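/- **Setting.** Let $r\ge 1$, and let $e^0,e^1,\dots,e^{r+1}$ be the standard basis of $\mathbb R^{r+2}$. Let $A_{r+1}=\{e^i-e^j : 0\le i,j\le r+1,\ i\ne j\}$, let $E$ be the $(r+1)$-dimensional span of $A_{r+1}$, and view the elements of $E$ as linear forms on $V=E^*$. Let $R_{A_{r+1}}$ be the ring of rational functions on $V$ generated by the polynomial functions and the inverses of the elements of $A_{r+1}$, and let $S_{A_{r+1}}\subset R_{A_{r+1}}$ be the real span of the functions $1/\prod_{\alpha\in\sigma}\alpha$, where $\sigma\subset A_{r+1}$ runs over the bases of $E$. Let $\partial(V)R_{A_{r+1}}$ be the span of all directional derivatives of elements of $R_{A_{r+1}}$. The total residue $\mathrm{Tres}_{A_{r+1}}(f)$ of $f\in R_{A_{r+1}}$ is its component in $S_{A_{r+1}}$ for the decomposition $R_{A_{r+1}}=\partial(V)R_{A_{r+1}}\oplus S_{A_{r+1}}$, that is, the unique $g\in S_{A_{r+1}}$ with $f-g\in\partial(V)R_{A_{r+1}}$. The group $\Sigma_r$ of permutations of $\{1,\dots,r\}$ acts by permuting $e^1,\dots,e^r$ (fixing $e^0,e^{r+1}$),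 and $\epsilon(w)$ is the sign of $w$. Put $f_\Pi=\dfrac{1}{(e^0-e^1)(e^1-e^2)\cdots(e^r-e^{r+1})}$ and, for $0\le\ell\le r$, $P_\ell=\sum_{w\in\Sigma_r}w\cdot\prod_{j=1}^{\ell}(e^j-e^{r+1})$. For integers $k_1,k_2,k_3\ge 0$ put $$\phi_{r+1}(\ell,k_1,k_2,k_3)=\frac{P_\ell}{\Big(\prod_{j=1}^r(e^j-e^{r+1})\Big)^{k_1}\Big(\prod_{j=1}^r(e^0-e^j)\Big)^{k_2}\Big(\prod_{1\le i<j\le r}(e^i-e^j)\Big)^{k_3}},$$ $$D=(k_1+k_2)r+k_3\frac{r(r-1)}2-\ell .$$ **Theorem.** (a) For all $r\ge1$, $0\le \ell\le r$ and $k_1,k_2,k_3\ge 0$, the rational function $(e^0-e^{r+1})^{D-(r+1)}\phi_{r+1}(\ell,k_1,k_2,k_3)$ is homogeneous of degree $-(r+1)$. There is a family of real constants $C_{r+1}(\ell,k_1,k_2,k_3)$ ($r\ge 1$, $0\le\ell\le r$, $k_1,k_2,k_3\ge0$) with the following properties. (b) If $D\ge r+1$, and if moreover $\ell=0$ or $(k_1,k_2,k_3)\neq(1,1,0)$,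 then $$\mathrm{Tres}_{A_{r+1}}\big((e^0-e^{r+1})^{D-(r+1)}\phi_{r+1}(\ell,k_1,k_2,k_3)\big)=\begin{cases}C_{r+1}(\ell,k_1,k_2,k_3)\displaystyle\sum_{w\in\Sigma_r}\epsilon(w)\,w\cdot f_\Pi,& k_3\text{ odd},\\[2mm] C_{r+1}(\ell,k_1,k_2,k_3)\displaystyle\sum_{w\in\Sigma_r}w\cdot f_\Pi,& k_3\text{ even}.\end{cases}$$ (c) The constants satisfy, for all $r\ge1$ and $k_1,k_2,k_3\ge0$ (unless restricted further): 1. for $1\le\ell\le r$: $\big(k_1+k_2-2+\tfrac{k_3}2(2r-\ell-1)\big)C_{r+1}(\ell,k_1,k_2,k_3)=\big(k_1-1+\tfrac{k_3}2(r-\ell)\big)C_{r+1}(\ell-1,k_1,k_2,k_3)$; 2. $C_{r+1}(r,k_1,k_2,k_3)=C_{r+1}(0,k_1-1,k_2,k_3)$ for $k_1\ge 1$; 3. $C_{r+1}(r-1,1,k_2,k_3)=C_r(0,k_3,k_2,k_3)$ for $r\ge2$; 4. $C_{r+1}(0,k_1,k_2,k_3)=C_{r+1}(0,k_2,k_1,k_3)$;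 5. $C_{r+1}(0,1,1,0)=r!$; 6. $C_{r+1}(\ell,k_1,k_2,k_3)=0$ for $0\le\ell\le r$ if $k_1=0$ or $k_2=0$; 7. $C_2(\ell,k_1,k_2,k_3)=C_2(\ell,k_1,k_2,0)$ for $\ell\in\{0,1\}$. (d) The relations 1–7 determine the constants uniquely, apart from the constants $C_{r+1}(\ell,1,1,0)$ with $1\le\ell\le r-2$: any family satisfying 1–7 agrees with $C$ at all other indices. (e) Let $r\ge2$. If $1\le\ell\le r$ and if $k_3>0$ or $k_1+k_2>2$, then $$C_{r+1}(\ell,k_1,k_2,k_3)=\prod_{j=1}^{\ell}\frac{k_1-1+(r-j)\frac{k_3}2}{k_1+k_2-2+(2r-j-1)\frac{k_3}2}\;C_{r+1}(0,k_1,k_2,k_3)$$ (if $k_1k_2=0$, a denominator may vanish; both sides are then read as $0$). If $k_1+k_2\ge2$, then $$C_{r+1}(0,k_1,k_2,k_3)=r!\prod_{j=0}^{r-1}\frac{\Gamma(1+\frac{k_3}2)\,\Gamma\big(k_1+k_2-1+(r+j-1)\frac{k_3}2\big)}{\Gamma\big(1+(j+1)\frac{k_3}2\big)\,\Gamma\big(k_1+j\frac{k_3}2\big)\,\Gamma\big(k_2+j\frac{k_3}2\big)},$$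 with the convention $1/\Gamma(0)=0$. -/

import Mathlib

/-!
Total residues of rational functions with poles on a hyperplane arrangement, and the
functions on the arrangement of type `A_{r+1}` needed for the statement.
-/

noncomputable section

namespace TotalResidue

section General

/-! ### Rational functions with poles on the hyperplanes `α = 0`, `α ∈ Δ`

`V = ℝ^ι`; a linear form on `V` is given by its coefficient vector `α : ι → ℝ`. -/

/-- The field of rational functions on `V = ℝ^ι`. -/
abbrev RatFun (ι : Type) : Type := FractionRing (MvPolynomial ι ℝ)

/-- The linear form `x ↦ ∑ i, α i * x i`, as a rational function. -/
def linForm {ι : Type} [Fintype ι] (α : ι → ℝ) : RatFun ι :=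
  algebraMap (MvPolynomial ι ℝ) (RatFun ι) (∑ i, MvPolynomial.C (α i) * MvPolynomial.X i)

/-- `R_Δ`: the ring generated by the polynomial functions on `V` and the inverses of the
linear forms in `Δ`. -/
def ringR {ι : Type} [Fintype ι] (Δ : Set (ι → ℝ)) : Subalgebra ℝ (RatFun ι) :=
  Algebra.adjoin ℝ
    (Set.range (algebraMap (MvPolynomial ι ℝ) (RatFun ι)) ∪ {f | ∃ α ∈ Δ, f = (linForm α)⁻¹})

/-- `σ` is a basis of `Δ`: a subset of `Δ` whose elements form a basis of `V^*`. -/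
def IsBasisOf {ι : Type} (Δ : Set (ι → ℝ)) (σ : Finset (ι → ℝ)) : Prop :=
  (σ : Set (ι → ℝ)) ⊆ Δ ∧ LinearIndependent ℝ (fun α : σ => (α : ι → ℝ)) ∧
    Submodule.span ℝ (σ : Set (ι → ℝ)) = ⊤

/-- `S_Δ`: the span of the simple fractions `f_σ = 1 / ∏_{α ∈ σ} α`, `σ` a basis of `Δ`. -/
def simpleS {ι : Type} [Fintype ι] (Δ : Set (ι → ℝ)) : Submodule ℝ (RatFun ι) :=
  Submodule.span ℝ {f | ∃ σ : Finset (ι → ℝ), IsBasisOf Δ σ ∧ f = (∏ α ∈ σ, linForm α)⁻¹}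

/-- The derivative `∂(v)` of polynomial functions in the direction `v ∈ V`. -/
def polyDeriv {ι : Type} (v : ι → ℝ) : Derivation ℝ (MvPolynomial ι ℝ) (MvPolynomial ι ℝ) :=
  MvPolynomial.mkDerivation ℝ (fun i => MvPolynomial.C (v i))

/-- The derivative `∂(v)` of rational functions in the direction `v ∈ V`: the derivation of
the field of rational functions that extends `polyDeriv v` (see `ratDeriv_algebraMap`). -/
def ratDeriv {ι : Type} (v : ι → ℝ) : Derivation ℝ (RatFun ι) (RatFun ι) :=
  haveI : Algebra.FormallyEtale (MvPolynomial ι ℝ) (RatFun ι) :=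
    Algebra.FormallyEtale.of_isLocalization (nonZeroDivisors (MvPolynomial ι ℝ))
  ((LinearMap.liftBaseChange (RatFun ι)
      (((Algebra.linearMap (MvPolynomial ι ℝ) (RatFun ι)).compDer
        (polyDeriv v)).liftKaehlerDifferential)).comp
    (KaehlerDifferential.tensorKaehlerEquivOfFormallyEtale ℝ (MvPolynomial ι ℝ)
      (RatFun ι)).symm.toLinearMap).compDer (KaehlerDifferential.D ℝ (RatFun ι))

theorem ratDeriv_algebraMap {ι : Type} (v : ι → ℝ) (p : MvPolynomial ι ℝ) :
    ratDeriv v (algebraMap (MvPolynomial ι ℝ) (RatFun ι) p) =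
      algebraMap (MvPolynomial ι ℝ) (RatFun ι) (polyDeriv v p) := by
  have : Algebra.FormallyEtale (MvPolynomial ι ℝ) (RatFun ι) :=
    Algebra.FormallyEtale.of_isLocalization (nonZeroDivisors (MvPolynomial ι ℝ))
  simp [ratDeriv, KaehlerDifferential.tensorKaehlerEquivOfFormallyEtale_symm_D_algebraMap]

/-- `∂(V) R_Δ`: the span of the derivatives `∂(v) f`, `v ∈ V`, `f ∈ R_Δ`. -/
def derivR {ι : Type} [Fintype ι] (Δ : Set (ι → ℝ)) : Submodule ℝ (RatFun ι) :=
  Submodule.span ℝ {g | ∃ v : ι → ℝ, ∃ f ∈ ringR Δ, g = ratDeriv v f}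

/-- `Tres_Δ f = g`: the element `g` is the component of `f ∈ R_Δ` in `S_Δ` with respect to
`R_Δ = ∂(V) R_Δ ⊕ S_Δ`, i.e. `g` is the one and only element of `S_Δ` with
`f - g ∈ ∂(V) R_Δ`. -/
def IsTotalResidue {ι : Type} [Fintype ι] (Δ : Set (ι → ℝ)) (f g : RatFun ι) : Prop :=
  f ∈ ringR Δ ∧ g ∈ simpleS Δ ∧ f - g ∈ derivR Δ ∧
    ∀ g' ∈ simpleS Δ, f - g' ∈ derivR Δ → g' = g

/-- The rational function `f` is homogeneous of degree `d ∈ ℤ`. -/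
def IsHomogeneousOfDegree {ι : Type} (f : RatFun ι) (d : ℤ) : Prop :=
  ∃ (p q : MvPolynomial ι ℝ) (m n : ℕ), p.IsHomogeneous m ∧ q.IsHomogeneous n ∧ q ≠ 0 ∧
    (m : ℤ) - n = d ∧
    f = algebraMap (MvPolynomial ι ℝ) (RatFun ι) p / algebraMap (MvPolynomial ι ℝ) (RatFun ι) q

end General

section TypeA

/-! ### The system `A_{r+1}`

The forms `e^0, …, e^{r+1}` are restricted to the `(r+1)`-dimensional space
`V = {x_{r+1} = 0}`, with coordinates `x_0, …, x_r`; this identifies the span of the roots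
`e^i - e^j` with `V^*`. -/

/-- The restriction of `e^i` to `V`: the coordinate `x_i` for `i ≤ r`, and `0` for `i = r+1`. -/
def coordForm (r : ℕ) : Fin (r + 2) → (Fin (r + 1) → ℝ) :=
  Fin.lastCases 0 (fun i => Pi.single i 1)

/-- The root system `A_{r+1} = {e^i - e^j : 0 ≤ i, j ≤ r+1, i ≠ j}`. -/
def rootsA (r : ℕ) : Set (Fin (r + 1) → ℝ) :=
  {α | ∃ i j : Fin (r + 2), i ≠ j ∧ α = coordForm r i - coordForm r j}

/-- The root `e^i - e^j` as a rational function on `V`. -/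
def rt (r : ℕ) (i j : Fin (r + 2)) : RatFun (Fin (r + 1)) :=
  linForm (coordForm r i - coordForm r j)

/-- The index `j + 1`, so that `mid 0, …, mid (r-1)` are the indices `1, …, r`. -/
def mid {r : ℕ} (j : Fin r) : Fin (r + 2) := j.castSucc.succ

/-- `Σ_r`: the permutations of the indices `0, …, r+1` which fix `0` and `r+1`, i.e. the
permutations of `{1, …, r}`. -/
def permS (r : ℕ) : Finset (Equiv.Perm (Fin (r + 2))) :=
  Finset.univ.filter (fun w => w 0 = 0 ∧ w (Fin.last (r + 1)) = Fin.last (r + 1))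

/-- `w · f_Π = 1 / ∏_{i=0}^{r} (e^{w(i)} - e^{w(i+1)})`. -/
def wfPi (r : ℕ) (w : Equiv.Perm (Fin (r + 2))) : RatFun (Fin (r + 1)) :=
  (∏ i : Fin (r + 1), rt r (w i.castSucc) (w i.succ))⁻¹

/-- `P_ℓ = ∑_{w ∈ Σ_r} w · [(e^1 - e^{r+1}) ⋯ (e^ℓ - e^{r+1})]`. -/
def polyP (r l : ℕ) : RatFun (Fin (r + 1)) :=
  ∑ w ∈ permS r, ∏ j ∈ Finset.univ.filter (fun j : Fin r => (j : ℕ) < l), rt r (w (mid j)) (Fin.last (r + 1))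

/-- The function `φ_{r+1}(ℓ, k₁, k₂, k₃)`. -/
def phi (r l k₁ k₂ k₃ : ℕ) : RatFun (Fin (r + 1)) :=
  polyP r l /
    ((∏ j : Fin r, rt r (mid j) (Fin.last (r + 1))) ^ k₁ *
      (∏ j : Fin r, rt r 0 (mid j)) ^ k₂ *
      (∏ i : Fin r, ∏ j ∈ Finset.univ.filter (fun j : Fin r => i < j), rt r (mid i) (mid j)) ^ k₃)

/-- `D = (k₁ + k₂) r + k₃ r (r-1) / 2 - ℓ`. -/
def degD (r l k₁ k₂ k₃ : ℕ) : ℤ :=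
  ((k₁ + k₂) * r + k₃ * (r * (r - 1) / 2) : ℕ) - (l : ℤ)

/-- The function `(e^0 - e^{r+1})^{D-(r+1)} φ_{r+1}(ℓ, k₁, k₂, k₃)`. -/
def morrisFun (r l k₁ k₂ k₃ : ℕ) : RatFun (Fin (r + 1)) :=
  rt r 0 (Fin.last (r + 1)) ^ (degD r l k₁ k₂ k₃ - (r + 1)) * phi r l k₁ k₂ k₃

/-- `∑_{w ∈ Σ_r} ε(w) w · f_Π` if `k₃` is odd, `∑_{w ∈ Σ_r} w · f_Π` if `k₃` is even. -/
def symSum (r k₃ : ℕ) : RatFun (Fin (r + 1)) :=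
  if Odd k₃ then ∑ w ∈ permS r, (((Equiv.Perm.sign w : ℤˣ) : ℤ) : ℝ) • wfPi r w
  else ∑ w ∈ permS r, wfPi r w

/-- The relations for a family of real constants `C r ℓ k₁ k₂ k₃`, written
`C_{r+1}(ℓ, k₁, k₂, k₃)` in mathematical notation, with `r ≥ 1` and `0 ≤ ℓ ≤ r`. The last relation says
that `C_2(ℓ, k₁, k₂, k₃)` does not depend on `k₃` (for `r = 1` there is no factor
`e^i - e^j` with `1 ≤ i < j ≤ r`). -/
structure MorrisRelations (C : ℕ → ℕ → ℕ → ℕ → ℕ → ℝ) : Prop where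
  recL : ∀ r l k₁ k₂ k₃ : ℕ, 1 ≤ l → l ≤ r →
    ((k₁ : ℝ) + k₂ - 2 + (k₃ : ℝ) / 2 * (2 * r - l - 1)) * C r l k₁ k₂ k₃ =
      ((k₁ : ℝ) - 1 + (k₃ : ℝ) / 2 * (r - l)) * C r (l - 1) k₁ k₂ k₃
  recK : ∀ r k₁ k₂ k₃ : ℕ, 1 ≤ r → 1 ≤ k₁ → C r r k₁ k₂ k₃ = C r 0 (k₁ - 1) k₂ k₃
  recR : ∀ r k₂ k₃ : ℕ, 2 ≤ r → C r (r - 1) 1 k₂ k₃ = C (r - 1) 0 k₃ k₂ k₃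
  symm : ∀ r k₁ k₂ k₃ : ℕ, 1 ≤ r → C r 0 k₁ k₂ k₃ = C r 0 k₂ k₁ k₃
  init : ∀ r : ℕ, 1 ≤ r → C r 0 1 1 0 = (Nat.factorial r : ℝ)
  vanish : ∀ r l k₁ k₂ k₃ : ℕ, 1 ≤ r → l ≤ r → (k₁ = 0 ∨ k₂ = 0) → C r l k₁ k₂ k₃ = 0
  base : ∀ l k₁ k₂ k₃ : ℕ, l ≤ 1 → C 1 l k₁ k₂ k₃ = C 1 l k₁ k₂ 0

end TypeA

end TotalResidue

end

/-! Two facts are needed: the sum ∂(V)R + S is direct, so that one representative certifies a total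
residue, and the function minus C times the (signed) sum over paths lies in ∂(V)R.

Directness. A basis of roots is a spanning tree on the vertices e^0, …, e^{r+1}. Removing leaves one
at a time and using partial fractions shows that S is spanned by the fractions of Hamiltonian paths
starting at the origin e^{r+1} (`inv_prod_mem_pathSpan`). Given such a path, expand rational
functions as Laurent series in the regime where the coordinates grow rapidly along it. The
coefficient of the product of all x_i⁻¹, an iterated residue, kills derivatives
(`coeff_expand_ratDeriv`), equals 1 on the given path and 0 on the other paths (`coeff_pathInv`).
Hence an element of both spaces is 0.

The residue. The constants are defined by the closed Gamma formula, which is checked to satisfy the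
relations. The function is then reduced along the same relations, modulo derivatives. The recurrence
in ℓ is Aomoto's argument: differentiate (e^0 − z) z times a monomial over the denominator and
symmetrize (`sum_ratDeriv_eq`). At ℓ = r the numerator cancels one power of the product of the e^j −
e^{r+1}, which lowers k₁. At ℓ = r − 1, k₁ = 1, each term keeps a single pole e^j − e^{r+1}; modulo
derivatives the power of e^0 may be replaced by that of e^0 − e^j, and the term comes from a
function of rank one less, with e^j as origin (`morrisFun_last_sub_mem`). The induction starts at k₁
= 1 without interaction between the variables: there they separate, and one-variable partial
fractions meet the closed form of the sum over all paths (`sum_chainInv`). If k₁ = 0 or k₂ = 0, the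
function itself is a sum of derivatives.

Uniqueness of the constants follows the same reductions. At (k₁, k₂, k₃) = (1, 1, 0) both
coefficients of the recurrence vanish, so 1 ≤ ℓ ≤ r − 2 stays free; the ratio then evaluates as 0/0
= 0, in accordance with the other relations. -/

noncomputable section

namespace TotalResidue

/-! ### Derivations and the ring R of a general arrangement -/

section General

variable {ι : Type}

/-- An algebra homomorphism out of the field of rational functions intertwines `∂(v)` with a
derivation `D` as soon as it does so on the coordinates. -/
theorem map_ratDeriv_of_X {K : Type*} [Field K] [Algebra ℝ K] (θ : RatFun ι →ₐ[ℝ] K)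
    (D : Derivation ℝ K K) (v : ι → ℝ)
    (h : ∀ i, D (θ (algebraMap (MvPolynomial ι ℝ) (RatFun ι) (MvPolynomial.X i))) =
      algebraMap ℝ K (v i)) (f : RatFun ι) :
    θ (ratDeriv v f) = D (θ f) := by
  have hp : ∀ p : MvPolynomial ι ℝ,
      θ (algebraMap (MvPolynomial ι ℝ) (RatFun ι) (polyDeriv v p)) =
        D (θ (algebraMap (MvPolynomial ι ℝ) (RatFun ι) p)) := by
    intro p
    induction p using MvPolynomial.induction_on with
    | C a =>
      have : algebraMap (MvPolynomial ι ℝ) (RatFun ι) (MvPolynomial.C a) =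
          algebraMap ℝ (RatFun ι) a := by
        rw [IsScalarTower.algebraMap_apply ℝ (MvPolynomial ι ℝ) (RatFun ι)]; rfl
      rw [this, AlgHom.commutes, Derivation.map_algebraMap, polyDeriv, MvPolynomial.derivation_C,
        map_zero, map_zero]
    | add p q hp hq => simp only [map_add, hp, hq]
    | mul_X p i hp =>
      have h2 : polyDeriv v (MvPolynomial.X i) = MvPolynomial.C (v i) := by
        simp [polyDeriv]
      have h3 : algebraMap (MvPolynomial ι ℝ) (RatFun ι) (MvPolynomial.C (v i)) =
          algebraMap ℝ (RatFun ι) (v i) := by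
        rw [IsScalarTower.algebraMap_apply ℝ (MvPolynomial ι ℝ) (RatFun ι)]; rfl
      simp only [Derivation.leibniz, map_mul, map_add, smul_eq_mul, h, hp, h2, h3,
        AlgHom.commutes]
  obtain ⟨p, q, hq, rfl⟩ := IsFractionRing.div_surjective (A := MvPolynomial ι ℝ) f
  rw [Derivation.leibniz_div, map_div₀, Derivation.leibniz_div]
  simp only [smul_eq_mul, map_mul, map_sub, map_pow, map_inv₀, ratDeriv_algebraMap, hp]

variable [Fintype ι]

theorem linForm_sub (α β : ι → ℝ) : linForm (α - β) = linForm α - linForm β := by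
  simp [linForm, sub_mul, Finset.sum_sub_distrib]

theorem linForm_zero : linForm (0 : ι → ℝ) = 0 := by simp [linForm]

theorem linForm_single [DecidableEq ι] (i : ι) : linForm (Pi.single i (1 : ℝ)) =
    algebraMap (MvPolynomial ι ℝ) (RatFun ι) (MvPolynomial.X i) := by
  rw [linForm, Finset.sum_eq_single i] <;> simp +contextual

theorem algebraMap_mem_ringR (Δ : Set (ι → ℝ)) (p : MvPolynomial ι ℝ) :
    algebraMap (MvPolynomial ι ℝ) (RatFun ι) p ∈ ringR Δ :=
  Algebra.subset_adjoin (Or.inl ⟨p, rfl⟩)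

theorem linForm_mem_ringR (Δ : Set (ι → ℝ)) (α : ι → ℝ) : linForm α ∈ ringR Δ :=
  algebraMap_mem_ringR _ _

theorem linForm_inv_mem_ringR {Δ : Set (ι → ℝ)} {α : ι → ℝ} (h : α ∈ Δ) :
    (linForm α)⁻¹ ∈ ringR Δ :=
  Algebra.subset_adjoin (Or.inr ⟨α, h, rfl⟩)

theorem ratDeriv_mem_derivR {Δ : Set (ι → ℝ)} (v : ι → ℝ) {f : RatFun ι} (h : f ∈ ringR Δ) :
    ratDeriv v f ∈ derivR Δ :=
  Submodule.subset_span ⟨v, f, h, rfl⟩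

/-- A factor killed by ∂(v) can be moved under the derivative; all factors independent of the active
variable are carried along in this way. -/
theorem ratDeriv_smul_mem_derivR {Δ : Set (ι → ℝ)} (v : ι → ℝ) {f c : RatFun ι} (h : f ∈ ringR Δ)
    (hc : c ∈ ringR Δ) (h0 : ratDeriv v c = 0) : c * ratDeriv v f ∈ derivR Δ := by
  have := ratDeriv_mem_derivR v (mul_mem hc h)
  rwa [Derivation.leibniz, h0, smul_zero, add_zero, smul_eq_mul] at this

end General

/-! ### Coordinates for the type A arrangement -/

section TypeA

/-- The coordinate functions `e^0, …, e^{r+1}` on `V`. -/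
def coord (r : ℕ) (i : Fin (r + 2)) : RatFun (Fin (r + 1)) := linForm (coordForm r i)

theorem rt_eq (r : ℕ) (i j : Fin (r + 2)) : rt r i j = coord r i - coord r j := linForm_sub _ _

@[simp] theorem coord_last (r : ℕ) : coord r (Fin.last (r + 1)) = 0 := by
  simp [coord, coordForm, linForm_zero]

theorem coord_castSucc (r : ℕ) (i : Fin (r + 1)) : coord r i.castSucc =
    algebraMap (MvPolynomial (Fin (r + 1)) ℝ) (RatFun (Fin (r + 1))) (MvPolynomial.X i) := by
  simp [coord, coordForm, linForm_single]

theorem coord_injective (r : ℕ) : Function.Injective (coord r) := by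
  have h0 : ∀ i : Fin (r + 1), coord r i.castSucc ≠ 0 := fun i => by
    rw [coord_castSucc, Ne, map_eq_zero_iff _ (IsFractionRing.injective _ _)]
    exact MvPolynomial.X_ne_zero i
  intro i j h
  induction i using Fin.lastCases with
  | last =>
    induction j using Fin.lastCases with
    | last => rfl
    | cast j => rw [coord_last] at h; exact absurd h.symm (h0 j)
  | cast i =>
    induction j using Fin.lastCases with
    | last => rw [coord_last] at h; exact absurd h (h0 i)
    | cast j =>
      rw [coord_castSucc, coord_castSucc] at h
      rw [MvPolynomial.X_injective (IsFractionRing.injective _ _ h)]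

theorem coord_sub_ne_zero {r : ℕ} {i j : Fin (r + 2)} (h : i ≠ j) : coord r i - coord r j ≠ 0 :=
  sub_ne_zero.2 fun h' => h (coord_injective r h')

theorem coord_mem (r : ℕ) (i : Fin (r + 2)) : coord r i ∈ ringR (rootsA r) :=
  linForm_mem_ringR _ _

theorem coord_sub_inv_mem {r : ℕ} {i j : Fin (r + 2)} (h : i ≠ j) :
    (coord r i - coord r j)⁻¹ ∈ ringR (rootsA r) := by
  rw [← rt_eq]; exact linForm_inv_mem_ringR ⟨i, j, h, rfl⟩

theorem ratDeriv_coord (r : ℕ) (v : Fin (r + 1) → ℝ) (i : Fin (r + 2)) :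
    ratDeriv v (coord r i) =
      algebraMap ℝ (RatFun (Fin (r + 1))) (Fin.snoc (α := fun _ => ℝ) v 0 i) := by
  induction i using Fin.lastCases with
  | last => simp
  | cast i =>
    rw [coord_castSucc, ratDeriv_algebraMap, polyDeriv, MvPolynomial.mkDerivation_X,
      Fin.snoc_castSucc, IsScalarTower.algebraMap_apply ℝ (MvPolynomial (Fin (r + 1)) ℝ)
        (RatFun (Fin (r + 1)))]
    rfl

end TypeA

/-! ### Fractions attached to paths -/

section Path

variable {K : Type*} [Field K]

/-- The product of the inverses of the successive differences along the path `c, L`. -/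
def pathInv : K → List K → K
  | _, [] => 1
  | c, q :: L => (q - c)⁻¹ * pathInv q L

theorem map_pathInv {K' : Type*} [Field K'] (θ : K →+* K') (c : K) (L : List K) :
    θ (pathInv c L) = pathInv (θ c) (L.map θ) := by
  induction L generalizing c with
  | nil => simp [pathInv]
  | cons q L ih => simp [pathInv, ih]

end Path

/-! ### Iterated Laurent series and iterated residues of path fractions -/

section Laurent

/-- Exponents of iterated Laurent series, ordered lexicographically. -/
abbrev Expo : Type := Lex (ℕ → ℤ)

/-- Iterated Laurent series. -/
abbrev IterLaurent : Type := HahnSeries Expo ℝ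

/-- The exponent of the `k`-th variable. -/
def unitExpo (k : ℕ) : Expo := toLex (Pi.single k 1)

/-- The `k`-th variable. -/
def lvar (k : ℕ) : IterLaurent := HahnSeries.single (unitExpo k) 1

/-- The derivation `x_k ∂/∂x_k` of iterated Laurent series. -/
def euler (k : ℕ) : Derivation ℝ IterLaurent IterLaurent :=
  Derivation.mk'
    { toFun := fun f =>
        { coeff := fun a => (ofLex a k : ℝ) * f.coeff a
          isPWO_support' := f.isPWO_support.mono fun a ha => by
            simp only [Function.mem_support, HahnSeries.mem_support] at ha ⊢
            exact right_ne_zero_of_mul ha }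
      map_add' := fun f g => by ext a; simp [mul_add]
      map_smul' := fun c f => by ext a; simp; ring }
    (by
      intro f g
      set E : IterLaurent → IterLaurent := fun f =>
        { coeff := fun a => (ofLex a k : ℝ) * f.coeff a
          isPWO_support' := f.isPWO_support.mono fun a ha => by
            simp only [Function.mem_support, HahnSeries.mem_support] at ha ⊢
            exact right_ne_zero_of_mul ha } with hE
      have hs : ∀ f, (E f).support ⊆ f.support := fun f a ha => by
        simp only [hE, HahnSeries.mem_support] at ha ⊢
        exact right_ne_zero_of_mul ha
      change E (f * g) = f * E g + g * E f
      rw [mul_comm g]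
      ext a
      -- The operator does not enlarge supports, so all three convolutions can be summed over the
      -- same pairs, where the weight of a sum of exponents is additive.
      rw [HahnSeries.coeff_add, HahnSeries.coeff_mul_right' g.isPWO_support (hs g),
        HahnSeries.coeff_mul_left' f.isPWO_support (hs f), ← Finset.sum_add_distrib]
      simp only [hE, HahnSeries.coeff_mul, Finset.mul_sum]
      refine Finset.sum_congr rfl fun ij hij => ?_
      have : ij.1 + ij.2 = a := by
        simpa using (Finset.mem_antidiagonal.1 hij).2.2
      rw [← this, ofLex_add, Pi.add_apply]
      push_cast
      ring)

theorem coeff_euler (k : ℕ) (f : IterLaurent) (a : Expo) :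
    (euler k f).coeff a = (ofLex a k : ℝ) * f.coeff a := rfl

theorem euler_lvar (k j : ℕ) : euler k (lvar j) = if k = j then lvar j else 0 := by
  ext a
  rw [coeff_euler]
  by_cases ha : a = unitExpo j
  · subst ha
    split_ifs with h
    · subst h; simp [unitExpo, lvar]
    · simp [unitExpo, h]
  · rw [lvar, HahnSeries.coeff_single_of_ne ha]
    split_ifs
    · rw [HahnSeries.coeff_single_of_ne ha]; simp
    · simp

theorem lvar_ne_zero (k : ℕ) : lvar k ≠ 0 := by simp [lvar]

/-- A derivative has no residue: the coefficient at x_k⁻¹ of x_k⁻¹ · `euler k f` comes from exponent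
0 in x_k, and `euler` multiplies it by that exponent. -/
theorem coeff_inv_lvar_mul_euler (k : ℕ) (f : IterLaurent) (a : Expo) (ha : ofLex a k = -1) :
    ((lvar k)⁻¹ * euler k f).coeff a = 0 := by
  rw [lvar, HahnSeries.inv_single, HahnSeries.coeff_single_mul, coeff_euler]
  have : ofLex (a - -unitExpo k) k = 0 := by
    rw [ofLex_sub, ofLex_neg, Pi.sub_apply, Pi.neg_apply, ha]; simp [unitExpo]
  rw [this, Int.cast_zero, zero_mul, mul_zero]

theorem ofLex_nsmul_apply (c : ℕ) (a : Expo) (i : ℕ) : ofLex (c • a) i = c * ofLex a i := by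
  induction c with
  | zero => rw [zero_nsmul]; simp; rfl
  | succ c ih => rw [succ_nsmul, ofLex_add, Pi.add_apply, ih]; push_cast; ring

/-- The expansion of polynomials, where the variable `i` goes to `lvar (τ i)`. -/
def expandPoly {n : ℕ} (τ : Fin n → ℕ) : MvPolynomial (Fin n) ℝ →ₐ[ℝ] IterLaurent :=
  MvPolynomial.aeval fun i => lvar (τ i)

theorem expandPoly_monomial {n : ℕ} (τ : Fin n → ℕ) (s : Fin n →₀ ℕ) (c : ℝ) :
    expandPoly τ (MvPolynomial.monomial s c) =
      HahnSeries.single (∑ i, s i • unitExpo (τ i)) c := by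
  rw [expandPoly, MvPolynomial.aeval_monomial, Finsupp.prod_fintype _ _ (by simp)]
  have : ∀ t : Finset (Fin n), ∏ i ∈ t, lvar (τ i) ^ s i =
      HahnSeries.single (∑ i ∈ t, s i • unitExpo (τ i)) (1 : ℝ) := by
    intro t
    induction t using Finset.induction_on with
    | empty => simp
    | insert a t ha ih =>
      rw [Finset.prod_insert ha, Finset.sum_insert ha, ih, lvar, HahnSeries.single_pow,
        HahnSeries.single_mul_single]
      simp
  rw [this, HahnSeries.algebraMap_apply, HahnSeries.C_apply, HahnSeries.single_mul_single]
  simp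

theorem expandPoly_injective {n : ℕ} {τ : Fin n → ℕ} (hτ : Function.Injective τ) :
    Function.Injective (expandPoly τ) := by
  have hinj : ∀ s t : Fin n →₀ ℕ,
      ∑ i, s i • unitExpo (τ i) = ∑ i, t i • unitExpo (τ i) → s = t := by
    have key : ∀ (s : Fin n →₀ ℕ) j, ofLex (∑ i, s i • unitExpo (τ i)) (τ j) = s j := by
      intro s j
      have : ∀ u : Finset (Fin n), ofLex (∑ i ∈ u, s i • unitExpo (τ i)) (τ j) =
          ∑ i ∈ u, (s i : ℤ) * (Pi.single (τ i) 1 : ℕ → ℤ) (τ j) := by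
        intro u
        induction u using Finset.induction_on with
        | empty => rfl
        | insert a u ha ih =>
          rw [Finset.sum_insert ha, Finset.sum_insert ha, ofLex_add, Pi.add_apply, ih, ofLex_nsmul_apply,
            unitExpo, ofLex_toLex]
      rw [this, Finset.sum_eq_single j]
      · simp
      · intro b _ hb
        rw [Pi.single_eq_of_ne (fun h => hb (hτ h).symm), mul_zero]
      · simp
    intro s t h
    ext j
    have := key s j
    rw [h, key t j] at this
    exact_mod_cast this.symm
  rw [injective_iff_map_eq_zero]
  intro p hp
  ext s
  have := congrArg (fun f : IterLaurent => f.coeff (∑ i, s i • unitExpo (τ i))) hp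
  rw [p.as_sum, map_sum] at this
  simp only [expandPoly_monomial, HahnSeries.coeff_sum, HahnSeries.coeff_zero] at this
  rw [Finset.sum_eq_single s] at this
  · simpa using this
  · intro t _ hts
    rw [HahnSeries.coeff_single_of_ne]
    exact fun h => hts (hinj _ _ h).symm
  · intro hs
    simp [MvPolynomial.notMem_support_iff.1 hs]

/-- The expansion of rational functions into iterated Laurent series. -/
def expand {n : ℕ} {τ : Fin n → ℕ} (hτ : Function.Injective τ) :
    RatFun (Fin n) →ₐ[ℝ] IterLaurent :=
  IsFractionRing.liftAlgHom (expandPoly_injective hτ)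

theorem expand_X {n : ℕ} {τ : Fin n → ℕ} (hτ : Function.Injective τ) (i : Fin n) :
    expand hτ (algebraMap (MvPolynomial (Fin n) ℝ) (RatFun (Fin n)) (MvPolynomial.X i)) =
      lvar (τ i) := by
  rw [expand, IsFractionRing.liftAlgHom_apply, IsFractionRing.lift_algebraMap]
  simp [expandPoly]

theorem coeff_expand_ratDeriv {n : ℕ} {τ : Fin n → ℕ} (hτ : Function.Injective τ)
    (v : Fin n → ℝ) (f : RatFun (Fin n)) (a : Expo) (ha : ∀ i, ofLex a (τ i) = -1) :
    (expand hτ (ratDeriv v f)).coeff a = 0 := by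
  -- The derivative in the direction `v`, written as the sum of v_i ∂/∂x_{τ i} with ∂/∂x = x⁻¹ · (x
  -- ∂/∂x).
  let D : Derivation ℝ IterLaurent IterLaurent :=
    ∑ i, v i • (lvar (τ i))⁻¹ • euler (τ i)
  have hD : ∀ g, D g = ∑ i, v i • ((lvar (τ i))⁻¹ * euler (τ i) g) := by
    intro g
    simp only [D]
    rw [show (∑ i, v i • (lvar (τ i))⁻¹ • euler (τ i)) g =
      Derivation.coeFnAddMonoidHom (∑ i, v i • (lvar (τ i))⁻¹ • euler (τ i)) g from rfl,
      map_sum, Finset.sum_apply]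
    rfl
  rw [map_ratDeriv_of_X (expand hτ) D v, hD, HahnSeries.coeff_sum]
  · refine Finset.sum_eq_zero fun i _ => ?_
    rw [HahnSeries.coeff_smul, coeff_inv_lvar_mul_euler _ _ _ (ha i), smul_zero]
  · intro j
    rw [expand_X, hD, Finset.sum_eq_single j]
    · rw [euler_lvar, if_pos rfl, inv_mul_cancel₀ (lvar_ne_zero _), Algebra.algebraMap_eq_smul_one]
    · intro i _ hij
      rw [euler_lvar, if_neg (fun h => hij (hτ h)), mul_zero, smul_zero]
    · simp

/-- The position of the `k`-th vertex of a path: the vertex `0` is the origin. -/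
def vert (k : ℕ) : IterLaurent := if k = 0 then 0 else lvar k

/-- The leading exponent of `pathInv (vert p) (M.map vert)`. -/
def pathExpo : ℕ → List ℕ → Expo
  | _, [] => 0
  | p, q :: M => -unitExpo (max p q) + pathExpo q M

/-- Later variables have smaller exponents and hence lead: the regime is |x_1| ≪ |x_2| ≪ …, and
1/(x_q − x_p) with p < q expands in powers of x_p/x_q. -/
theorem unitExpo_lt {i j : ℕ} (h : i < j) : unitExpo j < unitExpo i := by
  refine ⟨i, fun k hk => ?_, ?_⟩
  · simp [unitExpo, hk.ne, (hk.trans h).ne]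
  · simp [unitExpo, h.ne]

theorem order_leadingCoeff_vert_sub {p q : ℕ} (hq : q ≠ 0) (h : p < q) :
    vert q - vert p ≠ 0 ∧ (vert q - vert p).order = unitExpo q ∧
      (vert q - vert p).leadingCoeff = 1 := by
  have hlt : (lvar q).orderTop < (vert p).orderTop := by
    rw [lvar, HahnSeries.orderTop_single one_ne_zero, vert]
    split_ifs with h0
    · simp
    · rw [lvar, HahnSeries.orderTop_single one_ne_zero]
      exact WithTop.coe_lt_coe.2 (unitExpo_lt h)
  have ho := HahnSeries.orderTop_sub hlt
  have hl := HahnSeries.leadingCoeff_sub hlt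
  have hv : vert q = lvar q := by simp [vert, hq]
  have hne : lvar q - vert p ≠ 0 := by
    intro h0
    rw [h0, HahnSeries.orderTop_zero] at ho
    exact not_top_lt (ho ▸ hlt)
  rw [hv]
  refine ⟨hne, ?_, by rw [hl]; simp [lvar]⟩
  have := HahnSeries.order_eq_orderTop_of_ne_zero hne
  rw [ho, lvar, HahnSeries.orderTop_single one_ne_zero] at this
  exact WithTop.coe_injective this

theorem vert_sub {p q : ℕ} (hq : q ≠ 0) (h : p ≠ q) :
    vert q - vert p ≠ 0 ∧ (vert q - vert p).order = unitExpo (max p q) := by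
  rcases h.lt_or_gt with h | h
  · obtain ⟨h1, h2, -⟩ := order_leadingCoeff_vert_sub hq h
    rw [max_eq_right h.le]
    exact ⟨h1, h2⟩
  · obtain ⟨h1, h2, -⟩ := order_leadingCoeff_vert_sub (by omega) h
    rw [max_eq_left h.le, ← neg_sub, HahnSeries.order_neg, neg_ne_zero]
    exact ⟨h1, h2⟩

theorem order_inv_of_ne_zero {f : IterLaurent} (hf : f ≠ 0) : f⁻¹.order = -f.order := by
  have := HahnSeries.order_mul hf (inv_ne_zero hf)
  rw [mul_inv_cancel₀ hf, HahnSeries.order_one] at this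
  exact (neg_eq_of_add_eq_zero_right this.symm).symm

theorem order_pathInv {p : ℕ} {M : List ℕ} (hM : (p :: M).Nodup) (h0 : 0 ∉ M) :
    pathInv (vert p) (M.map vert) ≠ 0 ∧
      (pathInv (vert p) (M.map vert)).order = pathExpo p M := by
  induction M generalizing p with
  | nil => simp [pathInv, pathExpo]
  | cons q M ih =>
    obtain ⟨h1, h2⟩ := ih (List.nodup_cons.1 hM).2 (fun h => h0 (List.mem_cons_of_mem _ h))
    have hpq : p ≠ q := by simp at hM; tauto
    have hq : q ≠ 0 := by rintro rfl; simp at h0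
    obtain ⟨h3, h4⟩ := vert_sub hq hpq
    simp only [List.map_cons, pathInv, pathExpo]
    refine ⟨mul_ne_zero (inv_ne_zero h3) h1, ?_⟩
    rw [HahnSeries.order_mul (inv_ne_zero h3) h1, h2, order_inv_of_ne_zero h3, h4]

theorem leadingCoeff_pathInv_range' (p m : ℕ) :
    (pathInv (vert p) ((List.range' (p + 1) m).map vert)).leadingCoeff = 1 := by
  induction m generalizing p with
  | zero => simp [pathInv]
  | succ m ih =>
    obtain ⟨h1, -, h3⟩ := order_leadingCoeff_vert_sub (Nat.succ_ne_zero p) (Nat.lt_succ_self p)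
    rw [List.range'_succ, List.map_cons, pathInv, HahnSeries.leadingCoeff_mul, ih, mul_one]
    have := HahnSeries.leadingCoeff_mul (vert (p + 1) - vert p) (vert (p + 1) - vert p)⁻¹
    rw [mul_inv_cancel₀ h1, h3, one_mul, HahnSeries.leadingCoeff_one] at this
    exact this.symm

/-- Each edge contributes only at its larger endpoint, and the larger of two distinct vertices that
are at least `k` exceeds `k`. -/
theorem pathExpo_apply_eq_zero {p k : ℕ} {M : List ℕ} (hM : (p :: M).Nodup)
    (hp : k ≤ p) (hk : ∀ q ∈ M, k ≤ q) {i : ℕ} (hi : i ≤ k) : ofLex (pathExpo p M) i = 0 := by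
  induction M generalizing p with
  | nil => rfl
  | cons q M ih =>
    have hpq : p ≠ q := by simp at hM; tauto
    have hq := hk q (by simp)
    rw [pathExpo, ofLex_add, Pi.add_apply,
      ih (List.nodup_cons.1 hM).2 hq (fun x hx => hk x (List.mem_cons_of_mem _ hx)), ofLex_neg]
    have : i ≠ max p q := by
      rcases hpq.lt_or_gt with h | h
      · rw [max_eq_right h.le]; omega
      · rw [max_eq_left h.le]; omega
    simp [unitExpo, this]

theorem pathExpo_range'_apply (p m i : ℕ) : ofLex (pathExpo p (List.range' (p + 1) m)) i =
    if p + 1 ≤ i ∧ i < p + 1 + m then -1 else 0 := by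
  induction m generalizing p with
  | zero => rw [if_neg (by omega)]; rfl
  | succ m ih =>
    rw [List.range'_succ, pathExpo, ofLex_add, Pi.add_apply, ih, ofLex_neg, Pi.neg_apply, unitExpo,
      ofLex_toLex, max_eq_right (Nat.le_succ p), Pi.single_apply]
    split_ifs <;> omega

/-- Where a path first leaves the increasing one it skips the vertex p + 1. From then on p + 1 is
never the larger endpoint of an edge, so its exponent is 0 instead of −1, while all earlier
exponents agree. -/
theorem pathExpo_range'_lt {p m : ℕ} {M : List ℕ} (hM : M.Perm (List.range' (p + 1) m))
    (hne : M ≠ List.range' (p + 1) m) :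
    pathExpo p (List.range' (p + 1) m) < pathExpo p M := by
  induction m generalizing p M with
  | zero => simp at hM; simp [hM] at hne
  | succ m ih =>
    match M with
    | [] => simp at hM
    | q :: M =>
      by_cases hq : q = p + 1
      · subst hq
        rw [List.range'_succ] at hM hne ⊢
        rw [List.perm_cons] at hM
        exact add_lt_add_right (ih hM fun h => hne (by rw [h])) _
      · have hnd : (q :: M).Nodup := hM.nodup_iff.2 List.nodup_range'
        have hmem : ∀ x ∈ q :: M, p + 1 ≤ x := fun x hx => by
          have := hM.mem_iff.1 hx
          rw [List.mem_range'_1] at this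
          exact this.1
        have hq' := hmem q (by simp)
        have hz : ∀ i ≤ p + 1, ofLex (pathExpo p (q :: M)) i = 0 := by
          intro i hi
          rw [pathExpo, ofLex_add, Pi.add_apply,
            pathExpo_apply_eq_zero hnd hq' (fun x hx => hmem x (List.mem_cons_of_mem _ hx)) hi,
            ofLex_neg, max_eq_right (by omega)]
          have : i ≠ q := by omega
          simp [unitExpo, this]
        refine ⟨p + 1, fun j hj => ?_, ?_⟩
        · change ofLex (pathExpo p (List.range' (p + 1) (m + 1))) j = ofLex (pathExpo p (q :: M)) j
          rw [pathExpo_range'_apply, hz j hj.le, if_neg (by omega)]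
        · change ofLex (pathExpo p (List.range' (p + 1) (m + 1))) (p + 1) <
            ofLex (pathExpo p (q :: M)) (p + 1)
          rw [pathExpo_range'_apply, hz _ le_rfl, if_pos (by omega)]
          norm_num

/-- Duality of paths and iterated residues: the exponent is the leading one for the increasing path,
with coefficient 1, and lies below the order of every other path fraction. -/
theorem coeff_pathInv {m : ℕ} {M : List ℕ} (hM : M.Perm (List.range' 1 m)) :
    (pathInv 0 (M.map vert)).coeff (pathExpo 0 (List.range' 1 m)) =
      if M = List.range' 1 m then 1 else 0 := by
  have h0 : (0 : IterLaurent) = vert 0 := by simp [vert]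
  have hmem : ∀ N : List ℕ, N.Perm (List.range' 1 m) → 0 ∉ N := fun N hN h => by
    have := hN.mem_iff.1 h
    simp [List.mem_range'_1] at this
  have hnd : ∀ N : List ℕ, N.Perm (List.range' 1 m) → (0 :: N).Nodup := fun N hN =>
    List.nodup_cons.2 ⟨hmem N hN, hN.nodup_iff.2 List.nodup_range'⟩
  rw [h0]
  split_ifs with h
  · have h1 := (order_pathInv (hnd M hM) (hmem M hM)).2
    have h2 := leadingCoeff_pathInv_range' 0 m
    rw [zero_add, ← h, HahnSeries.leadingCoeff_eq, h1] at h2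
    rw [← h]
    exact h2
  · refine HahnSeries.coeff_eq_zero_of_lt_order ?_
    rw [(order_pathInv (hnd M hM) (hmem M hM)).2]
    exact pathExpo_range'_lt (p := 0) (by simpa using hM) (by simpa using h)

end Laurent

/-! ### Attaching a vertex to a path by partial fractions -/

section Path

variable {K : Type*} [Field K] [Algebra ℝ K] {ι : Type*}

/-- Adding a vertex `v` attached to the origin of a path. -/
theorem inv_mul_pathInv_mem_span (x : ι → K) (v : ι) (c : K) (L : List ι) (hc : x v ≠ c)
    (hL : ∀ q ∈ L, x v ≠ x q) (hcL : ((L.map x).head? ≠ some c)) (hch : (L.map x).IsChain (· ≠ ·)) :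
    (x v - c)⁻¹ * pathInv c (L.map x) ∈
      Submodule.span ℝ {f | ∃ L' : List ι, L'.Perm (v :: L) ∧ f = pathInv c (L'.map x)} := by
  induction L generalizing c with
  | nil => exact Submodule.subset_span ⟨[v], List.Perm.refl _, by simp [pathInv]⟩
  | cons q L ih =>
    have hq : x q ≠ c := by simpa using hcL
    have hvq := hL q (by simp)
    -- Either `v` is inserted between the origin and `q`, or its edge is passed on from the origin
    -- to `q`, where the induction hypothesis applies.
    have h1 : (x v - c)⁻¹ * pathInv c ((q :: L).map x) = pathInv c ((v :: q :: L).map x) +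
        (x q - c)⁻¹ * ((x v - x q)⁻¹ * pathInv (x q) (L.map x)) := by
      simp only [List.map_cons, pathInv]
      have h1 := sub_ne_zero.2 hc
      have h2 := sub_ne_zero.2 hq
      have h3 := sub_ne_zero.2 hvq
      have h4 := sub_ne_zero.2 hvq.symm
      have : (x v - c)⁻¹ * (x q - c)⁻¹ = (x v - c)⁻¹ * (x q - x v)⁻¹ +
          (x q - c)⁻¹ * (x v - x q)⁻¹ := by
        rw [← neg_sub (x v) (x q)] at h4 ⊢
        field_simp
        ring
      rw [← mul_assoc, this]
      ring
    rw [h1]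
    refine add_mem (Submodule.subset_span ⟨_, List.Perm.refl _, rfl⟩) ?_
    rw [List.map_cons, List.isChain_cons] at hch
    have := ih (x q) hvq (fun y hy => hL y (List.mem_cons_of_mem _ hy))
      (fun h => hch.1 _ h rfl) hch.2
    have h2 := Submodule.mem_map_of_mem (f := LinearMap.mulLeft ℝ (x q - c)⁻¹) this
    rw [Submodule.map_span] at h2
    refine Submodule.span_mono ?_ h2
    rintro _ ⟨_, ⟨L', hL', rfl⟩, rfl⟩
    exact ⟨q :: L', (hL'.cons q).trans (List.Perm.swap _ _ _), by simp [pathInv]⟩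

/-- Adding a vertex `v` attached to a vertex of a path. -/
theorem inv_mul_pathInv_mem_span_of_mem (x : ι → K) (hx : Function.Injective x) (v : ι) (c : K)
    (L : List ι) (hL : L.Nodup) (hv : v ∉ L) (u : ι) (hu : u ∈ L) :
    (x v - x u)⁻¹ * pathInv c (L.map x) ∈
      Submodule.span ℝ {f | ∃ L' : List ι, L'.Perm (v :: L) ∧ f = pathInv c (L'.map x)} := by
  induction L generalizing c with
  | nil => simp at hu
  | cons q L ih =>
    have key : (x v - x u)⁻¹ * pathInv (x q) (L.map x) ∈
        Submodule.span ℝ {f | ∃ L' : List ι, L'.Perm (v :: L) ∧ f = pathInv (x q) (L'.map x)} := by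
      rw [List.nodup_cons] at hL
      rcases List.mem_cons.1 hu with rfl | hu
      · refine inv_mul_pathInv_mem_span x v (x u) L (fun h => hv (by simp [hx h]))
          (fun y hy h => hv (by simp [hx h, hy])) ?_ ?_
        · intro h
          have := List.mem_of_mem_head? (Option.mem_def.2 h)
          rw [List.mem_map] at this
          obtain ⟨y, hy, hyu⟩ := this
          exact hL.1 (hx hyu ▸ hy)
        · exact List.Pairwise.isChain (List.Nodup.map hx hL.2)
      · exact ih (x q) hL.2 (fun h => hv (by simp [h])) hu
    have h2 := Submodule.mem_map_of_mem (f := LinearMap.mulLeft ℝ (x q - c)⁻¹) key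
    rw [Submodule.map_span] at h2
    have h3 : (x v - x u)⁻¹ * pathInv c ((q :: L).map x) =
        LinearMap.mulLeft ℝ (x q - c)⁻¹ ((x v - x u)⁻¹ * pathInv (x q) (L.map x)) := by
      simp [pathInv]; ring
    rw [h3]
    refine Submodule.span_mono ?_ h2
    rintro _ ⟨_, ⟨L', hL', rfl⟩, rfl⟩
    exact ⟨q :: L', (hL'.cons q).trans (List.Perm.swap _ _ _), by simp [pathInv]⟩

end Path

/-! ### Trees to paths; directness of ∂(V)R + S -/

section TypeA

/-- The paths from the origin `e^{r+1}` through the vertices of `T`. -/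
def pathSpan (r : ℕ) (T : Finset (Fin (r + 1))) : Submodule ℝ (RatFun (Fin (r + 1))) :=
  Submodule.span ℝ {f | ∃ L : List (Fin (r + 1)), L.Nodup ∧ L.toFinset = T ∧
    f = pathInv 0 (L.map fun i => coord r i.castSucc)}

theorem coordForm_castSucc (r : ℕ) (i : Fin (r + 1)) :
    coordForm r i.castSucc = Pi.single i 1 := by simp [coordForm]

theorem coordForm_last (r : ℕ) : coordForm r (Fin.last (r + 1)) = 0 := by simp [coordForm]

/-- A root is, up to sign, the difference of a coordinate at which it does not vanish and another
vertex; it is `±(e^v - e^{r+1})` or `±(e^v - e^u)`. -/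
theorem rootsA_cases {r : ℕ} {α : Fin (r + 1) → ℝ} (hα : α ∈ rootsA r) {v : Fin (r + 1)}
    (hv : α v ≠ 0) :
    ∃ s : ℝ, s ≠ 0 ∧ ((α = s • Pi.single v 1) ∨
      ∃ u, u ≠ v ∧ α = s • (Pi.single v 1 - Pi.single u 1)) := by
  obtain ⟨i, j, hij, rfl⟩ := hα
  induction i using Fin.lastCases with
  | last =>
    induction j using Fin.lastCases with
    | last => exact absurd rfl hij
    | cast j =>
      rw [coordForm_last, coordForm_castSucc] at hv ⊢
      have : v = j := by by_contra h; simp [h] at hv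
      subst this
      exact ⟨-1, by norm_num, Or.inl (by simp)⟩
  | cast i =>
    induction j using Fin.lastCases with
    | last =>
      rw [coordForm_last, coordForm_castSucc] at hv ⊢
      have : v = i := by by_contra h; simp [h] at hv
      subst this
      exact ⟨1, by norm_num, Or.inl (by simp)⟩
    | cast j =>
      rw [coordForm_castSucc, coordForm_castSucc] at hv ⊢
      have hne : i ≠ j := fun h => hij (by rw [h])
      by_cases h : v = i
      · subst h
        exact ⟨1, by norm_num, Or.inr ⟨j, hne.symm, by simp⟩⟩
      · by_cases h' : v = j
        · subst h'
          exact ⟨-1, by norm_num, Or.inr ⟨i, hne, by simp⟩⟩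
        · simp [h, h'] at hv

theorem linForm_smul {ι : Type} [Fintype ι] (s : ℝ) (α : ι → ℝ) :
    linForm (s • α) = s • linForm α := by
  simp only [linForm, Pi.smul_apply, smul_eq_mul, map_mul, mul_assoc]
  rw [← Finset.mul_sum, map_mul, Algebra.smul_def,
    IsScalarTower.algebraMap_apply ℝ (MvPolynomial ι ℝ) (RatFun ι)]
  rfl

theorem linForm_single_castSucc (r : ℕ) (i : Fin (r + 1)) :
    linForm (Pi.single i (1 : ℝ)) = coord r i.castSucc := by
  rw [coord, coordForm_castSucc]

theorem eq_zero_of_dot_eq_zero {n : ℕ} {σ : Finset (Fin n → ℝ)} {T : Finset (Fin n)}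
    (hT : ∀ i ∈ T, (Pi.single i 1 : Fin n → ℝ) ∈ Submodule.span ℝ (σ : Set (Fin n → ℝ)))
    (u : Fin n → ℝ) (hu : ∀ α ∈ σ, u ⬝ᵥ α = 0) {i : Fin n} (hi : i ∈ T) : u i = 0 := by
  have : ∀ w ∈ Submodule.span ℝ (σ : Set (Fin n → ℝ)), u ⬝ᵥ w = 0 := by
    intro w hw
    induction hw using Submodule.span_induction with
    | mem x hx => exact hu x hx
    | zero => simp
    | add x y _ _ hx hy => rw [dotProduct_add, hx, hy, add_zero]
    | smul a x _ hx => rw [dotProduct_smul, hx, smul_zero]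
  simpa using this _ (hT i hi)

open Finset in
/-- A spanning set of `|T|` roots on the nonempty vertex set `T` has a leaf. -/
theorem exists_leaf {r : ℕ} {σ : Finset (Fin (r + 1) → ℝ)} {T : Finset (Fin (r + 1))}
    (hσ : (σ : Set (Fin (r + 1) → ℝ)) ⊆ rootsA r)
    (hT : ∀ i ∈ T, (Pi.single i 1 : Fin (r + 1) → ℝ) ∈
      Submodule.span ℝ (σ : Set (Fin (r + 1) → ℝ)))
    (hcard : #σ = #T) (hne : T.Nonempty) :
    ∃ v ∈ T, ∃ α ∈ σ, α v ≠ 0 ∧ ∀ β ∈ σ, β ≠ α → β v = 0 := by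
  classical
  by_contra hcon
  push Not at hcon
  -- Without a leaf every vertex of `T` meets at least two roots; it meets one at all because
  -- otherwise its unit vector would be orthogonal to `σ`.
  have hd : ∀ v ∈ T, 2 ≤ #{α ∈ σ | α v ≠ 0} := by
    intro v hv
    have h1 : ∃ α ∈ σ, α v ≠ 0 := by
      by_contra h
      push Not at h
      have := eq_zero_of_dot_eq_zero hT (Pi.single v 1) (fun α hα => by simp [h α hα]) hv
      simp at this
    obtain ⟨α, hα, hαv⟩ := h1
    obtain ⟨β, hβ, hβα, hβv⟩ := hcon v hv α hα hαv
    exact one_lt_card.2 ⟨α, by simp [hα, hαv], β, by simp [hβ, hβv], hβα.symm⟩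
  -- A root meets at most two vertices of `T`; if it meets two, the origin is not one of its ends
  -- and its coefficients sum to 0.
  have hs : ∀ α ∈ σ, #{v ∈ T | α v ≠ 0} ≤ 2 ∧ (#{v ∈ T | α v ≠ 0} = 2 → ∑ i, α i = 0) := by
    intro α hα
    by_cases h : ∃ v, α v ≠ 0
    · obtain ⟨v, hv⟩ := h
      obtain ⟨s, hs, h | ⟨u, huv, h⟩⟩ := rootsA_cases (hσ hα) hv
      · have : #{v ∈ T | α v ≠ 0} ≤ 1 := by
          refine (card_le_card (t := {v}) fun i hi => ?_).trans (by simp)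
          by_contra h'
          simp only [mem_singleton] at h'
          simp [h, h'] at hi
        omega
      · refine ⟨(card_le_card (t := {v, u}) fun i hi => ?_).trans card_le_two, fun _ => ?_⟩
        · by_contra h'
          simp only [mem_insert, mem_singleton, not_or] at h'
          simp [h, h'.1, h'.2] at hi
        · simp [h, ← mul_sum, sum_sub_distrib]
    · push Not at h
      simp [h]
  have hdc : ∑ v ∈ T, #{α ∈ σ | α v ≠ 0} = ∑ α ∈ σ, #{v ∈ T | α v ≠ 0} := by
    simp only [card_filter]
    exact sum_comm
  have hle : #T * 2 ≤ ∑ v ∈ T, #{α ∈ σ | α v ≠ 0} := by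
    rw [← smul_eq_mul, ← sum_const]
    exact sum_le_sum hd
  -- Equality in the double count: every root meets exactly two vertices of `T`, so all are
  -- orthogonal to (1, …, 1), which is incompatible with spanning.
  have heq : ∀ α ∈ σ, #{v ∈ T | α v ≠ 0} = 2 := by
    have : ∑ α ∈ σ, #{v ∈ T | α v ≠ 0} = ∑ α ∈ σ, 2 := by
      refine le_antisymm (sum_le_sum fun α hα => (hs α hα).1) ?_
      rw [sum_const, smul_eq_mul, hcard, ← hdc]
      exact hle
    exact (sum_eq_sum_iff_of_le fun α hα => (hs α hα).1).1 this
  obtain ⟨v, hv⟩ := hne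
  have := eq_zero_of_dot_eq_zero hT 1 (fun α hα => by
    simpa [dotProduct] using (hs α hα).2 (heq α hα)) hv
  simp at this

/-- Induction on the size of `T`: remove a leaf `v` with its edge `α`, write the rest as a
combination of paths, and reattach `v` to the origin or to the vertex at the other end of `α`. -/
theorem inv_prod_mem_pathSpan {r : ℕ} (m : ℕ) {σ : Finset (Fin (r + 1) → ℝ)}
    {T : Finset (Fin (r + 1))}
    (hσ : (σ : Set (Fin (r + 1) → ℝ)) ⊆ rootsA r) (hsupp : ∀ α ∈ σ, ∀ i, i ∉ T → α i = 0)
    (hT : ∀ i ∈ T, (Pi.single i 1 : Fin (r + 1) → ℝ) ∈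
      Submodule.span ℝ (σ : Set (Fin (r + 1) → ℝ)))
    (hcard : σ.card = T.card) (hm : T.card = m) :
    (∏ α ∈ σ, linForm α)⁻¹ ∈ pathSpan r T := by
  classical
  induction m generalizing σ T with
  | zero =>
    rw [Finset.card_eq_zero] at hm
    subst hm
    rw [Finset.card_empty, Finset.card_eq_zero] at hcard
    subst hcard
    exact Submodule.subset_span ⟨[], by simp, by simp, by simp [pathInv]⟩
  | succ m ih =>
    obtain ⟨v, hv, α, hα, hαv, hother⟩ := exists_leaf hσ hT hcard
      (Finset.card_pos.1 (by omega))
    have hih := ih (σ := σ.erase α) (T := T.erase v)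
      (fun β hβ => hσ (Finset.mem_of_mem_erase hβ))
      (fun β hβ i hi => by
        by_cases hiv : i = v
        · subst hiv
          exact hother β (Finset.mem_of_mem_erase hβ) (Finset.ne_of_mem_erase hβ)
        · exact hsupp β (Finset.mem_of_mem_erase hβ) i (by simpa [hiv] using hi))
      (fun i hi => by
        have h1 := hT i (Finset.mem_of_mem_erase hi)
        rw [← Finset.insert_erase hα, Finset.coe_insert, Submodule.mem_span_insert] at h1
        obtain ⟨a, z, hz, hiz⟩ := h1
        have hzv : z v = 0 := by
          clear hiz
          induction hz using Submodule.span_induction with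
          | mem x hx =>
            exact hother x (Finset.mem_of_mem_erase hx) (Finset.ne_of_mem_erase hx)
          | zero => simp
          | add x y _ _ hx hy => simp [hx, hy]
          | smul a x _ hx => simp [hx]
        have h2 := congrFun hiz v
        rw [Pi.single_eq_of_ne (Finset.ne_of_mem_erase hi).symm] at h2
        simp only [Pi.add_apply, Pi.smul_apply, smul_eq_mul, hzv, add_zero] at h2
        -- At the leaf `v` only `α` is nonzero among the roots of `σ`, so `α` is not needed to
        -- express the remaining unit vectors.
        have ha : a = 0 := by
          rcases mul_eq_zero.1 h2.symm with h | h
          · exact h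
          · exact absurd h hαv
        rw [hiz, ha, zero_smul, zero_add]
        exact hz)
      (by rw [Finset.card_erase_of_mem hα, Finset.card_erase_of_mem hv, hcard])
      (by rw [Finset.card_erase_of_mem hv, hm]; rfl)
    rw [← Finset.mul_prod_erase _ _ hα, mul_inv]
    have hxinj : Function.Injective fun i : Fin (r + 1) => coord r i.castSucc :=
      fun i j h => Fin.castSucc_injective _ (coord_injective r h)
    have main : ∀ L : List (Fin (r + 1)), L.Nodup → L.toFinset = T.erase v →
        (linForm α)⁻¹ * pathInv 0 (L.map fun i => coord r i.castSucc) ∈ pathSpan r T := by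
      intro L hL hLT
      have hvL : v ∉ L := by rw [← List.mem_toFinset, hLT]; simp
      have hsub : (Submodule.span ℝ {f | ∃ L' : List (Fin (r + 1)), L'.Perm (v :: L) ∧
          f = pathInv 0 (L'.map fun i => coord r i.castSucc)}) ≤ pathSpan r T := by
        refine Submodule.span_mono ?_
        rintro _ ⟨L', hL', rfl⟩
        refine ⟨L', hL'.nodup_iff.2 (List.nodup_cons.2 ⟨hvL, hL⟩), ?_, rfl⟩
        rw [List.toFinset_eq_of_perm _ _ hL', List.toFinset_cons, hLT, Finset.insert_erase hv]
      have h0 : ∀ i : Fin (r + 1), coord r i.castSucc ≠ 0 := fun i h =>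
        (Fin.castSucc_lt_last i).ne (coord_injective r (h.trans (coord_last r).symm))
      obtain ⟨s, hs, h | ⟨u, huv, h⟩⟩ := rootsA_cases (hσ hα) hαv
      · rw [h, linForm_smul, linForm_single_castSucc, smul_inv₀, smul_mul_assoc]
        refine Submodule.smul_mem _ _ (hsub ?_)
        have := inv_mul_pathInv_mem_span (fun i : Fin (r + 1) => coord r i.castSucc) v 0 L (h0 v)
          (fun q hq h => hvL (hxinj h ▸ hq)) (fun h => by
            have := List.mem_of_mem_head? (Option.mem_def.2 h)
            rw [List.mem_map] at this
            obtain ⟨y, -, hy⟩ := this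
            exact h0 y hy) (List.Pairwise.isChain (List.Nodup.map hxinj hL))
        rwa [sub_zero] at this
      · have hu : u ∈ L := by
          rw [← List.mem_toFinset, hLT, Finset.mem_erase]
          refine ⟨huv, ?_⟩
          by_contra hu
          have := hsupp α hα u hu
          rw [h] at this
          simp [huv, hs] at this
        rw [h, linForm_smul, linForm_sub, linForm_single_castSucc, linForm_single_castSucc,
          smul_inv₀, smul_mul_assoc]
        exact Submodule.smul_mem _ _ (hsub
          (inv_mul_pathInv_mem_span_of_mem _ hxinj v 0 L hL hvL u hu))
    have h2 := Submodule.mem_map_of_mem (f := LinearMap.mulLeft ℝ (linForm α)⁻¹) hih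
    rw [pathSpan, Submodule.map_span] at h2
    refine Submodule.span_le.2 ?_ h2
    rintro _ ⟨_, ⟨L, hL, hLT, rfl⟩, rfl⟩
    exact main L hL hLT

theorem simpleS_le_pathSpan (r : ℕ) : simpleS (rootsA r) ≤ pathSpan r Finset.univ := by
  refine Submodule.span_le.2 ?_
  rintro _ ⟨σ, ⟨h1, h2, h3⟩, rfl⟩
  refine inv_prod_mem_pathSpan (r + 1) h1 (by simp) (by simp [h3]) ?_ (by simp)
  have h4 := finrank_span_eq_card h2
  have h5 : Set.range (fun α : σ => (α : Fin (r + 1) → ℝ)) = σ := by simp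
  rw [h5, h3, finrank_top] at h4
  simpa using h4.symm

/-- The sum `R = ∂(V) R + S` is direct. -/
theorem eq_zero_of_mem_simpleS_of_mem_derivR {r : ℕ} {f : RatFun (Fin (r + 1))}
    (hS : f ∈ simpleS (rootsA r)) (hR : f ∈ derivR (rootsA r)) : f = 0 := by
  classical
  have hf := simpleS_le_pathSpan r hS
  let I := {L : List (Fin (r + 1)) // L.Nodup ∧ L.toFinset = Finset.univ}
  let g : I → RatFun (Fin (r + 1)) := fun L => pathInv 0 (L.1.map fun i => coord r i.castSucc)
  have hset : {f | ∃ L : List (Fin (r + 1)), L.Nodup ∧ L.toFinset = Finset.univ ∧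
      f = pathInv 0 (L.map fun i => coord r i.castSucc)} = Set.range g := by
    ext f
    constructor
    · rintro ⟨L, h1, h2, rfl⟩; exact ⟨⟨L, h1, h2⟩, rfl⟩
    · rintro ⟨⟨L, h1, h2⟩, rfl⟩; exact ⟨L, h1, h2, rfl⟩
  rw [pathSpan, hset, Finsupp.mem_span_range_iff_exists_finsupp] at hf
  obtain ⟨c, rfl⟩ := hf
  suffices c = 0 by simp [this]
  ext L
  have hmem : ∀ (M : I) i, i ∈ M.1 := fun M i => by
    rw [← List.mem_toFinset, M.2.2]; simp
  -- Vertices are numbered by their position along `L`, from 1 on because `vert 0` is the origin;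
  -- `L` itself becomes the increasing path.
  let τ : Fin (r + 1) → ℕ := fun i => L.1.idxOf i + 1
  have hτ : Function.Injective τ := fun i j h =>
    (List.idxOf_inj (hmem L i)).1 (Nat.succ_injective h)
  have hlen : L.1.length = r + 1 := by
    rw [← List.toFinset_card_of_nodup L.2.1, L.2.2]; simp
  have hLmap : L.1.map τ = List.range' 1 (r + 1) := by
    refine List.ext_getElem (by simp [hlen]) fun k h1 h2 => ?_
    simp only [List.getElem_map, List.getElem_range', τ]
    rw [List.Nodup.idxOf_getElem L.2.1]
    ring
  have hmap : ∀ M : I, expand hτ (g M) = pathInv 0 ((M.1.map τ).map vert) := by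
    intro M
    change (expand hτ : RatFun (Fin (r + 1)) →+* IterLaurent) (pathInv 0 _) = _
    rw [map_pathInv, map_zero, List.map_map, List.map_map]
    congr 1
    refine List.map_congr_left fun i _ => ?_
    simp only [Function.comp, coord_castSucc]
    change expand hτ _ = _
    rw [expand_X]
    simp [vert, τ]
  set a := pathExpo 0 (List.range' 1 (r + 1)) with ha
  have hcoeff : ∀ M : I, (expand hτ (g M)).coeff a = if M = L then 1 else 0 := by
    intro M
    rw [hmap, coeff_pathInv]
    · refine if_congr ?_ rfl rfl
      rw [← hLmap, (List.map_injective_iff.2 hτ).eq_iff, Subtype.ext_iff]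
    · rw [← hLmap]
      refine List.Perm.map _ ?_
      rw [List.perm_ext_iff_of_nodup M.2.1 L.2.1]
      exact fun i => ⟨fun _ => hmem L i, fun _ => hmem M i⟩
  have hzero : ∀ f ∈ derivR (rootsA r), (expand hτ f).coeff a = 0 := by
    intro f hf
    induction hf using Submodule.span_induction with
    | mem x hx =>
      obtain ⟨v, f, -, rfl⟩ := hx
      refine coeff_expand_ratDeriv hτ v f a fun i => ?_
      rw [ha]
      have := pathExpo_range'_apply 0 (r + 1) (τ i)
      rw [zero_add] at this
      rw [this, if_pos]
      have : τ i ∈ List.range' 1 (r + 1) := by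
        rw [← hLmap]; exact List.mem_map_of_mem (hmem L i)
      rw [List.mem_range'_1] at this
      exact this
    | zero => simp
    | add x y _ _ hx hy => rw [map_add, HahnSeries.coeff_add, hx, hy, add_zero]
    | smul s x _ hx => rw [map_smul, HahnSeries.coeff_smul, hx, smul_zero]
  have h := hzero _ hR
  rw [Finsupp.sum, map_sum, HahnSeries.coeff_sum] at h
  simp only [map_smul, HahnSeries.coeff_smul, hcoeff] at h
  rw [Finset.sum_eq_single L (fun M _ hM => by rw [if_neg hM, smul_zero])
    (fun hL => by rw [Finsupp.notMem_support_iff.1 hL, zero_smul]), if_pos rfl] at h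
  simpa using h

/-- Two candidates in S differ by an element of ∂(V)R ∩ S = 0, so uniqueness is automatic and only
memberships remain to be shown. -/
theorem isTotalResidue_of_sub_mem {r : ℕ} {f g : RatFun (Fin (r + 1))}
    (hf : f ∈ ringR (rootsA r)) (hg : g ∈ simpleS (rootsA r)) (h : f - g ∈ derivR (rootsA r)) :
    IsTotalResidue (rootsA r) f g := by
  refine ⟨hf, hg, h, fun g' hg' h' => ?_⟩
  have := eq_zero_of_mem_simpleS_of_mem_derivR (sub_mem hg' hg)
    (by have := sub_mem h h'; rwa [sub_sub_sub_cancel_left] at this)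
  exact sub_eq_zero.1 this

end TypeA

/-! ### The constants: Gamma identities, relations, uniqueness -/

section Constants

/-- The product of Gamma values in Morris' identity, with `k₃ = 2 κ`. -/
def morrisBase (r : ℕ) (a b κ : ℝ) : ℝ :=
  (Nat.factorial r : ℝ) * ∏ j ∈ Finset.range r,
    (Real.Gamma (1 + κ) * Real.Gamma (a + b - 1 + ((r : ℝ) + j - 1) * κ)) /
      (Real.Gamma (1 + ((j : ℝ) + 1) * κ) * Real.Gamma (a + j * κ) * Real.Gamma (b + j * κ))

/-- The ratio of the constants for `ℓ` and for `0`. -/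
def morrisRatio (r l : ℕ) (a b κ : ℝ) : ℝ :=
  ∏ j ∈ Finset.Icc 1 l,
    (a - 1 + ((r : ℝ) - j) * κ) / (a + b - 2 + (2 * (r : ℝ) - j - 1) * κ)

/-- The constants `C_{r+1}(ℓ, k₁, k₂, k₃)`. -/
def morrisConst (r l k₁ k₂ k₃ : ℕ) : ℝ :=
  if k₁ = 0 ∨ k₂ = 0 then 0
  else morrisRatio r l k₁ k₂ ((k₃ : ℝ) / 2) * morrisBase r k₁ k₂ ((k₃ : ℝ) / 2)

theorem morrisBase_comm (r : ℕ) (a b κ : ℝ) : morrisBase r a b κ = morrisBase r b a κ := by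
  unfold morrisBase
  congr 1
  refine Finset.prod_congr rfl fun j _ => ?_
  rw [add_comm a b]
  ring

theorem morrisBase_one_one_zero (r : ℕ) : morrisBase r 1 1 0 = (Nat.factorial r : ℝ) := by
  simp [morrisBase]

/-- For r = 1 the only factor has j = 0, where κ survives only in the quotient Γ(1 + κ)/Γ(1 + κ). -/
theorem morrisBase_one (a b κ : ℝ) (hκ : 0 ≤ κ) : morrisBase 1 a b κ = morrisBase 1 a b 0 := by
  have : Real.Gamma (1 + κ) ≠ 0 := (Real.Gamma_pos_of_pos (by positivity)).ne'
  simp only [morrisBase, Finset.prod_range_one, Nat.cast_zero, Nat.cast_one]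
  norm_num
  field_simp

theorem prod_Icc_one_eq_prod_range (r : ℕ) (f : ℝ → ℝ) :
    ∏ j ∈ Finset.Icc 1 r, f ((r : ℝ) - j) = ∏ i ∈ Finset.range r, f i := by
  refine Finset.prod_nbij' (fun j => r - j) (fun i => r - i) ?_ ?_ ?_ ?_ ?_
  · intro j hj; simp only [Finset.mem_Icc, Finset.mem_range] at *; omega
  · intro j hj; simp only [Finset.mem_Icc, Finset.mem_range] at *; omega
  · intro j hj; simp only [Finset.mem_Icc] at *; omega
  · intro j hj; simp only [Finset.mem_range] at *; omega
  · intro j hj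
    simp only [Finset.mem_Icc] at hj
    rw [Nat.cast_sub hj.2]

/-- This is `recK` for the closed form. After the reindexing j ↦ r − j each factor of the ratio is
what Γ(x + 1) = x Γ(x) produces when a is raised by 1. -/
theorem morrisRatio_mul_morrisBase (r : ℕ) (hr : 1 ≤ r) {a b κ : ℝ} (ha : 0 < a) (hb : 1 ≤ b)
    (hκ : 0 ≤ κ) :
    morrisRatio r r (a + 1) b κ * morrisBase r (a + 1) b κ = morrisBase r a b κ := by
  have h1 : morrisRatio r r (a + 1) b κ =
      ∏ i ∈ Finset.range r, (a + i * κ) / (a + b - 1 + ((r : ℝ) + i - 1) * κ) := by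
    rw [← prod_Icc_one_eq_prod_range r fun x => (a + x * κ) / (a + b - 1 + ((r : ℝ) + x - 1) * κ)]
    refine Finset.prod_congr rfl fun j _ => ?_
    congr 1 <;> ring
  rw [h1, morrisBase, morrisBase, mul_left_comm, ← Finset.prod_mul_distrib]
  congr 1
  refine Finset.prod_congr rfl fun j _ => ?_
  have hr' : (1 : ℝ) ≤ r := by exact_mod_cast hr
  have hj : (0 : ℝ) ≤ (j : ℝ) * κ := by positivity
  have hrj : 0 ≤ ((r : ℝ) + j - 1) * κ :=
    mul_nonneg (by have : (0 : ℝ) ≤ j := j.cast_nonneg; linarith) hκ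
  have hx : 0 < a + j * κ := by linarith
  have hy : 0 < a + b - 1 + ((r : ℝ) + j - 1) * κ := by linarith
  rw [show a + 1 + j * κ = a + j * κ + 1 by ring,
    show a + 1 + b - 1 + ((r : ℝ) + j - 1) * κ = a + b - 1 + ((r : ℝ) + j - 1) * κ + 1 by ring,
    Real.Gamma_add_one hx.ne', Real.Gamma_add_one hy.ne']
  have := (Real.Gamma_pos_of_pos hx).ne'
  have := hx.ne'
  have := hy.ne'
  generalize a + b - 1 + ((r : ℝ) + j - 1) * κ = y at *
  field_simp

theorem prod_range_div_succ (n : ℕ) :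
    ∏ i ∈ Finset.range n, ((i : ℝ) + 1) / ((i : ℝ) + 2) = 1 / ((n : ℝ) + 1) := by
  induction n with
  | zero => simp
  | succ n ih =>
    rw [Finset.prod_range_succ, ih]
    push_cast
    field_simp
    ring

/-- This is `recR` for the closed form, with k₃ = 2κ as the new k₁. After shifting the Gamma
products, the product of the (i + 1)/(i + 2) telescopes to 1/(n + 1) and accounts for (n + 1)!/n!.
-/
theorem morrisRatio_mul_morrisBase_one (n : ℕ) {b κ : ℝ} (hb : 1 ≤ b) (hκ : 0 < κ) :
    morrisRatio (n + 1) n 1 b κ * morrisBase (n + 1) 1 b κ = morrisBase n (2 * κ) b κ := by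
  have h1 : morrisRatio (n + 1) n 1 b κ =
      ∏ i ∈ Finset.range n, (((i : ℝ) + 1) * κ) / (b - 1 + ((n : ℝ) + i + 1) * κ) := by
    rw [← prod_Icc_one_eq_prod_range n fun x => ((x + 1) * κ) / (b - 1 + ((n : ℝ) + x + 1) * κ)]
    refine Finset.prod_congr rfl fun j _ => ?_
    push_cast
    congr 1 <;> ring
  set G : ℝ → ℝ := fun x => Real.Gamma (1 + x * κ) with hG
  set B : ℝ → ℝ := fun x => Real.Gamma (b + x * κ) with hB
  have hGp : ∀ x : ℕ, G x ≠ 0 := fun x => (Real.Gamma_pos_of_pos (by positivity)).ne'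
  have hBp : ∀ x : ℕ, B x ≠ 0 := fun x =>
    (Real.Gamma_pos_of_pos (by have : 0 ≤ (x : ℝ) * κ := by positivity
                               linarith)).ne'
  have hfac : (Nat.factorial (n + 1) : ℝ) = (Nat.factorial n : ℝ) * ((n : ℝ) + 1) := by
    rw [Nat.factorial_succ]; push_cast; ring
  have h2 : morrisBase (n + 1) 1 b κ = (Nat.factorial n : ℝ) * ((n : ℝ) + 1) *
      ∏ i ∈ Finset.range n, (G 1 * B ((n : ℝ) + i + 1)) / (G ((i : ℝ) + 2) * G ((i : ℝ) + 1) * B i) := by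
    have e1 : ∀ j : ℕ, (Real.Gamma (1 + κ) *
        Real.Gamma (1 + b - 1 + (((n + 1 : ℕ) : ℝ) + j - 1) * κ)) /
      (Real.Gamma (1 + ((j : ℝ) + 1) * κ) * Real.Gamma (1 + j * κ) * Real.Gamma (b + j * κ)) =
        (G 1 * B ((n + j : ℕ) : ℝ)) / (G ((j + 1 : ℕ) : ℝ) * G j * B j) := by
      intro j
      simp only [hG, hB]
      push_cast
      congr 3 <;> ring_nf
    -- One factor is split off each product at the end that aligns the indices; the split factors `G
    -- 1` and `B n` cancel, and `G 0` is 1.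
    rw [morrisBase, Finset.prod_congr rfl fun j _ => e1 j, Finset.prod_div_distrib,
      Finset.prod_mul_distrib, Finset.prod_mul_distrib, Finset.prod_mul_distrib,
      Finset.prod_range_succ (fun _ => G 1), Finset.prod_range_succ' (fun j => B ((n + j : ℕ) : ℝ)),
      Finset.prod_range_succ' (fun j => G ((j + 1 : ℕ) : ℝ)),
      Finset.prod_range_succ' (fun j => G (j : ℝ)), Finset.prod_range_succ (fun j => B (j : ℝ)),
      Finset.prod_div_distrib, Finset.prod_mul_distrib, Finset.prod_mul_distrib,
      Finset.prod_mul_distrib, hfac]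
    have hG0 : G 0 = 1 := by simp [hG]
    have q1 : ∀ i : ℕ, B ((n : ℝ) + i + 1) = B ((n + (i + 1) : ℕ) : ℝ) := by
      intro i; push_cast; ring_nf
    have q2 : ∀ i : ℕ, G ((i : ℝ) + 2) = G ((i + 1 + 1 : ℕ) : ℝ) := by
      intro i; push_cast; ring_nf
    have q3 : ∀ i : ℕ, G ((i : ℝ) + 1) = G ((i + 1 : ℕ) : ℝ) := by
      intro i; push_cast; ring_nf
    simp only [q1, q2, q3, add_zero, zero_add, Nat.cast_zero, hG0, mul_one]
    have := hBp n
    have h11 := hGp 1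
    rw [Nat.cast_one] at h11 ⊢
    have p1 : ∏ i ∈ Finset.range n, G ((i + 1 + 1 : ℕ) : ℝ) ≠ 0 :=
      Finset.prod_ne_zero_iff.2 fun i _ => hGp _
    have p2 : ∏ i ∈ Finset.range n, G ((i + 1 : ℕ) : ℝ) ≠ 0 :=
      Finset.prod_ne_zero_iff.2 fun i _ => hGp _
    have p3 : ∏ i ∈ Finset.range n, B (i : ℝ) ≠ 0 := Finset.prod_ne_zero_iff.2 fun i _ => hBp _
    field_simp
  rw [h1, h2, morrisBase, mul_left_comm, ← Finset.prod_mul_distrib, mul_assoc]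
  congr 1
  have h3 : ∀ i : ℕ, ((((i : ℝ) + 1) * κ) / (b - 1 + ((n : ℝ) + i + 1) * κ)) *
      ((G 1 * B ((n : ℝ) + i + 1)) / (G ((i : ℝ) + 2) * G ((i : ℝ) + 1) * B i)) =
      (((i : ℝ) + 1) / ((i : ℝ) + 2)) *
      ((Real.Gamma (1 + κ) * Real.Gamma (2 * κ + b - 1 + ((n : ℝ) + i - 1) * κ)) /
      (Real.Gamma (1 + ((i : ℝ) + 1) * κ) * Real.Gamma (2 * κ + i * κ) *
        Real.Gamma (b + i * κ))) := by
    intro i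
    have hpos : 0 < b - 1 + ((n : ℝ) + i + 1) * κ := by
      have : 0 < ((n : ℝ) + i + 1) * κ := by positivity
      linarith
    have hpos2 : 0 < ((i : ℝ) + 2) * κ := by positivity
    have e1 : B ((n : ℝ) + i + 1) = (b - 1 + ((n : ℝ) + i + 1) * κ) *
        Real.Gamma (b - 1 + ((n : ℝ) + i + 1) * κ) := by
      rw [← Real.Gamma_add_one hpos.ne']
      simp only [hB]
      congr 1; ring
    have e2 : G ((i : ℝ) + 2) = (((i : ℝ) + 2) * κ) * Real.Gamma (((i : ℝ) + 2) * κ) := by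
      rw [← Real.Gamma_add_one hpos2.ne']
      simp only [hG]
      congr 1; ring
    rw [show 2 * κ + b - 1 + ((n : ℝ) + i - 1) * κ = b - 1 + ((n : ℝ) + i + 1) * κ by ring,
      show 2 * κ + i * κ = ((i : ℝ) + 2) * κ by ring, e1, e2]
    have := hpos.ne'
    have := hpos2.ne'
    have hg1 := hGp (i + 1)
    have hb1 := hBp i
    have := (Real.Gamma_pos_of_pos hpos2).ne'
    push_cast at hg1
    simp only [hG, hB, one_mul] at hg1 hb1 ⊢
    generalize b - 1 + ((n : ℝ) + i + 1) * κ = y at *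
    field_simp
  rw [Finset.prod_congr rfl fun i _ => h3 i, Finset.prod_mul_distrib, prod_range_div_succ]
  field_simp

theorem morrisRatio_succ (r l : ℕ) (a b κ : ℝ) : morrisRatio r (l + 1) a b κ =
    morrisRatio r l a b κ * ((a - 1 + ((r : ℝ) - (l + 1)) * κ) /
      (a + b - 2 + (2 * (r : ℝ) - (l + 1) - 1) * κ)) := by
  rw [morrisRatio, Finset.prod_Icc_succ_top (by omega), morrisRatio]
  push_cast
  rfl

/-- The denominators in the recurrence only vanish for `k₁ = k₂ = 1` and `k₃ = 0` or
`r = ℓ = 1`. -/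
theorem recurrence_denom_ne_zero {r l k₁ k₂ k₃ : ℕ} (hl : 1 ≤ l) (hlr : l ≤ r) (h₁ : 1 ≤ k₁)
    (h₂ : 1 ≤ k₂) (h : 2 < k₁ + k₂ ∨ (0 < k₃ ∧ 2 ≤ r)) :
    ((k₁ : ℝ) + k₂ - 2 + (k₃ : ℝ) / 2 * (2 * r - l - 1)) ≠ 0 := by
  have h1 : (1 : ℝ) ≤ l := by exact_mod_cast hl
  have h2 : (l : ℝ) ≤ r := by exact_mod_cast hlr
  have h3 : (0 : ℝ) ≤ (k₃ : ℝ) / 2 * (2 * r - l - 1) :=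
    mul_nonneg (by positivity) (by linarith)
  have h4 : (1 : ℝ) ≤ k₁ := by exact_mod_cast h₁
  have h5 : (1 : ℝ) ≤ k₂ := by exact_mod_cast h₂
  apply ne_of_gt
  rcases h with h | ⟨h, hr⟩
  · have : (2 : ℝ) < k₁ + k₂ := by exact_mod_cast h
    linarith
  · have : (2 : ℝ) ≤ r := by exact_mod_cast hr
    have h6 : (0 : ℝ) < (k₃ : ℝ) / 2 * (2 * r - l - 1) :=
      mul_pos (by positivity) (by linarith)
    linarith

theorem recurrence_numer_ne_zero {r l k₁ k₃ : ℕ} (hlr : l ≤ r)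
    (h : 2 ≤ k₁ ∨ (k₁ = 1 ∧ 0 < k₃ ∧ l < r)) :
    ((k₁ : ℝ) - 1 + (k₃ : ℝ) / 2 * (r - l)) ≠ 0 := by
  have h2 : (l : ℝ) ≤ r := by exact_mod_cast hlr
  have h3 : (0 : ℝ) ≤ (k₃ : ℝ) / 2 * (r - l) :=
    mul_nonneg (by positivity) (by linarith)
  apply ne_of_gt
  rcases h with h | ⟨rfl, h, hl⟩
  · have : (2 : ℝ) ≤ k₁ := by exact_mod_cast h
    linarith
  · have : (l : ℝ) < r := by exact_mod_cast hl
    have : (0 : ℝ) < (k₃ : ℝ) / 2 * (r - l) := mul_pos (by positivity) (by linarith)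
    push_cast
    linarith

theorem morrisRelations_morrisConst : MorrisRelations morrisConst where
  recL r l k₁ k₂ k₃ hl hlr := by
    obtain ⟨l, rfl⟩ : ∃ m, l = m + 1 := ⟨l - 1, by omega⟩
    rw [Nat.add_sub_cancel]
    unfold morrisConst
    split_ifs with h
    · simp
    push Not at h
    rw [morrisRatio_succ]
    by_cases hd : 2 < k₁ + k₂ ∨ (0 < k₃ ∧ 2 ≤ r)
    · have := recurrence_denom_ne_zero hl hlr (Nat.pos_of_ne_zero h.1) (Nat.pos_of_ne_zero h.2) hd
      push_cast at this ⊢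
      rw [mul_comm ((k₃ : ℝ) / 2)] at this ⊢
      rw [mul_comm ((k₃ : ℝ) / 2)]
      generalize (k₁ : ℝ) + k₂ - 2 + (2 * r - (l + 1) - 1) * (k₃ / 2) = d at *
      field_simp
    -- Both coefficients of the recurrence vanish in the remaining cases, whatever the constants
    -- are.
    · have h1 : k₁ = 1 := by omega
      have h2 : k₂ = 1 := by omega
      have h3 : k₃ = 0 ∨ (r = 1 ∧ l = 0) := by omega
      rcases h3 with h3 | ⟨h3, h4⟩
      · simp [h1, h2, h3]
      · simp [h1, h2, h3, h4]
  recK r k₁ k₂ k₃ hr h := by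
    obtain ⟨k, rfl⟩ : ∃ m, k₁ = m + 1 := ⟨k₁ - 1, by omega⟩
    rw [Nat.add_sub_cancel]
    unfold morrisConst
    by_cases h2 : k₂ = 0
    · simp [h2]
    -- If k₁ = 1 the right side is 0, and on the left the factor j = r of the ratio has numerator k₁
    -- − 1 = 0.
    by_cases hk : k = 0
    · subst hk
      obtain ⟨r, rfl⟩ : ∃ m, r = m + 1 := ⟨r - 1, by omega⟩
      simp [morrisRatio_succ]
    · rw [if_neg (by omega), if_neg (by omega)]
      have hk1 : (0 : ℝ) < k := by exact_mod_cast Nat.pos_of_ne_zero hk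
      have hk2 : (1 : ℝ) ≤ k₂ := by exact_mod_cast Nat.pos_of_ne_zero h2
      rw [Nat.cast_succ, morrisRatio_mul_morrisBase r hr hk1 hk2 (by positivity)]
      simp [morrisRatio]
  recR r k₂ k₃ hr := by
    obtain ⟨n, rfl⟩ : ∃ m, r = m + 2 := ⟨r - 2, by omega⟩
    unfold morrisConst
    by_cases h2 : k₂ = 0
    · simp [h2]
    -- If k₃ = 0 both sides are 0: on the right the new k₁ is 0, on the left the numerators of the
    -- ratio vanish.
    by_cases h3 : k₃ = 0
    · have : n + 2 - 1 = n + 1 := rfl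
      simp [h3, h2, this, morrisRatio_succ]
    · rw [if_neg (by omega), if_neg (by omega)]
      have hk2 : (1 : ℝ) ≤ k₂ := by exact_mod_cast Nat.pos_of_ne_zero h2
      have hk3 : (0 : ℝ) < (k₃ : ℝ) / 2 := by
        have := Nat.pos_of_ne_zero h3
        positivity
      have := morrisRatio_mul_morrisBase_one (n + 1) hk2 hk3
      rw [mul_div_cancel₀ _ two_ne_zero] at this
      rw [Nat.cast_one]
      refine this.trans ?_
      simp [morrisRatio]
  symm r k₁ k₂ k₃ _ := by
    unfold morrisConst
    rw [morrisBase_comm]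
    simp [morrisRatio, or_comm]
  init r _ := by
    simp [morrisConst, morrisRatio, morrisBase_one_one_zero]
  vanish r l k₁ k₂ k₃ _ _ h := by simp [morrisConst, h]
  base l k₁ k₂ k₃ hl := by
    unfold morrisConst
    rw [morrisBase_one _ _ _ (by positivity)]
    have : morrisRatio 1 l k₁ k₂ ((k₃ : ℝ) / 2) = morrisRatio 1 l k₁ k₂ (((0 : ℕ) : ℝ) / 2) := by
      interval_cases l
      · simp [morrisRatio]
      · simp [morrisRatio]
        norm_num
    rw [this]
    simp

/-- Descent in ℓ: the coefficient of the constant with index ℓ − 1 in `recL` is nonzero, so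
agreement passes from `L` down to 0. -/
theorem MorrisRelations.eq_zero_index {C C' : ℕ → ℕ → ℕ → ℕ → ℕ → ℝ} (hC : MorrisRelations C)
    (hC' : MorrisRelations C') {r k₁ k₂ k₃ : ℕ} (L : ℕ) (hL : L ≤ r)
    (hnum : 2 ≤ k₁ ∨ (k₁ = 1 ∧ 0 < k₃ ∧ L < r)) (h : C r L k₁ k₂ k₃ = C' r L k₁ k₂ k₃) :
    C r 0 k₁ k₂ k₃ = C' r 0 k₁ k₂ k₃ := by
  induction L with
  | zero => exact h
  | succ L ih =>
    refine ih (by omega) (by omega) ?_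
    have h1 := hC.recL r (L + 1) k₁ k₂ k₃ (by omega) hL
    have h2 := hC'.recL r (L + 1) k₁ k₂ k₃ (by omega) hL
    rw [h, h2] at h1
    exact (mul_left_cancel₀ (recurrence_numer_ne_zero hL hnum) h1).symm

/-- Ascent in ℓ, dividing by the other coefficient of `recL`. -/
theorem MorrisRelations.eq_of_eq_zero_index {C C' : ℕ → ℕ → ℕ → ℕ → ℕ → ℝ}
    (hC : MorrisRelations C) (hC' : MorrisRelations C') {r k₁ k₂ k₃ : ℕ} (h₁ : 1 ≤ k₁)
    (h₂ : 1 ≤ k₂) (hd : 2 < k₁ + k₂ ∨ (0 < k₃ ∧ 2 ≤ r))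
    (h : C r 0 k₁ k₂ k₃ = C' r 0 k₁ k₂ k₃) (l : ℕ) (hl : l ≤ r) :
    C r l k₁ k₂ k₃ = C' r l k₁ k₂ k₃ := by
  induction l with
  | zero => exact h
  | succ l ih =>
    have h1 := hC.recL r (l + 1) k₁ k₂ k₃ (by omega) hl
    have h2 := hC'.recL r (l + 1) k₁ k₂ k₃ (by omega) hl
    rw [Nat.add_sub_cancel] at h1 h2
    rw [ih (by omega), ← h2] at h1
    exact mul_left_cancel₀ (recurrence_denom_ne_zero (by omega) hl h₁ h₂ hd) h1

/-- Induction on r, then on k₁: `recK` gives the value at ℓ = r from k₁ − 1, and descent brings it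
to ℓ = 0. For k₁ = 1, k₃ > 0 and r ≥ 2 the descent starts at ℓ = r − 1 with `recR`, from rank r − 1.
In the other cases `symm` exchanges k₁ and k₂, and the same descent in k₂ ends at `init`; for r = 1,
`base` first sets k₃ to 0. -/
theorem MorrisRelations.zero_index_unique {C C' : ℕ → ℕ → ℕ → ℕ → ℕ → ℝ}
    (hC : MorrisRelations C) (hC' : MorrisRelations C') (r : ℕ) (hr : 1 ≤ r) (k₁ k₂ k₃ : ℕ) :
    C r 0 k₁ k₂ k₃ = C' r 0 k₁ k₂ k₃ := by
  induction r, hr using Nat.le_induction generalizing k₁ k₂ k₃ with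
  | base =>
    rw [hC.base 0 k₁ k₂ k₃ zero_le_one, hC'.base 0 k₁ k₂ k₃ zero_le_one]
    have step : ∀ k₁ k₂, C 1 0 1 k₂ 0 = C' 1 0 1 k₂ 0 → C 1 0 k₁ k₂ 0 = C' 1 0 k₁ k₂ 0 := by
      intro k₁ k₂ h
      induction k₁ with
      | zero => rw [hC.vanish, hC'.vanish] <;> simp
      | succ k ih =>
        by_cases hk : k = 0
        · rw [hk]; exact h
        · refine hC.eq_zero_index hC' 1 le_rfl (by omega) ?_
          rw [hC.recK, hC'.recK] <;> simp [ih]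
    refine step k₁ k₂ ?_
    rw [hC.symm _ _ _ _ le_rfl, hC'.symm _ _ _ _ le_rfl]
    exact step k₂ 1 (by rw [hC.init, hC'.init] <;> simp)
  | succ r hr ihr =>
    have step : ∀ k₁ k₂ k₃, C (r + 1) 0 1 k₂ k₃ = C' (r + 1) 0 1 k₂ k₃ →
        C (r + 1) 0 k₁ k₂ k₃ = C' (r + 1) 0 k₁ k₂ k₃ := by
      intro k₁ k₂ k₃ h
      induction k₁ with
      | zero => rw [hC.vanish, hC'.vanish] <;> simp
      | succ k ih =>
        by_cases hk : k = 0
        · rw [hk]; exact h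
        · refine hC.eq_zero_index hC' (r + 1) le_rfl (by omega) ?_
          rw [hC.recK, hC'.recK] <;> simp [ih]
    refine step k₁ k₂ k₃ ?_
    rcases Nat.eq_zero_or_pos k₃ with rfl | h3
    · rw [hC.symm _ _ _ _ (by omega), hC'.symm _ _ _ _ (by omega)]
      exact step k₂ 1 0 (by rw [hC.init, hC'.init] <;> simp)
    · refine hC.eq_zero_index hC' r (by omega) (by omega) ?_
      have h1 := hC.recR (r + 1) k₂ k₃ (by omega)
      have h2 := hC'.recR (r + 1) k₂ k₃ (by omega)
      rw [Nat.add_sub_cancel] at h1 h2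
      rw [h1, h2, ihr]

theorem MorrisRelations.unique {C C' : ℕ → ℕ → ℕ → ℕ → ℕ → ℝ}
    (hC : MorrisRelations C) (hC' : MorrisRelations C') (r l k₁ k₂ k₃ : ℕ) (hr : 1 ≤ r)
    (hl : l ≤ r) (h : ¬ (k₁ = 1 ∧ k₂ = 1 ∧ k₃ = 0 ∧ 1 ≤ l ∧ l + 2 ≤ r)) :
    C r l k₁ k₂ k₃ = C' r l k₁ k₂ k₃ := by
  have h0 := hC.zero_index_unique hC' r hr
  by_cases hk : k₁ = 0 ∨ k₂ = 0
  · rw [hC.vanish _ _ _ _ _ hr hl hk, hC'.vanish _ _ _ _ _ hr hl hk]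
  by_cases hd : 2 < k₁ + k₂ ∨ (0 < k₃ ∧ 2 ≤ r)
  · exact hC.eq_of_eq_zero_index hC' (by omega) (by omega) hd (h0 _ _ _) l hl
  -- The recurrence is now void; only ℓ = 0, ℓ = r (through `recK`) and ℓ = r − 1 (through `recR`)
  -- are still determined.
  obtain ⟨rfl, rfl⟩ : k₁ = 1 ∧ k₂ = 1 := by omega
  rcases Nat.eq_zero_or_pos l with rfl | hl0
  · exact h0 _ _ _
  rcases hl.eq_or_lt with rfl | hlr
  · rw [hC.recK _ _ _ _ hr le_rfl, hC'.recK _ _ _ _ hr le_rfl, h0]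
  · obtain ⟨m, rfl⟩ : ∃ m, r = m + 1 := ⟨r - 1, by omega⟩
    obtain rfl : l = m := by omega
    have h1 := hC.recR (l + 1) 1 k₃ (by omega)
    have h2 := hC'.recR (l + 1) 1 k₃ (by omega)
    rw [Nat.add_sub_cancel] at h1 h2
    rw [h1, h2, hC.zero_index_unique hC' l hl0]

theorem morrisConst_eq_ratio_mul (r l k₁ k₂ k₃ : ℕ) :
    morrisConst r l k₁ k₂ k₃ =
      morrisRatio r l k₁ k₂ ((k₃ : ℝ) / 2) * morrisConst r 0 k₁ k₂ k₃ := by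
  unfold morrisConst
  split_ifs <;> simp [morrisRatio]

/-- If k₁ = 0 or k₂ = 0, the factor j = 0 contains `Real.Gamma 0 = 0` in its denominator and is
therefore 0, so the formula needs no case distinction. -/
theorem morrisConst_zero_index {r : ℕ} (hr : 1 ≤ r) (k₁ k₂ k₃ : ℕ) :
    morrisConst r 0 k₁ k₂ k₃ = morrisBase r k₁ k₂ ((k₃ : ℝ) / 2) := by
  unfold morrisConst
  split_ifs with h
  · rw [morrisBase, Finset.prod_eq_zero (Finset.mem_range.2 hr), mul_zero]
    rcases h with h | h <;> simp [h]
  · simp [morrisRatio]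

end Constants

/-! ### Σ_r as the permutations of `Fin r` -/

section Permutations

theorem mid_injective (r : ℕ) : Function.Injective (mid : Fin r → Fin (r + 2)) :=
  (Fin.succ_injective _).comp (Fin.castSucc_injective _)

theorem mid_eq_castSucc {r : ℕ} (j : Fin r) : mid j = j.succ.castSucc := rfl

theorem mid_ne_zero {r : ℕ} (j : Fin r) : mid j ≠ 0 := Fin.succ_ne_zero _

theorem mid_ne_last {r : ℕ} (j : Fin r) : mid j ≠ Fin.last (r + 1) :=
  (Fin.castSucc_lt_last j.succ).ne

theorem exists_mid_eq {r : ℕ} {i : Fin (r + 2)} (h0 : i ≠ 0) (h1 : i ≠ Fin.last (r + 1)) :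
    ∃ j : Fin r, mid j = i := by
  refine ⟨(i.pred h0).castPred fun h => h1 ?_, ?_⟩
  · rw [← Fin.succ_pred i h0, h, Fin.succ_last]
  · simp [mid]

/-- The indices `1, …, r`. -/
def midEquiv (r : ℕ) : Fin r ≃ {i : Fin (r + 2) // i ≠ 0 ∧ i ≠ Fin.last (r + 1)} :=
  Equiv.ofBijective (fun j => ⟨mid j, mid_ne_zero j, mid_ne_last j⟩)
    ⟨fun i j h => mid_injective r (Subtype.ext_iff.1 h), fun ⟨i, h0, h1⟩ => by
      obtain ⟨j, rfl⟩ := exists_mid_eq h0 h1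
      exact ⟨j, rfl⟩⟩

/-- The permutation of `0, …, r+1` given by a permutation of `1, …, r`. -/
def extPerm {r : ℕ} (u : Equiv.Perm (Fin r)) : Equiv.Perm (Fin (r + 2)) :=
  u.extendDomain (midEquiv r)

@[simp] theorem extPerm_mid {r : ℕ} (u : Equiv.Perm (Fin r)) (j : Fin r) :
    extPerm u (mid j) = mid (u j) :=
  u.extendDomain_apply_image (midEquiv r) j

@[simp] theorem extPerm_zero {r : ℕ} (u : Equiv.Perm (Fin r)) : extPerm u 0 = 0 :=
  u.extendDomain_apply_not_subtype (midEquiv r) (by simp)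

@[simp] theorem extPerm_last {r : ℕ} (u : Equiv.Perm (Fin r)) :
    extPerm u (Fin.last (r + 1)) = Fin.last (r + 1) :=
  u.extendDomain_apply_not_subtype (midEquiv r) (by simp)

theorem sign_extPerm {r : ℕ} (u : Equiv.Perm (Fin r)) :
    Equiv.Perm.sign (extPerm u) = Equiv.Perm.sign u :=
  Equiv.Perm.sign_extendDomain _ _

theorem sum_permS {M : Type*} [AddCommMonoid M] (r : ℕ) (F : Equiv.Perm (Fin (r + 2)) → M) :
    ∑ w ∈ permS r, F w = ∑ u : Equiv.Perm (Fin r), F (extPerm u) := by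
  symm
  refine Finset.sum_nbij extPerm ?_ ?_ ?_ fun _ _ => rfl
  · intro u _
    simp [permS]
  · intro u _ u' _ h
    ext j
    have := congrArg (fun w => w (mid j)) h
    simp only [extPerm_mid] at this
    exact congrArg _ (mid_injective r this)
  · intro w hw
    simp only [permS, Finset.coe_filter, Finset.mem_univ, true_and, Set.mem_ofPred_eq] at hw
    have hmid : ∀ j : Fin r, ∃ i : Fin r, mid i = w (mid j) := fun j =>
      exists_mid_eq (fun h => mid_ne_zero j (w.injective (h.trans hw.1.symm)))
        (fun h => mid_ne_last j (w.injective (h.trans hw.2.symm)))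
    choose f hf using hmid
    have hfinj : Function.Injective f := fun i j h => by
      have := (hf i).symm.trans ((congrArg mid h).trans (hf j))
      exact mid_injective r (w.injective this)
    refine ⟨Equiv.ofBijective f (Finite.injective_iff_bijective.1 hfinj), by simp, ?_⟩
    ext i
    congr 1
    by_cases h0 : i = 0
    · subst h0; rw [extPerm_zero, hw.1]
    by_cases h1 : i = Fin.last (r + 1)
    · subst h1; rw [extPerm_last, hw.2]
    obtain ⟨j, rfl⟩ := exists_mid_eq h0 h1
    rw [extPerm_mid, Equiv.ofBijective_apply, hf]

/-- The sign of a permutation as a real number. -/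
def realSign {r : ℕ} (u : Equiv.Perm (Fin r)) : ℝ := ((Equiv.Perm.sign u : ℤˣ) : ℤ)

theorem realSign_mul {r : ℕ} (u w : Equiv.Perm (Fin r)) :
    realSign (u * w) = realSign u * realSign w := by
  simp [realSign]

theorem realSign_mul_self {r : ℕ} (u : Equiv.Perm (Fin r)) : realSign u * realSign u = 1 := by
  rw [← realSign_mul]
  simp only [realSign, Equiv.Perm.sign_mul]
  rcases Int.units_eq_one_or (Equiv.Perm.sign u) with h | h <;> simp [h]

end Permutations

/-! ### Denominators and symmetric sums over an arbitrary field -/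

section Point

variable {K : Type*} [Field K]

/-- The product `∏_{i < j} (z_i - z_j)`. -/
def diffProd {r : ℕ} (z : Fin r → K) : K :=
  ∏ i : Fin r, ∏ j ∈ Finset.univ.filter (fun j : Fin r => i < j), (z i - z j)

theorem diffProd_comp_perm [Algebra ℝ K] {r : ℕ} (z : Fin r → K) (u : Equiv.Perm (Fin r)) :
    diffProd (z ∘ u) = realSign u • diffProd z := by
  have := u.prod_Ioi_comp_eq_sign_mul_prod (f := fun i j => z i - z j) fun i j => by ring
  have h : ∀ i : Fin r, Finset.univ.filter (fun j : Fin r => i < j) = Finset.Ioi i := by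
    intro i; ext j; simp
  simp only [diffProd, h, Function.comp]
  rw [this, Algebra.smul_def, realSign]
  simp

/-- The denominator of `φ_{r+1}(ℓ, k₁, k₂, k₃)` at a point with `e^{r+1} = 0`. -/
def morrisDen {r : ℕ} (k₁ k₂ k₃ : ℕ) (z0 : K) (z : Fin r → K) : K :=
  (∏ j, z j) ^ k₁ * (∏ j, (z0 - z j)) ^ k₂ * diffProd z ^ k₃

/-- The sum over all permutations of the monomial in the variables in the positions `J`. -/
def symMonomial {r : ℕ} (z : Fin r → K) (J : Finset (Fin r)) : K :=
  ∑ w : Equiv.Perm (Fin r), ∏ j ∈ J, z (w j)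

/-- `1 / ∏ (Y_i - Y_{i+1})`. -/
def chainInv {n : ℕ} (Y : Fin (n + 1) → K) : K := (∏ i : Fin n, (Y i.castSucc - Y i.succ))⁻¹

end Point

/-! ### The functions of the theorem in coordinates; membership in R and S -/

section TypeA

/-- The coordinates `e^1, …, e^r`. -/
def midCoord (r : ℕ) (j : Fin r) : RatFun (Fin (r + 1)) := coord r (mid j)

theorem midCoord_injective (r : ℕ) : Function.Injective (midCoord r) :=
  (coord_injective r).comp (mid_injective r)

theorem polyP_eq (r l : ℕ) : polyP r l =
    symMonomial (midCoord r) (Finset.univ.filter fun j : Fin r => (j : ℕ) < l) := by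
  rw [polyP, sum_permS]
  simp [symMonomial, rt_eq, midCoord]

theorem phi_eq (r l k₁ k₂ k₃ : ℕ) : phi r l k₁ k₂ k₃ =
    symMonomial (midCoord r) (Finset.univ.filter fun j : Fin r => (j : ℕ) < l) *
      (morrisDen k₁ k₂ k₃ (coord r 0) (midCoord r))⁻¹ := by
  rw [phi, polyP_eq, div_eq_mul_inv]
  simp only [morrisDen, diffProd, midCoord, rt_eq, coord_last, sub_zero]

theorem morrisFun_eq (r l k₁ k₂ k₃ : ℕ) : morrisFun r l k₁ k₂ k₃ =
    coord r 0 ^ (degD r l k₁ k₂ k₃ - (r + 1)) *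
      (symMonomial (midCoord r) (Finset.univ.filter fun j : Fin r => (j : ℕ) < l) *
        (morrisDen k₁ k₂ k₃ (coord r 0) (midCoord r))⁻¹) := by
  rw [morrisFun, phi_eq, rt_eq, coord_last, sub_zero]

theorem coord_comp_extPerm {r : ℕ} (u : Equiv.Perm (Fin r)) :
    (coord r ∘ extPerm u : Fin (r + 2) → RatFun (Fin (r + 1))) =
      Fin.cons (coord r 0) (Fin.snoc (midCoord r ∘ u) 0 : Fin (r + 1) → RatFun (Fin (r + 1))) := by
  ext i
  by_cases h0 : i = 0
  · subst h0; simp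
  by_cases h1 : i = Fin.last (r + 1)
  · subst h1
    rw [Function.comp, extPerm_last, coord_last, ← Fin.succ_last, Fin.cons_succ, Fin.snoc_last]
  obtain ⟨j, rfl⟩ := exists_mid_eq h0 h1
  simp only [Function.comp, extPerm_mid]
  change midCoord r (u j) = Fin.cons (α := fun _ => RatFun (Fin (r + 1))) (coord r 0)
    (Fin.snoc (α := fun _ => RatFun (Fin (r + 1))) (midCoord r ∘ u) 0) j.castSucc.succ
  rw [Fin.cons_succ, Fin.snoc_castSucc]
  rfl

theorem wfPi_eq {r : ℕ} (w : Equiv.Perm (Fin (r + 2))) : wfPi r w = chainInv (coord r ∘ w) := by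
  simp [wfPi, chainInv, rt_eq]

theorem symSum_eq (r k₃ : ℕ) : symSum r k₃ =
    ∑ u : Equiv.Perm (Fin r), realSign u ^ k₃ • chainInv (coord r ∘ extPerm u) := by
  unfold symSum
  have hs : ∀ u : Equiv.Perm (Fin r), realSign u ^ 2 = 1 := fun u => by
    rw [sq, realSign_mul_self]
  split_ifs with h
  · rw [sum_permS]
    refine Finset.sum_congr rfl fun u _ => ?_
    obtain ⟨m, rfl⟩ := h
    rw [wfPi_eq, sign_extPerm, pow_succ, pow_mul, hs, one_pow, one_mul]
    rfl
  · rw [sum_permS]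
    refine Finset.sum_congr rfl fun u _ => ?_
    obtain ⟨m, rfl⟩ := Nat.not_odd_iff_even.1 h
    rw [wfPi_eq, ← two_mul, pow_mul, hs, one_pow, one_smul]

theorem coord_zero_ne_zero (r : ℕ) : coord r 0 ≠ 0 := fun h =>
  (Fin.last_pos (n := r)).ne (coord_injective r (h.trans (coord_last r).symm))

theorem midCoord_ne_zero {r : ℕ} (j : Fin r) : midCoord r j ≠ 0 := fun h =>
  mid_ne_last j (coord_injective r (h.trans (coord_last r).symm))

theorem coord_zero_sub_midCoord_ne_zero {r : ℕ} (j : Fin r) : coord r 0 - midCoord r j ≠ 0 :=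
  coord_sub_ne_zero (mid_ne_zero j).symm

theorem midCoord_sub_ne_zero {r : ℕ} {i j : Fin r} (h : i ≠ j) :
    midCoord r i - midCoord r j ≠ 0 :=
  coord_sub_ne_zero ((mid_injective r).ne h)

theorem coord_inv_mem {r : ℕ} {i : Fin (r + 2)} (h : i ≠ Fin.last (r + 1)) :
    (coord r i)⁻¹ ∈ ringR (rootsA r) := by
  have := coord_sub_inv_mem h
  rwa [coord_last, sub_zero] at this

theorem zpow_mem_of_mem {K : Type*} [Field K] [Algebra ℝ K] {A : Subalgebra ℝ K} {x : K}
    (h : x ∈ A) (h' : x⁻¹ ∈ A) (m : ℤ) : x ^ m ∈ A := by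
  cases m with
  | ofNat m => rw [Int.ofNat_eq_natCast, zpow_natCast]; exact pow_mem h m
  | negSucc m => rw [zpow_negSucc, ← inv_pow]; exact pow_mem h' _

theorem coord_zero_zpow_mem (r : ℕ) (m : ℤ) : coord r 0 ^ m ∈ ringR (rootsA r) :=
  zpow_mem_of_mem (coord_mem r 0) (coord_inv_mem (Fin.last_pos (n := r)).ne) m

theorem diffProd_inv_mem (r : ℕ) : (diffProd (midCoord r))⁻¹ ∈ ringR (rootsA r) := by
  simp only [diffProd, ← Finset.prod_inv_distrib]
  refine prod_mem fun i _ => prod_mem fun j hj => coord_sub_inv_mem ((mid_injective r).ne ?_)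
  simp only [Finset.mem_filter] at hj
  exact hj.2.ne

theorem morrisDen_inv_mem (r k₁ k₂ k₃ : ℕ) :
    (morrisDen k₁ k₂ k₃ (coord r 0) (midCoord r))⁻¹ ∈ ringR (rootsA r) := by
  simp only [morrisDen, mul_inv, ← inv_pow]
  refine mul_mem (mul_mem (pow_mem ?_ _) (pow_mem ?_ _)) (pow_mem (diffProd_inv_mem r) _) <;>
    rw [← Finset.prod_inv_distrib] <;> refine prod_mem fun i _ => ?_
  · exact coord_inv_mem (mid_ne_last i)
  · exact coord_sub_inv_mem (mid_ne_zero i).symm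

theorem diffProd_ne_zero (r : ℕ) : diffProd (midCoord r) ≠ 0 := by
  refine Finset.prod_ne_zero_iff.2 fun i _ => Finset.prod_ne_zero_iff.2 fun j hj =>
    midCoord_sub_ne_zero ?_
  simp only [Finset.mem_filter] at hj
  exact hj.2.ne

theorem morrisDen_ne_zero (r k₁ k₂ k₃ : ℕ) :
    morrisDen k₁ k₂ k₃ (coord r 0) (midCoord r) ≠ 0 :=
  mul_ne_zero (mul_ne_zero
    (pow_ne_zero _ (Finset.prod_ne_zero_iff.2 fun i _ => midCoord_ne_zero i))
    (pow_ne_zero _ (Finset.prod_ne_zero_iff.2 fun i _ => coord_zero_sub_midCoord_ne_zero i)))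
    (pow_ne_zero _ (diffProd_ne_zero r))

theorem symMonomial_mem (r : ℕ) (J : Finset (Fin r)) :
    symMonomial (midCoord r) J ∈ ringR (rootsA r) :=
  sum_mem fun _ _ => prod_mem fun _ _ => coord_mem _ _

theorem morrisFun_mem (r l k₁ k₂ k₃ : ℕ) : morrisFun r l k₁ k₂ k₃ ∈ ringR (rootsA r) := by
  rw [morrisFun_eq]
  exact mul_mem (coord_zero_zpow_mem r _) (mul_mem (symMonomial_mem r _)
    (morrisDen_inv_mem r k₁ k₂ k₃))

/-- Summing the differences back from the end of the path, where the form is 0, recovers all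
coordinate forms; so the r + 1 differences span and form a basis. -/
theorem chainInv_mem_simpleS {r : ℕ} (w : Equiv.Perm (Fin (r + 2)))
    (hw : w (Fin.last (r + 1)) = Fin.last (r + 1)) :
    chainInv (coord r ∘ w) ∈ simpleS (rootsA r) := by
  classical
  let b : Fin (r + 1) → Fin (r + 1) → ℝ := fun i =>
    coordForm r (w i.castSucc) - coordForm r (w i.succ)
  have hspan : Submodule.span ℝ (Set.range b) = ⊤ := by
    have h1 : ∀ i : Fin (r + 2), coordForm r (w i) ∈ Submodule.span ℝ (Set.range b) := by
      intro i
      induction i using Fin.reverseInduction with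
      | last => rw [hw, coordForm_last]; exact zero_mem _
      | cast i ih =>
        have := add_mem (Submodule.subset_span (R := ℝ) (Set.mem_range_self (f := b) i)) ih
        simpa [b] using this
    rw [eq_top_iff, ← (Pi.basisFun ℝ (Fin (r + 1))).span_eq, Submodule.span_le]
    rintro _ ⟨i, rfl⟩
    have := h1 (w.symm i.castSucc)
    rw [Equiv.apply_symm_apply, coordForm_castSucc] at this
    simpa using this
  have hli : LinearIndependent ℝ b :=
    linearIndependent_of_top_le_span_of_card_eq_finrank hspan.ge (by simp)
  refine Submodule.subset_span ⟨Finset.univ.image b, ⟨?_, ?_, ?_⟩, ?_⟩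
  · intro α hα
    simp only [Finset.coe_image, Finset.coe_univ, Set.image_univ, Set.mem_range] at hα
    obtain ⟨i, rfl⟩ := hα
    exact ⟨_, _, w.injective.ne (Fin.castSucc_lt_succ (i := i)).ne, rfl⟩
  · have h2 : LinearIndependent ℝ (fun α : Set.range b => (α : Fin (r + 1) → ℝ)) :=
      hli.linearIndepOn_id
    have h3 : (Set.range b) = (Finset.univ.image b : Finset _) := by simp
    rw [h3] at h2
    exact h2
  · rw [Finset.coe_image, Finset.coe_univ, Set.image_univ, hspan]
  · rw [chainInv, Finset.prod_image fun i _ j _ h => hli.injective h]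
    simp [b, coord, linForm_sub]

theorem symSum_mem_simpleS (r k₃ : ℕ) : symSum r k₃ ∈ simpleS (rootsA r) := by
  rw [symSum_eq]
  exact sum_mem fun u _ => Submodule.smul_mem _ _ (chainInv_mem_simpleS _ (extPerm_last u))

end TypeA

/-! ### Symmetrization of the interaction term -/

section Symmetrization

variable {K : Type*} [Field K]

/-- A permutation carrying `J` to `J'` is absorbed by the sum. Thus P_ℓ can be written with any ℓ
positions, in particular with or without position 0. -/
theorem symMonomial_congr_card {r : ℕ} (z : Fin r → K) {J J' : Finset (Fin r)}
    (h : J.card = J'.card) : symMonomial z J = symMonomial z J' := by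
  classical
  let e : {x // x ∈ J} ≃ {x // x ∈ J'} := Finset.equivOfCardEq h
  let σ : Equiv.Perm (Fin r) := e.extendSubtype
  have hσ : J' = J.map σ.toEmbedding := by
    symm
    refine Finset.eq_of_subset_of_card_le (fun x hx => ?_) (by rw [Finset.card_map, h])
    obtain ⟨y, hy, rfl⟩ := Finset.mem_map.1 hx
    exact e.extendSubtype_mem y hy
  rw [symMonomial, symMonomial, hσ, ← Equiv.sum_comp (Equiv.mulRight σ)]
  simp

variable {n : ℕ} (z0 : K) (z : Fin (n + 1) → K)

/-- Pairing each w with its product with a transposition cancels the pole along z_{w i} − z_{w j} in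
the next lemmas. -/
theorem sum_add_sum_mul_swap (F : Equiv.Perm (Fin (n + 1)) → K) (i j : Fin (n + 1)) :
    2 * ∑ w, F w = ∑ w, (F w + F (w * Equiv.swap i j)) := by
  rw [Finset.sum_add_distrib, two_mul]
  congr 1
  exact (Equiv.sum_comp (Equiv.mulRight (Equiv.swap i j)) F).symm

theorem prod_mul_swap {J : Finset (Fin (n + 1))} {i j : Fin (n + 1)} (hi : i ∉ J) (hj : j ∉ J)
    (w : Equiv.Perm (Fin (n + 1))) :
    ∏ k ∈ J, z ((w * Equiv.swap i j) k) = ∏ k ∈ J, z (w k) := by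
  refine Finset.prod_congr rfl fun k hk => ?_
  rw [Equiv.Perm.mul_apply, Equiv.swap_apply_of_ne_of_ne]
  · rintro rfl; exact hi hk
  · rintro rfl; exact hj hk

/-- With x = z_{w 0} and y = z_{w i}, the pair contributes xy((z0 − x) − (z0 − y))/(x − y) = −xy. -/
theorem two_mul_sum_prod_of_mem (hz : Function.Injective z) {J : Finset (Fin (n + 1))}
    (h0 : 0 ∉ J) {i : Fin (n + 1)} (hi : i ∈ J) :
    2 * ∑ w : Equiv.Perm (Fin (n + 1)),
      (∏ j ∈ J, z (w j)) * ((z0 - z (w 0)) * z (w 0) * (z (w 0) - z (w i))⁻¹) =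
      -symMonomial z (insert 0 J) := by
  rw [sum_add_sum_mul_swap _ 0 i, symMonomial, ← Finset.sum_neg_distrib]
  refine Finset.sum_congr rfl fun w _ => ?_
  have h0i : 0 ≠ i := by rintro rfl; exact h0 hi
  have h1 : z (w 0) - z (w i) ≠ 0 := sub_ne_zero.2 fun h => h0i (w.injective (hz h))
  rw [Finset.prod_insert h0, ← Finset.mul_prod_erase J (fun j => z (w j)) hi,
    ← Finset.mul_prod_erase J _ hi,
    prod_mul_swap z (fun h => h0 (Finset.mem_of_mem_erase h)) (Finset.notMem_erase i J)]
  simp only [Equiv.Perm.mul_apply, Equiv.swap_apply_left, Equiv.swap_apply_right]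
  rw [← neg_sub (z (w 0)) (z (w i)), inv_neg]
  field_simp
  ring

/-- With x = z_{w 0} and y = z_{w i}, the pair contributes ((z0 − x)x − (z0 − y)y)/(x − y) = z0 − x
− y; the monomials with x and with y have the same symmetrization. -/
theorem two_mul_sum_prod_of_notMem (hz : Function.Injective z) {J : Finset (Fin (n + 1))}
    (h0 : 0 ∉ J) {i : Fin (n + 1)} (h0i : 0 ≠ i) (hi : i ∉ J) :
    2 * ∑ w : Equiv.Perm (Fin (n + 1)),
      (∏ j ∈ J, z (w j)) * ((z0 - z (w 0)) * z (w 0) * (z (w 0) - z (w i))⁻¹) =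
      z0 * symMonomial z J - 2 * symMonomial z (insert 0 J) := by
  have hcard : symMonomial z (insert i J) = symMonomial z (insert 0 J) :=
    symMonomial_congr_card z (by rw [Finset.card_insert_of_notMem h0, Finset.card_insert_of_notMem hi])
  rw [sum_add_sum_mul_swap _ 0 i, two_mul, ← sub_sub]
  nth_rewrite 2 [← hcard]
  simp only [symMonomial]
  rw [Finset.mul_sum, ← Finset.sum_sub_distrib, ← Finset.sum_sub_distrib]
  refine Finset.sum_congr rfl fun w _ => ?_
  have h1 : z (w 0) - z (w i) ≠ 0 := sub_ne_zero.2 fun h => h0i (w.injective (hz h))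
  rw [Finset.prod_insert h0, Finset.prod_insert hi, prod_mul_swap z h0 hi]
  simp only [Equiv.Perm.mul_apply, Equiv.swap_apply_left, Equiv.swap_apply_right]
  rw [← neg_sub (z (w 0)) (z (w i)), inv_neg]
  field_simp
  ring

/-- Of the n indices i ≠ 0, those in `J` and those outside it contribute by the two preceding
lemmas. -/
theorem two_mul_sum_prod_sum (hz : Function.Injective z) {J : Finset (Fin (n + 1))}
    (h0 : 0 ∉ J) :
    2 * ∑ w : Equiv.Perm (Fin (n + 1)), (∏ j ∈ J, z (w j)) *
      ∑ i ∈ Finset.univ.erase 0, ((z0 - z (w 0)) * z (w 0) * (z (w 0) - z (w i))⁻¹) =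
      ((n : K) - J.card) * (z0 * symMonomial z J - 2 * symMonomial z (insert 0 J)) -
        J.card * symMonomial z (insert 0 J) := by
  classical
  simp only [Finset.mul_sum]
  rw [Finset.sum_comm]
  have hJ : J ⊆ Finset.univ.erase 0 := fun i hi => by
    simp only [Finset.mem_erase, Finset.mem_univ, and_true]
    rintro rfl
    exact h0 hi
  rw [← Finset.sum_sdiff hJ]
  have e1 : ∀ i ∈ Finset.univ.erase 0 \ J, ∑ w : Equiv.Perm (Fin (n + 1)),
      2 * ((∏ j ∈ J, z (w j)) * ((z0 - z (w 0)) * z (w 0) * (z (w 0) - z (w i))⁻¹)) =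
      z0 * symMonomial z J - 2 * symMonomial z (insert 0 J) := by
    intro i hi
    simp only [Finset.mem_sdiff, Finset.mem_erase, Finset.mem_univ, and_true] at hi
    rw [← Finset.mul_sum]
    exact two_mul_sum_prod_of_notMem z0 z hz h0 (Ne.symm hi.1) hi.2
  have e2 : ∀ i ∈ J, ∑ w : Equiv.Perm (Fin (n + 1)),
      2 * ((∏ j ∈ J, z (w j)) * ((z0 - z (w 0)) * z (w 0) * (z (w 0) - z (w i))⁻¹)) =
      -symMonomial z (insert 0 J) := by
    intro i hi
    rw [← Finset.mul_sum]
    exact two_mul_sum_prod_of_mem z0 z hz h0 hi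
  rw [Finset.sum_congr rfl e1, Finset.sum_congr rfl e2, Finset.sum_const, Finset.sum_const,
    Finset.card_sdiff_of_subset hJ, Finset.card_erase_of_mem (Finset.mem_univ _),
    Finset.card_univ, Fintype.card_fin, Nat.add_sub_cancel, nsmul_eq_mul, nsmul_eq_mul]
  have hc : J.card ≤ n := by
    have := Finset.card_le_card hJ
    simpa using this
  rw [Nat.cast_sub hc]
  ring

end Symmetrization

/-! ### Logarithmic derivatives -/

section LogDeriv

variable {K : Type*} [Field K] [Algebra ℝ K] (D : Derivation ℝ K K)

/-- The logarithmic derivative is encoded as D f = f · g rather than as D f / f, so no nonvanishing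
is required. -/
theorem deriv_prod_of_log {ι : Type*} (s : Finset ι) (f g : ι → K)
    (h : ∀ i ∈ s, D (f i) = f i * g i) : D (∏ i ∈ s, f i) = (∏ i ∈ s, f i) * ∑ i ∈ s, g i := by
  classical
  induction s using Finset.induction_on with
  | empty => simp
  | insert a s ha ih =>
    rw [Finset.prod_insert ha, Finset.sum_insert ha, Derivation.leibniz,
      ih fun i hi => h i (Finset.mem_insert_of_mem hi), h a (Finset.mem_insert_self a s)]
    simp only [smul_eq_mul]
    ring

theorem deriv_pow_of_log {f g : K} (h : D f = f * g) (k : ℕ) : D (f ^ k) = f ^ k * (k * g) := by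
  induction k with
  | zero => simp
  | succ k ih =>
    rw [pow_succ, Derivation.leibniz, ih, h]
    simp only [smul_eq_mul]
    push_cast
    ring

theorem deriv_zpow_eq_zero {f : K} (h : D f = 0) (m : ℤ) : D (f ^ m) = 0 := by
  have hp : ∀ k : ℕ, D (f ^ k) = 0 := fun k => by
    rw [deriv_pow_of_log D (g := 0) (by rw [h, mul_zero]), mul_zero, mul_zero]
  cases m with
  | ofNat m => rw [Int.ofNat_eq_natCast, zpow_natCast]; exact hp m
  | negSucc m => rw [zpow_negSucc, Derivation.leibniz_inv, hp, smul_zero]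

theorem deriv_mul_of_log {f f' g g' : K} (h : D f = f * g) (h' : D f' = f' * g') :
    D (f * f') = f * f' * (g + g') := by
  rw [Derivation.leibniz, h, h']
  simp only [smul_eq_mul]
  ring

theorem deriv_inv_of_log {f g : K} (hf : f ≠ 0) (h : D f = f * g) : D f⁻¹ = f⁻¹ * (-g) := by
  rw [Derivation.leibniz_inv, h, smul_eq_mul]
  field_simp

variable {r : ℕ} {z0 : K} {z : Fin r → K} {a : Fin r}

/-- Only factors containing z_a contribute. Those with a in first and in second place have opposite
signs, which the orientation of z_a − z_b absorbs into one sum over b ≠ a. -/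
theorem deriv_diffProd (hz : Function.Injective z) (hD : ∀ i, D (z i) = if i = a then 1 else 0) :
    D (diffProd z) = diffProd z * ∑ b ∈ Finset.univ.erase a, (z a - z b)⁻¹ := by
  classical
  have hne : ∀ {i j}, i ≠ j → z i - z j ≠ 0 := fun h => sub_ne_zero.2 (hz.ne h)
  have h1 := deriv_prod_of_log D Finset.univ
    (fun i => ∏ j ∈ Finset.univ.filter (fun j : Fin r => i < j), (z i - z j))
    (fun i => ∑ j ∈ Finset.univ.filter (fun j : Fin r => i < j),
      ((if i = a then 1 else 0) - (if j = a then 1 else 0)) * (z i - z j)⁻¹)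
    (fun i _ => deriv_prod_of_log D _ (fun j => z i - z j) _ fun j hj => by
      simp only [Finset.mem_filter] at hj
      have := hne hj.2.ne
      rw [map_sub, hD, hD]
      field_simp)
  rw [diffProd, h1]
  congr 1
  simp only [sub_mul, Finset.sum_sub_distrib, Finset.sum_filter]
  have h2 : ∑ i : Fin r, ∑ j : Fin r,
      (if i < j then (if i = a then 1 else 0) * (z i - z j)⁻¹ else 0) =
      ∑ j : Fin r, if a < j then (z a - z j)⁻¹ else 0 := by
    rw [Finset.sum_eq_single a]
    · simp
    · intro i _ hi; simp [hi]
    · simp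
  have h3 : ∑ i : Fin r, ∑ j : Fin r,
      (if i < j then (if j = a then 1 else 0) * (z i - z j)⁻¹ else 0) =
      ∑ i : Fin r, if i < a then (z i - z a)⁻¹ else 0 := by
    refine Finset.sum_congr rfl fun i _ => ?_
    rw [Finset.sum_eq_single a]
    · simp
    · intro j _ hj; simp [hj]
    · simp
  rw [h2, h3, ← Finset.sum_sub_distrib, ← Finset.add_sum_erase _ _ (Finset.mem_univ a)]
  simp only [lt_self_iff_false, if_false, sub_zero, zero_add]
  refine Finset.sum_congr rfl fun b hb => ?_
  have hba := Finset.ne_of_mem_erase hb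
  rcases hba.lt_or_gt with h | h
  · rw [if_neg h.not_gt, if_pos h, zero_sub, ← inv_neg, neg_sub]
  · rw [if_pos h, if_neg h.not_gt, sub_zero]

theorem deriv_morrisDen_inv (hz : Function.Injective z) (hz0 : ∀ i, z i ≠ 0)
    (hz1 : ∀ i, z0 - z i ≠ 0) (h0 : D z0 = 0) (hD : ∀ i, D (z i) = if i = a then 1 else 0)
    (k₁ k₂ k₃ : ℕ) (hne : morrisDen k₁ k₂ k₃ z0 z ≠ 0) :
    D (morrisDen k₁ k₂ k₃ z0 z)⁻¹ = (morrisDen k₁ k₂ k₃ z0 z)⁻¹ *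
      -(k₁ * (z a)⁻¹ + k₂ * (-(z0 - z a)⁻¹) +
        k₃ * ∑ b ∈ Finset.univ.erase a, (z a - z b)⁻¹) := by
  classical
  refine deriv_inv_of_log D hne (deriv_mul_of_log D (deriv_mul_of_log D
    (deriv_pow_of_log D ?_ k₁) (deriv_pow_of_log D ?_ k₂))
    (deriv_pow_of_log D (deriv_diffProd D hz hD) k₃))
  · rw [deriv_prod_of_log D _ z (fun i => if i = a then (z a)⁻¹ else 0)]
    · simp
    · intro i _
      rw [hD]
      split_ifs with h
      · subst h; rw [mul_inv_cancel₀ (hz0 i)]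
      · simp
  · rw [deriv_prod_of_log D _ (fun i => z0 - z i) (fun i => if i = a then -(z0 - z a)⁻¹ else 0)]
    · simp
    · intro i _
      rw [map_sub, h0, hD]
      split_ifs with h
      · subst h; rw [mul_neg, mul_inv_cancel₀ (hz1 i), zero_sub]
      · simp

theorem deriv_prod_eq_zero (s : Finset (Fin r)) (hs : a ∉ s)
    (hD : ∀ i, D (z i) = if i = a then 1 else 0) : D (∏ i ∈ s, z i) = 0 := by
  rw [deriv_prod_of_log D s z 0]
  · simp
  · intro i hi
    rw [hD, if_neg (fun h => hs (by rwa [← h]))]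
    simp

end LogDeriv

/-! ### The recurrence in ℓ modulo derivatives -/

section Recurrence

theorem ratDeriv_coord_zero {r : ℕ} (a : Fin r) :
    ratDeriv (Pi.single a.succ (1 : ℝ)) (coord r 0) = 0 := by
  rw [← Fin.castSucc_zero, ratDeriv_coord, Fin.snoc_castSucc,
    Pi.single_eq_of_ne (Fin.succ_ne_zero a).symm, map_zero]

theorem ratDeriv_midCoord {r : ℕ} (a i : Fin r) :
    ratDeriv (Pi.single a.succ (1 : ℝ)) (midCoord r i) = if i = a then 1 else 0 := by
  rw [midCoord, mid_eq_castSucc, ratDeriv_coord, Fin.snoc_castSucc]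
  split_ifs with h
  · rw [h, Pi.single_eq_same, map_one]
  · rw [Pi.single_eq_of_ne (fun h' => h (Fin.succ_injective _ h')), map_zero]

theorem card_filter_val_lt {r l : ℕ} (h : l ≤ r) :
    (Finset.univ.filter fun j : Fin r => (j : ℕ) < l).card = l := by
  rw [Fin.card_filter_val_lt, min_eq_right h]

/-- The total derivative behind the recurrence in `ℓ`. -/
theorem sum_ratDeriv_eq (n k₁ k₂ k₃ : ℕ) {J : Finset (Fin (n + 1))} (h0 : 0 ∉ J) :
    ∑ w : Equiv.Perm (Fin (n + 1)), ratDeriv (Pi.single (w 0).succ (1 : ℝ))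
      ((coord (n + 1) 0 - midCoord (n + 1) (w 0)) * midCoord (n + 1) (w 0) *
        (∏ j ∈ J, midCoord (n + 1) (w j)) *
          (morrisDen k₁ k₂ k₃ (coord (n + 1) 0) (midCoord (n + 1)))⁻¹) =
    ((k₁ : ℝ) + k₂ - 2 + (k₃ : ℝ) / 2 * (2 * (n + 1) - (J.card + 1) - 1)) •
        (symMonomial (midCoord (n + 1)) (insert 0 J) *
          (morrisDen k₁ k₂ k₃ (coord (n + 1) 0) (midCoord (n + 1)))⁻¹) -
      ((k₁ : ℝ) - 1 + (k₃ : ℝ) / 2 * ((n + 1) - (J.card + 1))) •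
        (coord (n + 1) 0 * symMonomial (midCoord (n + 1)) J *
          (morrisDen k₁ k₂ k₃ (coord (n + 1) 0) (midCoord (n + 1)))⁻¹) := by
  set z0 := coord (n + 1) 0
  set z := midCoord (n + 1)
  set ψ := (morrisDen k₁ k₂ k₃ z0 z)⁻¹
  have hz : Function.Injective z := midCoord_injective _
  -- The prefactor (z0 − z) z cancels the poles at z = 0 and z = z0 of the logarithmic derivative;
  -- only the k₃ term keeps poles outside ψ.
  have e : ∀ w : Equiv.Perm (Fin (n + 1)), ratDeriv (Pi.single (w 0).succ (1 : ℝ))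
      ((z0 - z (w 0)) * z (w 0) * (∏ j ∈ J, z (w j)) * ψ) =
      ψ * (z0 * (∏ j ∈ J, z (w j)) * (1 - k₁) + (k₁ + k₂ - 2) * (z (w 0) * ∏ j ∈ J, z (w j)) -
        k₃ * ((∏ j ∈ J, z (w j)) * ∑ i ∈ Finset.univ.erase 0,
          ((z0 - z (w 0)) * z (w 0) * (z (w 0) - z (w i))⁻¹))) := by
    intro w
    have hψ : ratDeriv (Pi.single (w 0).succ (1 : ℝ)) ψ = ψ *
        -(k₁ * (z (w 0))⁻¹ + k₂ * (-(z0 - z (w 0))⁻¹) +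
          k₃ * ∑ b ∈ Finset.univ.erase (w 0), (z (w 0) - z b)⁻¹) := deriv_morrisDen_inv (ratDeriv (Pi.single (w 0).succ (1 : ℝ))) (a := w 0) hz
      midCoord_ne_zero coord_zero_sub_midCoord_ne_zero (ratDeriv_coord_zero _)
      (ratDeriv_midCoord _) k₁ k₂ k₃ (morrisDen_ne_zero _ _ _ _)
    have hJ : ratDeriv (Pi.single (w 0).succ (1 : ℝ)) (∏ j ∈ J, z (w j)) = 0 := by
      have := deriv_prod_eq_zero (ratDeriv (Pi.single (w 0).succ (1 : ℝ))) (a := w 0) (z := z)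
        (J.map w.toEmbedding) (by simpa using h0) (ratDeriv_midCoord _)
      rwa [Finset.prod_map] at this
    have hsum : ∑ b ∈ Finset.univ.erase (w 0), (z (w 0) - z b)⁻¹ =
        ∑ i ∈ Finset.univ.erase 0, (z (w 0) - z (w i))⁻¹ := by
      have : Finset.univ.erase (w 0) = (Finset.univ.erase 0).map w.toEmbedding := by
        rw [Finset.map_erase]; simp
      rw [this, Finset.sum_map]
      rfl
    rw [Derivation.leibniz, Derivation.leibniz, Derivation.leibniz, hψ, hJ, map_sub,
      ratDeriv_coord_zero, ratDeriv_midCoord, if_pos rfl, hsum, ← Finset.mul_sum]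
    simp only [smul_eq_mul]
    have h1 : z (w 0) ≠ 0 := midCoord_ne_zero _
    have h2 : z0 - z (w 0) ≠ 0 := coord_zero_sub_midCoord_ne_zero _
    generalize ∑ i ∈ Finset.univ.erase 0, (z (w 0) - z (w i))⁻¹ = s
    generalize z (w 0) = x at *
    field_simp
    ring
  rw [Finset.sum_congr rfl fun w _ => e w, ← Finset.mul_sum, Finset.sum_sub_distrib,
    Finset.sum_add_distrib, ← Finset.sum_mul, ← Finset.mul_sum, ← Finset.mul_sum, ← Finset.mul_sum]
  -- Symmetrization removes these last poles and leaves a combination of the sums for `J` and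
  -- `insert 0 J`.
  have h2 := two_mul_sum_prod_sum z0 z hz h0
  have h3 : ∑ w : Equiv.Perm (Fin (n + 1)), z (w 0) * ∏ j ∈ J, z (w j) =
      symMonomial z (insert 0 J) := by
    refine Finset.sum_congr rfl fun w _ => ?_
    rw [Finset.prod_insert h0]
  have h4 : ∑ w : Equiv.Perm (Fin (n + 1)), ∏ j ∈ J, z (w j) = symMonomial z J := rfl
  rw [h3, h4]
  have two : (2 : RatFun (Fin (n + 1 + 1))) ≠ 0 := two_ne_zero
  rw [mul_comm, ← eq_div_iff two] at h2
  rw [h2]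
  simp only [Algebra.smul_def]
  simp only [map_add, map_sub, map_mul, map_div₀, map_natCast, map_one, map_ofNat]
  field_simp
  ring

/-- The recurrence in `ℓ` modulo derivatives. -/
theorem morrisFun_recurrence {r l : ℕ} (k₁ k₂ k₃ : ℕ) (hl : 1 ≤ l) (hlr : l ≤ r) :
    ((k₁ : ℝ) + k₂ - 2 + (k₃ : ℝ) / 2 * (2 * r - l - 1)) • morrisFun r l k₁ k₂ k₃ -
      ((k₁ : ℝ) - 1 + (k₃ : ℝ) / 2 * (r - l)) • morrisFun r (l - 1) k₁ k₂ k₃ ∈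
      derivR (rootsA r) := by
  obtain ⟨n, rfl⟩ : ∃ n, r = n + 1 := ⟨r - 1, by omega⟩
  obtain ⟨c, rfl⟩ : ∃ c, l = c + 1 := ⟨l - 1, by omega⟩
  obtain ⟨J, hJ0, hJ⟩ : ∃ J : Finset (Fin (n + 1)), 0 ∉ J ∧ J.card = c := by
    obtain ⟨J, hJ, hc⟩ := Finset.exists_subset_card_eq
      (s := Finset.univ.erase (0 : Fin (n + 1))) (n := c) (by simp; omega)
    exact ⟨J, fun h => by simpa using hJ h, hc⟩
  have h1 := sum_ratDeriv_eq n k₁ k₂ k₃ hJ0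
  rw [hJ] at h1
  rw [morrisFun_eq, morrisFun_eq, Nat.add_sub_cancel,
    symMonomial_congr_card (midCoord (n + 1))
      (J := Finset.univ.filter fun j : Fin (n + 1) => (j : ℕ) < c + 1) (J' := insert 0 J)
      (by rw [card_filter_val_lt hlr, Finset.card_insert_of_notMem hJ0, hJ]),
    symMonomial_congr_card (midCoord (n + 1))
      (J := Finset.univ.filter fun j : Fin (n + 1) => (j : ℕ) < c) (J' := J)
      (by rw [card_filter_val_lt (by omega), hJ])]
  -- Lowering ℓ by 1 raises D by 1; this supplies the factor e^0 in front of the sum for `J`.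
  have h2 : degD (n + 1) c k₁ k₂ k₃ - (((n + 1 : ℕ) : ℤ) + 1) =
      (degD (n + 1) (c + 1) k₁ k₂ k₃ - (((n + 1 : ℕ) : ℤ) + 1)) + 1 := by
    simp only [degD]
    push_cast
    ring
  rw [h2, zpow_add_one₀ (coord_zero_ne_zero _)]
  set m := degD (n + 1) (c + 1) k₁ k₂ k₃ - (((n + 1 : ℕ) : ℤ) + 1)
  have h3 : coord (n + 1) 0 ^ m * ∑ w : Equiv.Perm (Fin (n + 1)),
      ratDeriv (Pi.single (w 0).succ (1 : ℝ))
      ((coord (n + 1) 0 - midCoord (n + 1) (w 0)) * midCoord (n + 1) (w 0) *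
        (∏ j ∈ J, midCoord (n + 1) (w j)) *
          (morrisDen k₁ k₂ k₃ (coord (n + 1) 0) (midCoord (n + 1)))⁻¹) ∈
      derivR (rootsA (n + 1)) := by
    rw [Finset.mul_sum]
    refine sum_mem fun w _ => ratDeriv_smul_mem_derivR _ ?_ (coord_zero_zpow_mem _ _) ?_
    · exact mul_mem (mul_mem (mul_mem (sub_mem (coord_mem _ _) (coord_mem _ _)) (coord_mem _ _))
        (prod_mem fun _ _ => coord_mem _ _)) (morrisDen_inv_mem _ _ _ _)
    · exact deriv_zpow_eq_zero _ (ratDeriv_coord_zero _) m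
  rw [h1] at h3
  convert h3 using 1
  simp only [Algebra.smul_def]
  push_cast
  ring

end Recurrence

/-! ### Functions that are sums of derivatives: k₁ = 0 or k₂ = 0 -/

section Vanishing

/-- Since ∂(v) e^0 = 1 and ∂(v) h = 0, a primitive is (e^0)^{k+1} h/(k + 1). -/
theorem pow_mul_mem_derivR {r : ℕ} {v : Fin (r + 1) → ℝ} (hv : ratDeriv v (coord r 0) = 1)
    {h : RatFun (Fin (r + 1))} (hh : h ∈ ringR (rootsA r)) (h0 : ratDeriv v h = 0) (k : ℕ) :
    coord r 0 ^ k * h ∈ derivR (rootsA r) := by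
  have h1 := ratDeriv_mem_derivR v (mul_mem (pow_mem (coord_mem r 0) (k + 1)) hh)
  have h2 := Submodule.smul_mem _ ((k : ℝ) + 1)⁻¹ h1
  convert h2 using 1
  rw [Derivation.leibniz, h0, Derivation.leibniz_pow, hv, Nat.add_sub_cancel, Algebra.smul_def]
  have : ((k : RatFun (Fin (r + 1))) + 1) ≠ 0 := by exact_mod_cast Nat.succ_ne_zero k
  simp only [map_inv₀, map_add, map_natCast, map_one, smul_eq_mul, nsmul_eq_mul]
  push_cast
  field_simp
  ring

theorem ratDeriv_one_coord {r : ℕ} (i : Fin (r + 1)) :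
    ratDeriv (1 : Fin (r + 1) → ℝ) (coord r i.castSucc) = 1 := by
  rw [ratDeriv_coord, Fin.snoc_castSucc, Pi.one_apply, map_one]

/-- A function with poles only along `e^i - e^j`, `i, j ≤ r`, is a sum of derivatives. -/
theorem polynomial_mul_mem_derivR {r : ℕ} (p : MvPolynomial (Fin (r + 1)) ℝ)
    {h : RatFun (Fin (r + 1))} (hh : h ∈ ringR (rootsA r))
    (h0 : ratDeriv (1 : Fin (r + 1) → ℝ) h = 0) (k : ℕ) :
    coord r 0 ^ k * (algebraMap _ (RatFun (Fin (r + 1))) p * h) ∈ derivR (rootsA r) := by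
  have hc : ratDeriv (1 : Fin (r + 1) → ℝ) (coord r 0) = 1 := ratDeriv_one_coord 0
  induction p using MvPolynomial.induction_on generalizing h k with
  | C a =>
    have : algebraMap (MvPolynomial (Fin (r + 1)) ℝ) (RatFun (Fin (r + 1))) (MvPolynomial.C a) =
        algebraMap ℝ (RatFun (Fin (r + 1))) a := by
      rw [IsScalarTower.algebraMap_apply ℝ (MvPolynomial (Fin (r + 1)) ℝ) (RatFun (Fin (r + 1)))]
      rfl
    rw [this, ← Algebra.smul_def, mul_smul_comm]
    exact Submodule.smul_mem _ _ (pow_mul_mem_derivR hc hh h0 k)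
  | add p q hp hq =>
    rw [map_add, add_mul, mul_add]
    exact add_mem (hp hh h0 k) (hq hh h0 k)
  | mul_X p i hp =>
    -- Write x_i = e^0 − (e^0 − x_i): the first term raises `k`, the second is translation invariant
    -- and joins `h`.
    have h1 := hp hh h0 (k + 1)
    have h2 := hp (h := (coord r 0 - coord r i.castSucc) * h)
      (mul_mem (sub_mem (coord_mem _ _) (coord_mem _ _)) hh)
      (by rw [Derivation.leibniz, h0, map_sub, hc, ratDeriv_one_coord]; simp) k
    convert sub_mem h1 h2 using 1
    rw [map_mul, ← coord_castSucc]
    ring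

theorem coord_eq_algebraMap (r : ℕ) (i : Fin (r + 2)) :
    coord r i = algebraMap (MvPolynomial (Fin (r + 1)) ℝ) _
      (Fin.snoc (α := fun _ => MvPolynomial (Fin (r + 1)) ℝ) MvPolynomial.X 0 i) := by
  induction i using Fin.lastCases with
  | last => simp
  | cast i => rw [coord_castSucc, Fin.snoc_castSucc]

theorem exists_symMonomial_eq (r : ℕ) (J : Finset (Fin r)) :
    ∃ p : MvPolynomial (Fin (r + 1)) ℝ, p.IsHomogeneous J.card ∧
      symMonomial (midCoord r) J = algebraMap _ _ p := by
  refine ⟨∑ w : Equiv.Perm (Fin r), ∏ j ∈ J, MvPolynomial.X (w j).succ, ?_, ?_⟩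
  · refine MvPolynomial.IsHomogeneous.sum _ _ _ fun w _ => ?_
    have := MvPolynomial.IsHomogeneous.prod J
      (fun j => (MvPolynomial.X (w j).succ : MvPolynomial (Fin (r + 1)) ℝ)) (fun _ => 1)
      (fun j _ => MvPolynomial.isHomogeneous_X _ _)
    simpa using this
  · simp only [symMonomial, map_sum, map_prod, midCoord, mid_eq_castSucc, coord_castSucc]

/-- The direction (1, …, 1) translates e^0, …, e^r together. With k₁ = 0 the denominator consists of
differences of these, which are invariant. -/
theorem ratDeriv_one_morrisDen_inv (r k₂ k₃ : ℕ) (z : Fin r → RatFun (Fin (r + 1)))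
    (hz : ∀ i, ratDeriv (1 : Fin (r + 1) → ℝ) (z i) = 1) :
    ratDeriv (1 : Fin (r + 1) → ℝ) (morrisDen 0 k₂ k₃ (coord r 0) z)⁻¹ = 0 := by
  have hc : ratDeriv (1 : Fin (r + 1) → ℝ) (coord r 0) = 1 := ratDeriv_one_coord 0
  set D := ratDeriv (1 : Fin (r + 1) → ℝ)
  have h1 : D (∏ j, (coord r 0 - z j)) = (∏ j, (coord r 0 - z j)) * ∑ j : Fin r, 0 :=
    deriv_prod_of_log D _ _ _ fun i _ => by rw [map_sub, hc, hz, sub_self, mul_zero]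
  have h2 : D (diffProd z) = diffProd z * ∑ i : Fin r, 0 :=
    deriv_prod_of_log D _ _ _ fun i _ => by
      have := deriv_prod_of_log D (Finset.univ.filter (fun j : Fin r => i < j))
        (fun j => z i - z j) 0
        fun j _ => by rw [map_sub, hz, hz, sub_self, Pi.zero_apply, mul_zero]
      simpa using this
  rw [Derivation.leibniz_inv, morrisDen, pow_zero, one_mul,
    deriv_mul_of_log D (deriv_pow_of_log D h1 k₂) (deriv_pow_of_log D h2 k₃)]
  simp

theorem ratDeriv_one_midCoord {r : ℕ} (i : Fin r) :
    ratDeriv (1 : Fin (r + 1) → ℝ) (midCoord r i) = 1 := by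
  rw [midCoord, mid_eq_castSucc]; exact ratDeriv_one_coord _

theorem morrisFun_mem_derivR_of_left {r l k₂ k₃ : ℕ}
    (h : (r : ℤ) + 1 ≤ degD r l 0 k₂ k₃) : morrisFun r l 0 k₂ k₃ ∈ derivR (rootsA r) := by
  -- The bound D ≥ r + 1 makes the power of e^0 a polynomial, so that it has a primitive.
  obtain ⟨m, hm⟩ := Int.eq_ofNat_of_zero_le (sub_nonneg.2 h)
  obtain ⟨p, -, hp⟩ := exists_symMonomial_eq r (Finset.univ.filter fun j : Fin r => (j : ℕ) < l)
  rw [morrisFun_eq, hm, zpow_natCast, hp]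
  exact polynomial_mul_mem_derivR p (morrisDen_inv_mem _ _ _ _)
    (ratDeriv_one_morrisDen_inv _ _ _ _ ratDeriv_one_midCoord) m

/-- Without the factors e^0 − e^j only the power of e^0 depends on x_0, and it is integrated in x_0.
-/
theorem morrisFun_mem_derivR_of_right {r l k₁ k₃ : ℕ}
    (h : (r : ℤ) + 1 ≤ degD r l k₁ 0 k₃) : morrisFun r l k₁ 0 k₃ ∈ derivR (rootsA r) := by
  obtain ⟨m, hm⟩ := Int.eq_ofNat_of_zero_le (sub_nonneg.2 h)
  rw [morrisFun_eq, hm, zpow_natCast]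
  set D := ratDeriv (Pi.single 0 1 : Fin (r + 1) → ℝ)
  have hc : D (coord r 0) = 1 := by
    rw [← Fin.castSucc_zero, ratDeriv_coord, Fin.snoc_castSucc, Pi.single_eq_same, map_one]
  have hz : ∀ i, D (midCoord r i) = 0 := fun i => by
    rw [midCoord, mid_eq_castSucc, ratDeriv_coord, Fin.snoc_castSucc,
      Pi.single_eq_of_ne (Fin.succ_ne_zero i), map_zero]
  refine pow_mul_mem_derivR hc (mul_mem (symMonomial_mem _ _) (morrisDen_inv_mem _ _ _ _)) ?_ m
  have h1 : ∀ (s : Finset (Fin r)) (f : Fin r → Fin r), D (∏ j ∈ s, midCoord r (f j)) = 0 := by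
    intro s f
    rw [deriv_prod_of_log D s _ 0 fun i _ => by rw [hz, Pi.zero_apply, mul_zero]]
    simp
  have h2 : D (symMonomial (midCoord r) (Finset.univ.filter fun j : Fin r => (j : ℕ) < l)) = 0 := by
    rw [symMonomial, map_sum]
    exact Finset.sum_eq_zero fun w _ => h1 _ w
  have h3 : D (diffProd (midCoord r)) = diffProd (midCoord r) * ∑ i : Fin r, 0 :=
    deriv_prod_of_log D _ _ _ fun i _ => by
      have := deriv_prod_of_log D (Finset.univ.filter (fun j : Fin r => i < j))
        (fun j => midCoord r i - midCoord r j) 0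
        fun j _ => by rw [map_sub, hz, hz, sub_self, Pi.zero_apply, mul_zero]
      simpa using this
  have h4 : D (∏ j, midCoord r j) = (∏ j, midCoord r j) * 0 := by
    rw [mul_zero]; exact h1 Finset.univ id
  rw [Derivation.leibniz, h2, Derivation.leibniz_inv, morrisDen, pow_zero, mul_one,
    deriv_mul_of_log D (deriv_pow_of_log D h4 k₁) (deriv_pow_of_log D h3 k₃)]
  simp

end Vanishing

/-! ### The sum over all paths in closed form -/

section Shuffle

variable {K : Type*} [Field K]

theorem chainInv_cons {n : ℕ} (a : K) (Y : Fin (n + 1) → K) :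
    chainInv (Fin.cons a Y : Fin (n + 2) → K) = (a - Y 0)⁻¹ * chainInv Y := by
  rw [chainInv, Fin.prod_univ_succ, mul_inv, chainInv]
  simp

theorem prod_swap_succ {n : ℕ} (p : Fin (n + 1)) (f : Fin (n + 1) → K) :
    ∏ i : Fin n, f (Equiv.swap 0 p i.succ) = ∏ j ∈ Finset.univ.erase p, f j := by
  refine (Finset.prod_map Finset.univ
    ((Fin.succEmb n).trans (Equiv.swap 0 p).toEmbedding) f).symm.trans ?_
  congr 1
  ext j
  simp only [Finset.mem_map, Finset.mem_univ, true_and, Finset.mem_erase, and_true]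
  constructor
  · rintro ⟨i, rfl⟩ h
    have h' : Equiv.swap 0 p i.succ = p := h
    rw [Equiv.swap_apply_eq_iff, Equiv.swap_apply_right] at h'
    exact Fin.succ_ne_zero i h'
  · intro h
    have : Equiv.swap 0 p j ≠ 0 := by
      rw [Ne, Equiv.swap_apply_eq_iff, Equiv.swap_apply_left]
      exact h
    refine ⟨(Equiv.swap 0 p j).pred this, ?_⟩
    simp

/-- The polynomial X^n has degree below the number of nodes and equals its Lagrange interpolant;
evaluate at z0 and divide by the nodal polynomial. -/
theorem sum_lagrange {n : ℕ} (z0 : K) (z : Fin (n + 1) → K) (hz : Function.Injective z)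
    (h0 : ∀ j, z0 ≠ z j) :
    ∑ p, (z0 - z p)⁻¹ * (z p ^ n * ∏ j ∈ Finset.univ.erase p, (z p - z j)⁻¹) =
      z0 ^ n * ∏ j, (z0 - z j)⁻¹ := by
  have h1 := Lagrange.eq_interpolate_of_eval_eq (s := Finset.univ) (v := z)
    (fun j => z j ^ n) (f := (Polynomial.X ^ n : Polynomial K)) hz.injOn
    (by rw [Polynomial.degree_X_pow, Finset.card_univ, Fintype.card_fin]; exact_mod_cast n.lt_succ_self)
    (by simp)
  have h2 := Lagrange.eval_interpolate_not_at_node (s := Finset.univ) (v := z)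
    (fun j => z j ^ n) (x := z0) (fun j _ => h0 j)
  rw [← h1, Polynomial.eval_pow, Polynomial.eval_X, Lagrange.eval_nodal] at h2
  have hne : ∏ j, (z0 - z j) ≠ 0 :=
    Finset.prod_ne_zero_iff.2 fun j _ => sub_ne_zero.2 (h0 j)
  rw [h2, Finset.prod_inv_distrib, mul_comm (∏ j, (z0 - z j)), mul_assoc, mul_inv_cancel₀ hne,
    mul_one]
  refine Finset.sum_congr rfl fun p _ => ?_
  rw [Lagrange.nodalWeight]
  ring

/-- Summing over all paths from `z0` to `0` through the points `z`. -/
theorem sum_chainInv (n : ℕ) (z0 : K) (z : Fin n → K) (hz : Function.Injective z)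
    (hz0 : ∀ j, z j ≠ 0) (h00 : z0 ≠ 0) (h0 : ∀ j, z0 ≠ z j) :
    ∑ u : Equiv.Perm (Fin n), chainInv (Fin.cons z0 (Fin.snoc (z ∘ u) 0 : Fin (n + 1) → K) :
      Fin (n + 2) → K) = z0 ^ n * z0⁻¹ * ∏ j, ((z j)⁻¹ * (z0 - z j)⁻¹) := by
  induction n generalizing z0 with
  | zero =>
    simp only [Fintype.sum_unique, chainInv_cons, pow_zero, Finset.univ_eq_empty,
      Finset.prod_empty, one_mul, mul_one]
    simp [chainInv]
    rfl
  | succ n ih =>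
    -- Split by the vertex `z p` that follows `z0`. The other points are indexed through the
    -- transposition (0 p), and the remaining sum over p is `sum_lagrange`.
    rw [← Equiv.sum_comp Equiv.Perm.decomposeFin.symm, Fintype.sum_prod_type]
    have h1 : ∀ p : Fin (n + 1), ∑ e : Equiv.Perm (Fin n), chainInv (Fin.cons z0
        (Fin.snoc (z ∘ Equiv.Perm.decomposeFin.symm (p, e)) 0 : Fin (n + 2) → K) :
          Fin (n + 3) → K) = (∏ j, (z j)⁻¹) *
            ((z0 - z p)⁻¹ * (z p ^ n * ∏ j ∈ Finset.univ.erase p, (z p - z j)⁻¹)) := by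
      intro p
      have h2 := ih (z p) (fun i => z (Equiv.swap 0 p i.succ))
        (fun i j h => Fin.succ_injective _ ((Equiv.swap 0 p).injective (hz h)))
        (fun j => hz0 _) (hz0 p) (fun j h => by
          have h3 := hz h
          rw [eq_comm, Equiv.swap_apply_eq_iff, Equiv.swap_apply_right] at h3
          exact Fin.succ_ne_zero j h3)
      rw [prod_swap_succ p fun j => (z j)⁻¹ * (z p - z j)⁻¹, Finset.prod_mul_distrib] at h2
      have h4 : ∀ e : Equiv.Perm (Fin n), (Fin.snoc (z ∘ Equiv.Perm.decomposeFin.symm (p, e)) 0 :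
          Fin (n + 2) → K) = Fin.cons (z p)
            (Fin.snoc ((fun i => z (Equiv.swap 0 p i.succ)) ∘ e) 0 : Fin (n + 1) → K) := by
        intro e
        rw [Fin.cons_snoc_eq_snoc_cons]
        congr 1
        ext i
        induction i using Fin.cases with
        | zero => simp
        | succ i => simp
      have h5 : ∀ e : Equiv.Perm (Fin n), chainInv (Fin.cons z0
        (Fin.snoc (z ∘ Equiv.Perm.decomposeFin.symm (p, e)) 0 : Fin (n + 2) → K) :
          Fin (n + 3) → K) = (z0 - z p)⁻¹ * chainInv (Fin.cons (z p)
            (Fin.snoc ((fun i => z (Equiv.swap 0 p i.succ)) ∘ e) 0 : Fin (n + 1) → K) :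
              Fin (n + 2) → K) := by
        intro e
        rw [chainInv_cons, h4, Fin.cons_zero]
      rw [Finset.sum_congr rfl fun e _ => h5 e, ← Finset.mul_sum, h2,
        ← Finset.mul_prod_erase Finset.univ _ (Finset.mem_univ p)]
      ring
    rw [Finset.sum_congr rfl fun p _ => h1 p, ← Finset.mul_sum, sum_lagrange z0 z hz h0,
      Finset.prod_mul_distrib, pow_succ]
    field_simp

end Shuffle

/-! ### The starting case: k₁ = 1 without interaction -/

section Decoupled

/-- Replacing the factors of a product of functions of one variable each, up to derivatives. -/
theorem prod_sub_prod_mem_derivR {r : ℕ} {c : RatFun (Fin (r + 1))} {A B T : Fin r → RatFun (Fin (r + 1))}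
    (hc : c ∈ ringR (rootsA r)) (hA : ∀ j, A j ∈ ringR (rootsA r))
    (hB : ∀ j, B j ∈ ringR (rootsA r)) (hT : ∀ j, T j ∈ ringR (rootsA r))
    (hDc : ∀ i : Fin r, ratDeriv (Pi.single i.succ (1 : ℝ)) c = 0)
    (hDA : ∀ i j : Fin r, j ≠ i → ratDeriv (Pi.single i.succ (1 : ℝ)) (A j) = 0)
    (hDB : ∀ i j : Fin r, j ≠ i → ratDeriv (Pi.single i.succ (1 : ℝ)) (B j) = 0)
    (hDT : ∀ j : Fin r, ratDeriv (Pi.single j.succ (1 : ℝ)) (T j) = A j - B j) :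
    c * ∏ j, A j - c * ∏ j, B j ∈ derivR (rootsA r) := by
  classical
  -- Exchange one factor at a time: enlarging `s` by `a` changes the product by a multiple of A a −
  -- B a = ∂_a (T a), and ∂_a kills the multiplier.
  have key : ∀ s : Finset (Fin r), c * ∏ j, (if j ∈ s then A j else B j) - c * ∏ j, B j ∈
      derivR (rootsA r) := by
    intro s
    induction s using Finset.induction_on with
    | empty => simp
    | insert a s ha ih =>
      have h1 : c * ∏ j, (if j ∈ insert a s then A j else B j) -
          c * ∏ j, (if j ∈ s then A j else B j) =
          (c * ∏ j ∈ Finset.univ.erase a, (if j ∈ s then A j else B j)) *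
            ratDeriv (Pi.single a.succ (1 : ℝ)) (T a) := by
        rw [hDT, ← Finset.mul_prod_erase Finset.univ _ (Finset.mem_univ a),
          ← Finset.mul_prod_erase Finset.univ (fun j => if j ∈ s then A j else B j)
            (Finset.mem_univ a), if_pos (Finset.mem_insert_self a s), if_neg ha]
        have : ∏ j ∈ Finset.univ.erase a, (if j ∈ insert a s then A j else B j) =
            ∏ j ∈ Finset.univ.erase a, (if j ∈ s then A j else B j) :=
          Finset.prod_congr rfl fun j hj => by
            simp [Finset.mem_insert, Finset.ne_of_mem_erase hj]
        rw [this]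
        ring
      have h2 : (c * ∏ j ∈ Finset.univ.erase a, (if j ∈ s then A j else B j)) *
            ratDeriv (Pi.single a.succ (1 : ℝ)) (T a) ∈ derivR (rootsA r) := by
        refine ratDeriv_smul_mem_derivR _ (hT a) (mul_mem hc (prod_mem fun j _ => ?_)) ?_
        · split_ifs
          · exact hA j
          · exact hB j
        · rw [Derivation.leibniz, hDc, deriv_prod_of_log _ _ _ 0 fun j hj => ?_]
          · simp
          · rw [Pi.zero_apply, mul_zero]
            split_ifs
            · exact hDA _ _ (Finset.ne_of_mem_erase hj)
            · exact hDB _ _ (Finset.ne_of_mem_erase hj)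
      have := add_mem (h1 ▸ h2) ih
      rwa [sub_add_sub_cancel] at this
  simpa using key Finset.univ

/-- For x = y + z, 1/(zy) = 1/(xz) + 1/(xy) lowers the order of the pole in y, up to a pure power of
y⁻¹, which is a derivative; `c` stands for the k + 1 produced by differentiating. -/
theorem partial_fraction_step {K : Type*} [Field K] {x z y c : K} (hx : x ≠ 0) (hz : z ≠ 0)
    (hy : y ≠ 0) (hc : c ≠ 0) (k : ℕ) (h : y + z = x) :
    x⁻¹ * (z⁻¹ * y⁻¹ ^ (k + 1) - x⁻¹ ^ k * (z⁻¹ * y⁻¹)) +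
      c⁻¹ * (x⁻¹ * (y⁻¹ ^ (k + 1) * (c * - -y⁻¹))) =
    z⁻¹ * y⁻¹ ^ (k + 1 + 1) - x⁻¹ ^ (k + 1) * (z⁻¹ * y⁻¹) := by
  have e1 : x⁻¹ * z⁻¹ * y⁻¹ ^ (k + 1) + x⁻¹ * y⁻¹ ^ (k + 2) = z⁻¹ * y⁻¹ ^ (k + 2) := by
    have : x⁻¹ * z⁻¹ + x⁻¹ * y⁻¹ = z⁻¹ * y⁻¹ := by
      field_simp
      exact h
    calc _ = (x⁻¹ * z⁻¹ + x⁻¹ * y⁻¹) * y⁻¹ ^ (k + 1) := by ring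
      _ = _ := by rw [this]; ring
  have e2 : c⁻¹ * (x⁻¹ * (y⁻¹ ^ (k + 1) * (c * - -y⁻¹))) = x⁻¹ * y⁻¹ ^ (k + 2) := by
    rw [neg_neg]
    calc _ = (c⁻¹ * c) * (x⁻¹ * y⁻¹ ^ (k + 2)) := by ring
      _ = _ := by rw [inv_mul_cancel₀ hc, one_mul]
  rw [e2, mul_sub, sub_add_eq_add_sub, ← mul_assoc, e1]
  ring

/-- Partial fractions in one variable. -/
theorem exists_ratDeriv_eq_partial_fraction {r : ℕ} (j : Fin r) (k : ℕ) :
    ∃ T ∈ ringR (rootsA r), ratDeriv (Pi.single j.succ (1 : ℝ)) T =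
      (midCoord r j)⁻¹ * ((coord r 0 - midCoord r j)⁻¹) ^ (k + 1) -
        ((coord r 0)⁻¹) ^ k * ((midCoord r j)⁻¹ * (coord r 0 - midCoord r j)⁻¹) := by
  have hx := coord_zero_ne_zero r
  have hz := midCoord_ne_zero j
  have hy := coord_zero_sub_midCoord_ne_zero j
  have hxm : (coord r 0)⁻¹ ∈ ringR (rootsA r) := coord_inv_mem (Fin.last_pos (n := r)).ne
  have hym : (coord r 0 - midCoord r j)⁻¹ ∈ ringR (rootsA r) :=
    coord_sub_inv_mem (mid_ne_zero j).symm
  set D := ratDeriv (Pi.single j.succ (1 : ℝ))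
  have hDx : D (coord r 0) = 0 := ratDeriv_coord_zero j
  have hDz : D (midCoord r j) = 1 := by rw [ratDeriv_midCoord, if_pos rfl]
  induction k with
  | zero => exact ⟨0, zero_mem _, by simp⟩
  | succ k ih =>
    obtain ⟨T, hT, hDT⟩ := ih
    refine ⟨(coord r 0)⁻¹ * T + ((k : ℝ) + 1)⁻¹ •
      ((coord r 0)⁻¹ * ((coord r 0 - midCoord r j)⁻¹) ^ (k + 1)),
      add_mem (mul_mem hxm hT) (Subalgebra.smul_mem _ (mul_mem hxm (pow_mem hym _)) _), ?_⟩
    have h1 : D (coord r 0)⁻¹ = 0 := by rw [Derivation.leibniz_inv, hDx, smul_zero]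
    have h2 : D (coord r 0 - midCoord r j) =
        (coord r 0 - midCoord r j) * (-(coord r 0 - midCoord r j)⁻¹) := by
      rw [map_sub, hDx, hDz, mul_neg, mul_inv_cancel₀ hy, zero_sub]
    have h3 := deriv_pow_of_log D (deriv_inv_of_log D hy h2) (k + 1)
    rw [map_add, Derivation.leibniz, h1, hDT, D.map_smul, Derivation.leibniz, h1, h3, Algebra.smul_def ((k : ℝ) + 1)⁻¹]
    have hk : ((k : RatFun (Fin (r + 1))) + 1) ≠ 0 := by exact_mod_cast Nat.succ_ne_zero k
    simp only [map_inv₀, map_add, map_natCast, map_one, smul_eq_mul, mul_zero, add_zero]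
    push_cast
    exact partial_fraction_step hx hz hy hk k (sub_add_cancel _ _)

theorem diffProd_pow_eq_one {K : Type*} [Field K] {r k₃ : ℕ} (h : k₃ = 0 ∨ r ≤ 1)
    (z : Fin r → K) : diffProd z ^ k₃ = 1 := by
  rcases h with rfl | h
  · rw [pow_zero]
  · rw [diffProd, Finset.prod_eq_one fun i _ => Finset.prod_eq_one fun j hj => ?_, one_pow]
    simp only [Finset.mem_filter] at hj
    have := hj.2
    have := i.2
    have := j.2
    omega

theorem realSign_pow_eq_one {r k₃ : ℕ} (h : k₃ = 0 ∨ r ≤ 1) (u : Equiv.Perm (Fin r)) :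
    realSign u ^ k₃ = 1 := by
  rcases h with rfl | h
  · rw [pow_zero]
  · have : Subsingleton (Fin r) := Fin.subsingleton_iff_le_one.2 h
    rw [Subsingleton.elim u 1]
    simp [realSign]

theorem symMonomial_filter_zero {K : Type*} [Field K] {r : ℕ} (z : Fin r → K) :
    symMonomial z (Finset.univ.filter fun j : Fin r => (j : ℕ) < 0) = (Nat.factorial r : K) := by
  simp [symMonomial, Fintype.card_perm]

theorem symSum_eq_of_trivial_sign {r k₃ : ℕ} (h : k₃ = 0 ∨ r ≤ 1) :
    symSum r k₃ = coord r 0 ^ r * (coord r 0)⁻¹ *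
      ∏ j, ((midCoord r j)⁻¹ * (coord r 0 - midCoord r j)⁻¹) := by
  rw [symSum_eq, ← sum_chainInv r (coord r 0) (midCoord r) (midCoord_injective r)
    midCoord_ne_zero (coord_zero_ne_zero r) fun j => sub_ne_zero.1 (coord_zero_sub_midCoord_ne_zero j)]
  refine Finset.sum_congr rfl fun u _ => ?_
  rw [realSign_pow_eq_one h, one_smul, coord_comp_extPerm]

/-- The case `k₁ = 1` without interaction between the variables. -/
theorem morrisFun_one_sub_mem {r k₂ k₃ : ℕ} (hk₂ : 1 ≤ k₂) (h : k₃ = 0 ∨ r ≤ 1) :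
    morrisFun r 0 1 k₂ k₃ - (Nat.factorial r : ℝ) • symSum r k₃ ∈ derivR (rootsA r) := by
  obtain ⟨k, rfl⟩ : ∃ k, k₂ = k + 1 := ⟨k₂ - 1, by omega⟩
  choose T hT hDT using fun j : Fin r => exists_ratDeriv_eq_partial_fraction j k
  have hx := coord_zero_ne_zero r
  have hxm : (coord r 0)⁻¹ ∈ ringR (rootsA r) := coord_inv_mem (Fin.last_pos (n := r)).ne
  have hym : ∀ j, (coord r 0 - midCoord r j)⁻¹ ∈ ringR (rootsA r) := fun j =>
    coord_sub_inv_mem (mid_ne_zero j).symm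
  have hzm : ∀ j, (midCoord r j)⁻¹ ∈ ringR (rootsA r) := fun j => coord_inv_mem (mid_ne_last j)
  have hDx : ∀ i : Fin r, ratDeriv (Pi.single i.succ (1 : ℝ)) (coord r 0) = 0 :=
    ratDeriv_coord_zero
  have hDinv : ∀ (i : Fin r) (f : RatFun (Fin (r + 1))),
      ratDeriv (Pi.single i.succ (1 : ℝ)) f = 0 → ∀ n : ℕ,
        ratDeriv (Pi.single i.succ (1 : ℝ)) (f⁻¹ ^ n) = 0 := by
    intro i f hf n
    have := deriv_zpow_eq_zero _ hf (-(n : ℤ))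
    rwa [zpow_neg, zpow_natCast, ← inv_pow] at this
  have hDinv' : ∀ (i : Fin r) (f : RatFun (Fin (r + 1))),
      ratDeriv (Pi.single i.succ (1 : ℝ)) f = 0 →
        ratDeriv (Pi.single i.succ (1 : ℝ)) f⁻¹ = 0 := fun i f hf => by
    simpa using hDinv i f hf 1
  have hDz : ∀ i j : Fin r, j ≠ i → ratDeriv (Pi.single i.succ (1 : ℝ)) (midCoord r j) = 0 :=
    fun i j hij => by rw [ratDeriv_midCoord, if_neg hij]
  have hDy : ∀ i j : Fin r, j ≠ i →
      ratDeriv (Pi.single i.succ (1 : ℝ)) (coord r 0 - midCoord r j) = 0 :=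
    fun i j hij => by rw [map_sub, hDx, hDz i j hij, sub_zero]
  have key := prod_sub_prod_mem_derivR (c := coord r 0 ^ (degD r 0 1 (k + 1) k₃ - (r + 1)))
    (coord_zero_zpow_mem r _)
    (fun j => mul_mem (hzm j) (pow_mem (hym j) (k + 1)))
    (fun j => mul_mem (pow_mem hxm k) (mul_mem (hzm j) (hym j))) hT
    (fun i => deriv_zpow_eq_zero _ (hDx i) _)
    (fun i j hij => by
      rw [Derivation.leibniz, hDinv' _ _ (hDz i j hij), hDinv _ _ (hDy i j hij), smul_zero,
        smul_zero, add_zero])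
    (fun i j hij => by
      rw [Derivation.leibniz, Derivation.leibniz, hDinv' _ _ (hDz i j hij),
        hDinv' _ _ (hDy i j hij), hDinv _ _ (hDx i), smul_zero,
        smul_zero, add_zero, smul_zero, smul_zero, add_zero])
    hDT
  have h2 := Submodule.smul_mem _ (Nat.factorial r : ℝ) key
  convert h2 using 1
  rw [smul_sub]
  congr 1
  · rw [morrisFun_eq, symMonomial_filter_zero, morrisDen, diffProd_pow_eq_one h,
      Algebra.smul_def, map_natCast, Finset.prod_mul_distrib, Finset.prod_pow,
      Finset.prod_inv_distrib, Finset.prod_inv_distrib, pow_one, mul_one, mul_inv, inv_pow]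
    ring
  · rw [symSum_eq_of_trivial_sign h, Finset.prod_mul_distrib (f := fun _ => (coord r 0)⁻¹ ^ k),
      Finset.prod_const, Finset.card_univ, Fintype.card_fin, ← mul_assoc (coord r 0 ^ (_ : ℤ))]
    congr 2
    have e1 : coord r 0 ^ r * (coord r 0)⁻¹ = coord r 0 ^ ((r : ℤ) - 1) := by
      rw [zpow_sub_one₀ hx, zpow_natCast]
    have e2 : ((coord r 0)⁻¹ ^ k) ^ r = coord r 0 ^ (-((k : ℤ) * r)) := by
      rw [← pow_mul, inv_pow, zpow_neg, ← Nat.cast_mul, zpow_natCast]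
    -- Since D = (k + 2) r here, D − (r + 1) − kr = r − 1, the exponent of e^0 in the sum over
    -- paths.
    rw [e1, e2, ← zpow_add₀ hx]
    congr 1
    have h3 : k₃ * (r * (r - 1) / 2) = 0 := by
      rcases h with h | h
      · simp [h]
      · interval_cases r <;> simp
    simp only [degD, h3]
    push_cast
    ring

end Decoupled

/-! ### Substitutions that move the origin to another vertex -/

section Restriction

/-- The coordinates as polynomials. -/
def polyCoord (r : ℕ) : Fin (r + 2) → MvPolynomial (Fin (r + 1)) ℝ :=
  Fin.snoc (α := fun _ => MvPolynomial (Fin (r + 1)) ℝ) MvPolynomial.X 0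

theorem polyCoord_last (r : ℕ) : polyCoord r (Fin.last (r + 1)) = 0 := by simp [polyCoord]

theorem polyCoord_castSucc (r : ℕ) (i : Fin (r + 1)) :
    polyCoord r i.castSucc = MvPolynomial.X i := by
  rw [polyCoord, Fin.snoc_castSucc]

theorem algebraMap_polyCoord (r : ℕ) (i : Fin (r + 2)) :
    algebraMap _ (RatFun (Fin (r + 1))) (polyCoord r i) = coord r i :=
  (coord_eq_algebraMap r i).symm

variable {n : ℕ} (W : Equiv.Perm (Fin (n + 3)))

/-- The substitution sending the vertex `a` of `A_{n+1}` to the vertex `W a` of `A_{n+2}`, on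
polynomials. -/
def substPoly : MvPolynomial (Fin (n + 1)) ℝ →ₐ[ℝ] MvPolynomial (Fin (n + 2)) ℝ :=
  MvPolynomial.aeval fun i =>
    polyCoord (n + 1) (W i.castSucc.castSucc) - polyCoord (n + 1) (W (Fin.last (n + 1)).castSucc)

theorem substPoly_polyCoord (a : Fin (n + 2)) : substPoly W (polyCoord n a) =
    polyCoord (n + 1) (W a.castSucc) - polyCoord (n + 1) (W (Fin.last (n + 1)).castSucc) := by
  induction a using Fin.lastCases with
  | last => rw [polyCoord_last, map_zero, sub_self]
  | cast i => rw [polyCoord_castSucc, substPoly, MvPolynomial.aeval_X]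

variable {W}

theorem substPoly_injective (hW : W (Fin.last (n + 2)) = Fin.last (n + 2)) :
    Function.Injective (substPoly W) := by
  -- A left inverse: relabel by W⁻¹ and send the vertex that serves as origin to 0.
  let Q : Fin (n + 3) → MvPolynomial (Fin (n + 1)) ℝ :=
    Fin.snoc (α := fun _ => MvPolynomial (Fin (n + 1)) ℝ) (polyCoord n) 0
  let ρ : MvPolynomial (Fin (n + 2)) ℝ →ₐ[ℝ] MvPolynomial (Fin (n + 1)) ℝ :=
    MvPolynomial.aeval fun j => Q (W.symm j.castSucc)
  have hρ : ∀ a : Fin (n + 2), ρ (polyCoord (n + 1) (W a.castSucc)) = polyCoord n a := by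
    intro a
    have hne : W a.castSucc ≠ Fin.last (n + 2) := fun h =>
      (Fin.castSucc_lt_last a).ne (W.injective (h.trans hW.symm))
    obtain ⟨b, hb⟩ := Fin.exists_castSucc_eq.2 hne
    rw [← hb, polyCoord_castSucc]
    simp only [ρ, MvPolynomial.aeval_X, hb, Equiv.symm_apply_apply, Q]
    rw [Fin.snoc_castSucc]
  have hcomp : ρ.comp (substPoly W) = AlgHom.id ℝ _ := by
    ext1 i
    rw [AlgHom.comp_apply, ← polyCoord_castSucc, substPoly_polyCoord, map_sub, hρ, hρ,
      polyCoord_last, sub_zero, AlgHom.id_apply]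
  intro p q h
  have := congrArg ρ h
  rwa [← AlgHom.comp_apply, ← AlgHom.comp_apply, hcomp, AlgHom.id_apply, AlgHom.id_apply] at this

theorem algebraMap_comp_substPoly_injective (hW : W (Fin.last (n + 2)) = Fin.last (n + 2)) :
    Function.Injective ((IsScalarTower.toAlgHom ℝ (MvPolynomial (Fin (n + 2)) ℝ)
      (RatFun (Fin (n + 2)))).comp (substPoly W)) := fun _ _ h =>
  substPoly_injective hW (IsFractionRing.injective (MvPolynomial (Fin (n + 2)) ℝ)
    (RatFun (Fin (n + 2))) h)

/-- The substitution `substPoly` on rational functions. -/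
def subst (hW : W (Fin.last (n + 2)) = Fin.last (n + 2)) :
    RatFun (Fin (n + 1)) →ₐ[ℝ] RatFun (Fin (n + 2)) :=
  IsFractionRing.liftAlgHom (algebraMap_comp_substPoly_injective hW)

variable (hW : W (Fin.last (n + 2)) = Fin.last (n + 2))

theorem subst_algebraMap (p : MvPolynomial (Fin (n + 1)) ℝ) :
    subst hW (algebraMap _ _ p) = algebraMap _ _ (substPoly W p) := by
  rw [subst, IsFractionRing.liftAlgHom_apply, IsFractionRing.lift_algebraMap]
  rfl

theorem subst_smul (c : ℝ) (f : RatFun (Fin (n + 1))) : subst hW (c • f) = c • subst hW f := by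
  rw [Algebra.smul_def, map_mul, AlgHom.commutes, ← Algebra.smul_def]

theorem subst_coord (a : Fin (n + 2)) : subst hW (coord n a) =
    coord (n + 1) (W a.castSucc) - coord (n + 1) (W (Fin.last (n + 1)).castSucc) := by
  rw [← algebraMap_polyCoord, subst_algebraMap, substPoly_polyCoord, map_sub,
    algebraMap_polyCoord, algebraMap_polyCoord]

theorem subst_mem_ringR {f : RatFun (Fin (n + 1))} (hf : f ∈ ringR (rootsA n)) :
    subst hW f ∈ ringR (rootsA (n + 1)) := by
  have : ringR (rootsA n) ≤ (ringR (rootsA (n + 1))).comap (subst hW) := by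
    refine Algebra.adjoin_le ?_
    rintro _ (⟨p, rfl⟩ | ⟨_, ⟨i, j, hij, rfl⟩, rfl⟩)
    · change subst hW _ ∈ ringR _
      rw [subst_algebraMap]
      exact algebraMap_mem_ringR _ _
    · change subst hW _ ∈ ringR _
      rw [map_inv₀, linForm_sub]
      change (subst hW (coord n i - coord n j))⁻¹ ∈ _
      rw [map_sub, subst_coord, subst_coord,
    sub_sub_sub_cancel_right]
      exact coord_sub_inv_mem (W.injective.ne ((Fin.castSucc_injective _).ne hij))
  exact this hf

/-- The lifted direction moves the vertex `W a` as `v` moves `a`; the vertex that serves as origin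
stays fixed. -/
theorem exists_subst_ratDeriv (v : Fin (n + 1) → ℝ) :
    ∃ v' : Fin (n + 2) → ℝ,
      (∀ f, subst hW (ratDeriv v f) = ratDeriv v' (subst hW f)) ∧
      ratDeriv v' (coord (n + 1) (W (Fin.last (n + 1)).castSucc)) = 0 := by
  let q : Fin (n + 3) → ℝ :=
    Fin.snoc (α := fun _ => ℝ) (Fin.snoc (α := fun _ => ℝ) v 0 : Fin (n + 2) → ℝ) 0
  let v' : Fin (n + 2) → ℝ := fun j => q (W.symm j.castSucc)
  have hv' : ∀ a : Fin (n + 2), ratDeriv v' (coord (n + 1) (W a.castSucc)) =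
      algebraMap ℝ _ (Fin.snoc (α := fun _ => ℝ) v 0 a) := by
    intro a
    have hne : W a.castSucc ≠ Fin.last (n + 2) := fun h =>
      (Fin.castSucc_lt_last a).ne (W.injective (h.trans hW.symm))
    obtain ⟨b, hb⟩ := Fin.exists_castSucc_eq.2 hne
    rw [ratDeriv_coord, ← hb, Fin.snoc_castSucc]
    simp only [v', q, hb, Equiv.symm_apply_apply]
    rw [Fin.snoc_castSucc]
  refine ⟨v', map_ratDeriv_of_X (subst hW) (ratDeriv v') v fun i => ?_, ?_⟩
  · rw [← coord_castSucc, subst_coord, map_sub, hv', hv', Fin.snoc_castSucc, Fin.snoc_last,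
      map_zero, sub_zero]
  · rw [hv', Fin.snoc_last, map_zero]

/-- The lifted directions kill the coordinate of the substituted origin, so its inverse can be moved
under the derivative. -/
theorem inv_mul_subst_mem_derivR {g : RatFun (Fin (n + 1))} (hg : g ∈ derivR (rootsA n)) :
    (coord (n + 1) (W (Fin.last (n + 1)).castSucc))⁻¹ * subst hW g ∈ derivR (rootsA (n + 1)) := by
  induction hg using Submodule.span_induction with
  | mem x hx =>
    obtain ⟨v, f, hf, rfl⟩ := hx
    obtain ⟨v', h1, h2⟩ := exists_subst_ratDeriv hW v
    rw [h1]
    refine ratDeriv_smul_mem_derivR v' (subst_mem_ringR hW hf) (coord_inv_mem fun h => ?_) ?_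
    · exact (Fin.castSucc_lt_last _).ne (W.injective (h.trans hW.symm))
    · rw [Derivation.leibniz_inv, h2, smul_zero]
  | zero => simp
  | add x y _ _ hx hy => rw [map_add, mul_add]; exact add_mem hx hy
  | smul a x _ hx => rw [subst_smul, mul_smul_comm]; exact Submodule.smul_mem _ _ hx

end Restriction

/-! ### Relating ranks n and n + 1 through the last vertex of a path -/

section LastVertex

/-- The permutation of `n + 1` points that fixes the last one. -/
def liftLast {n : ℕ} (u : Equiv.Perm (Fin n)) : Equiv.Perm (Fin (n + 1)) :=
  u.extendDomain (p := fun i : Fin (n + 1) => i ≠ Fin.last n) (finSuccAboveEquiv (Fin.last n))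

theorem liftLast_castSucc {n : ℕ} (u : Equiv.Perm (Fin n)) (i : Fin n) :
    liftLast u i.castSucc = (u i).castSucc := by
  have := u.extendDomain_apply_image (p := fun i : Fin (n + 1) => i ≠ Fin.last n)
    (finSuccAboveEquiv (Fin.last n)) i
  simp only [finSuccAboveEquiv_apply, Fin.succAbove_last] at this
  exact this

theorem liftLast_last {n : ℕ} (u : Equiv.Perm (Fin n)) : liftLast u (Fin.last n) = Fin.last n :=
  u.extendDomain_apply_not_subtype (p := fun i : Fin (n + 1) => i ≠ Fin.last n)
    (finSuccAboveEquiv (Fin.last n)) (by simp)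

theorem realSign_liftLast {n : ℕ} (u : Equiv.Perm (Fin n)) : realSign (liftLast u) = realSign u := by
  rw [realSign, liftLast, Equiv.Perm.sign_extendDomain, realSign]

theorem extPerm_mul {r : ℕ} (u w : Equiv.Perm (Fin r)) :
    extPerm (u * w) = extPerm u * extPerm w :=
  (Equiv.Perm.extendDomain_mul _ _ _).symm

theorem extPerm_liftLast {n : ℕ} (u : Equiv.Perm (Fin n)) (a : Fin (n + 2)) :
    extPerm (liftLast u) a.castSucc = (extPerm u a).castSucc := by
  by_cases h0 : a = 0
  · subst h0
    rw [extPerm_zero, Fin.castSucc_zero, extPerm_zero]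
  by_cases h1 : a = Fin.last (n + 1)
  · subst h1
    have : (Fin.last (n + 1)).castSucc = mid (Fin.last n) := by
      rw [mid_eq_castSucc, Fin.succ_last]
    rw [extPerm_last, this, extPerm_mid, liftLast_last]
  · obtain ⟨j, rfl⟩ := exists_mid_eq h0 h1
    have : ∀ j : Fin n, (mid j).castSucc = mid j.castSucc := fun j => by
      rw [mid_eq_castSucc, mid_eq_castSucc, Fin.succ_castSucc]
    rw [extPerm_mid, this, this, extPerm_mid, liftLast_castSucc]

theorem diffProd_succ {K : Type*} [Field K] {n : ℕ} (z : Fin (n + 1) → K) :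
    diffProd z = diffProd (fun i : Fin n => z i.castSucc) *
      ∏ i : Fin n, (z i.castSucc - z (Fin.last n)) := by
  simp only [diffProd, Finset.prod_filter]
  rw [Fin.prod_univ_castSucc]
  simp only [Fin.prod_univ_castSucc (n := n), Fin.castSucc_lt_castSucc_iff, Fin.castSucc_lt_last,
    if_true, Finset.prod_mul_distrib]
  have : ∀ i : Fin n, ¬ Fin.last n < i.castSucc := fun i => (Fin.castSucc_lt_last i).not_gt
  simp [this]

theorem chainInv_castSucc {K : Type*} [Field K] {n : ℕ} (Y : Fin (n + 2) → K) :
    chainInv Y = chainInv (fun i : Fin (n + 1) => Y i.castSucc) *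
      (Y (Fin.last n).castSucc - Y (Fin.last (n + 1)))⁻¹ := by
  rw [chainInv, Fin.prod_univ_castSucc, mul_inv, chainInv]
  rfl

variable {n : ℕ} (w : Equiv.Perm (Fin (n + 1)))

/-- After substitution the lower-rank path ends at the vertex numbered w(n); the extra factor is the
edge from there to the true origin. -/
theorem inv_mul_subst_chainInv (u : Equiv.Perm (Fin n)) :
    (midCoord (n + 1) (w (Fin.last n)))⁻¹ *
      subst (extPerm_last w) (chainInv (coord n ∘ extPerm u)) =
        chainInv (coord (n + 1) ∘ extPerm (w * liftLast u)) := by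
  have hl : (extPerm w) (Fin.last (n + 1)).castSucc = mid (w (Fin.last n)) := by
    have : (Fin.last (n + 1)).castSucc = mid (Fin.last n) := by
      rw [mid_eq_castSucc, Fin.succ_last]
    rw [this, extPerm_mid]
  rw [chainInv_castSucc (coord (n + 1) ∘ _)]
  simp only [Function.comp, extPerm_mul, Equiv.Perm.mul_apply, extPerm_liftLast, extPerm_last, hl,
    coord_last, sub_zero]
  rw [mul_comm]
  congr 1
  rw [chainInv, map_inv₀, map_prod, chainInv]
  congr 1
  refine Finset.prod_congr rfl fun i _ => ?_
  rw [map_sub, Function.comp_apply, Function.comp_apply, subst_coord, subst_coord,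
    sub_sub_sub_cancel_right]

theorem inv_mul_subst_symSum (k₃ : ℕ) :
    (midCoord (n + 1) (w (Fin.last n)))⁻¹ * subst (extPerm_last w) (symSum n k₃) =
      ∑ u : Equiv.Perm (Fin n), realSign u ^ k₃ •
        chainInv (coord (n + 1) ∘ extPerm (w * liftLast u)) := by
  rw [symSum_eq, map_sum, Finset.mul_sum]
  refine Finset.sum_congr rfl fun u _ => ?_
  rw [subst_smul, mul_smul_comm, inv_mul_subst_chainInv]

/-- Each of the n! permutations u of the first n vertices reproduces the full sum, since w ↦ w ·
`liftLast u` is a bijection. -/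
theorem sum_realSign_smul_inv_mul_subst_symSum (n k₃ : ℕ) :
    ∑ w : Equiv.Perm (Fin (n + 1)), realSign w ^ k₃ •
      ((midCoord (n + 1) (w (Fin.last n)))⁻¹ * subst (extPerm_last w) (symSum n k₃)) =
    (Nat.factorial n : ℝ) • symSum (n + 1) k₃ := by
  simp only [inv_mul_subst_symSum, Finset.smul_sum, smul_smul]
  rw [Finset.sum_comm]
  have : ∀ u : Equiv.Perm (Fin n), ∑ w : Equiv.Perm (Fin (n + 1)),
      (realSign w ^ k₃ * realSign u ^ k₃) • chainInv (coord (n + 1) ∘ extPerm (w * liftLast u)) =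
      symSum (n + 1) k₃ := by
    intro u
    rw [symSum_eq]
    refine (Finset.sum_congr rfl fun w _ => ?_).trans (Equiv.sum_comp
      (Equiv.mulRight (liftLast u)) fun w => realSign w ^ k₃ • chainInv (coord (n + 1) ∘ extPerm w))
    rw [Equiv.coe_mulRight, realSign_mul, realSign_liftLast, mul_pow]
  rw [Finset.sum_congr rfl fun u _ => this u, Finset.sum_const, Finset.card_univ,
    Fintype.card_perm, Fintype.card_fin, Nat.cast_smul_eq_nsmul]

/-- The part of the denominator without poles along `e^j - e^{r+1}`. -/
def restDen (k₂ k₃ : ℕ) : RatFun (Fin (n + 2)) :=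
  morrisDen 0 k₂ k₃ (coord (n + 1) 0) (midCoord (n + 1) ∘ w)

theorem restDen_eq (k₂ k₃ : ℕ) : restDen w k₂ k₃ =
    realSign w ^ k₃ • morrisDen 0 k₂ k₃ (coord (n + 1) 0) (midCoord (n + 1)) := by
  rw [restDen, morrisDen, diffProd_comp_perm, morrisDen, smul_pow, mul_smul_comm]
  simp only [Function.comp]
  rw [Equiv.prod_comp w (fun j => coord (n + 1) 0 - midCoord (n + 1) j), pow_zero, pow_zero]

theorem restDen_inv (k₂ k₃ : ℕ) : (restDen w k₂ k₃)⁻¹ =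
    realSign w ^ k₃ • (morrisDen 0 k₂ k₃ (coord (n + 1) 0) (midCoord (n + 1)))⁻¹ := by
  rw [restDen_eq, smul_inv₀]
  congr 1
  exact inv_eq_of_mul_eq_one_left (by rw [← mul_pow, realSign_mul_self, one_pow])

theorem restDen_inv_mem (k₂ k₃ : ℕ) : (restDen w k₂ k₃)⁻¹ ∈ ringR (rootsA (n + 1)) := by
  rw [restDen_inv]
  exact Subalgebra.smul_mem _ (morrisDen_inv_mem _ _ _ _) _

/-- The lower factors z_i become z_{w i} − z_{w n}, the missing part of the Vandermonde product;
this is why k₃ stands in the place of k₁. The power of e^0 becomes a power of e^0 − z_{w n}, whose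
exponent absorbs the k₂ factors at that vertex. -/
theorem subst_morrisFun (k₂ k₃ : ℕ) :
    (Nat.factorial n : ℝ)⁻¹ • subst (extPerm_last w) (morrisFun n 0 k₃ k₂ k₃) =
      (coord (n + 1) 0 - midCoord (n + 1) (w (Fin.last n))) ^
        (degD (n + 1) n 1 k₂ k₃ - (((n + 1 : ℕ) : ℤ) + 1)) * (restDen w k₂ k₃)⁻¹ := by
  have hl : (extPerm w) (Fin.last (n + 1)).castSucc = mid (w (Fin.last n)) := by
    have : (Fin.last (n + 1)).castSucc = mid (Fin.last n) := by
      rw [mid_eq_castSucc, Fin.succ_last]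
    rw [this, extPerm_mid]
  have h0 : subst (extPerm_last w) (coord n 0) =
      coord (n + 1) 0 - midCoord (n + 1) (w (Fin.last n)) := by
    rw [subst_coord, hl, Fin.castSucc_zero, extPerm_zero, midCoord]
  have hm : ∀ i : Fin n, subst (extPerm_last w) (midCoord n i) =
      midCoord (n + 1) (w i.castSucc) - midCoord (n + 1) (w (Fin.last n)) := by
    intro i
    have : (mid i).castSucc = mid i.castSucc := by
      rw [mid_eq_castSucc, mid_eq_castSucc, Fin.succ_castSucc]
    rw [midCoord, subst_coord, hl, this, extPerm_mid, midCoord, midCoord]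
  have hy : coord (n + 1) 0 - midCoord (n + 1) (w (Fin.last n)) ≠ 0 :=
    coord_zero_sub_midCoord_ne_zero _
  have hdiff : subst (extPerm_last w) (diffProd (midCoord n)) =
      diffProd (fun i : Fin n => midCoord (n + 1) (w i.castSucc)) := by
    simp only [diffProd, map_prod, map_sub, hm, sub_sub_sub_cancel_right]
  rw [morrisFun_eq, symMonomial_filter_zero, map_mul, map_mul, map_zpow₀, h0, map_natCast,
    map_inv₀, morrisDen, map_mul, map_mul, map_pow, map_pow, map_pow, hdiff, map_prod, map_prod]
  simp only [hm, map_sub, h0, sub_sub_sub_cancel_right]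
  rw [restDen, morrisDen, diffProd_succ, pow_zero, one_mul, Fin.prod_univ_castSucc]
  simp only [Function.comp]
  have hfac : (Nat.factorial n : RatFun (Fin (n + 2))) ≠ 0 := by
    exact_mod_cast Nat.factorial_ne_zero n
  have hdeg : degD (n + 1) n 1 k₂ k₃ - (((n + 1 : ℕ) : ℤ) + 1) =
      degD n 0 k₃ k₂ k₃ - ((n : ℤ) + 1) + k₂ := by
    have h1 : (n + 1) * (n + 1 - 1) / 2 = n * (n - 1) / 2 + n := by
      rw [Nat.add_sub_cancel, ← Nat.add_mul_div_right _ _ two_pos]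
      congr 1
      cases n with
      | zero => rfl
      | succ m => rw [Nat.add_sub_cancel]; ring
    simp only [degD, h1]
    push_cast
    ring
  rw [hdeg, zpow_add₀ hy, zpow_natCast, Algebra.smul_def, map_inv₀, map_natCast]
  simp only [mul_inv, mul_pow]
  have h2 := pow_ne_zero k₂ hy
  generalize (coord (n + 1) 0 - midCoord (n + 1) (w (Fin.last n))) ^ k₂ = y at *
  rw [show ∀ a b c d e f : RatFun (Fin (n + 2)), a * (b * (c * (d * e * f))) =
    (a * c) * (b * (d * e * f)) from fun a b c d e f => by ring, inv_mul_cancel₀ hfac, one_mul]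
  rw [show ∀ b e f g : RatFun (Fin (n + 2)), b * y * (e * y⁻¹ * (f * g)) =
    (y * y⁻¹) * (b * (g * e * f)) from fun b e f g => by ring, mul_inv_cancel₀ h2, one_mul]

end LastVertex

/-! ### The reductions at ℓ = r − 1 and ℓ = r -/

section LastStep

theorem extPerm_last_castSucc {n : ℕ} (w : Equiv.Perm (Fin (n + 1))) :
    (extPerm w) (Fin.last (n + 1)).castSucc = mid (w (Fin.last n)) := by
  have : (Fin.last (n + 1)).castSucc = mid (Fin.last n) := by
    rw [mid_eq_castSucc, Fin.succ_last]
  rw [this, extPerm_mid]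

theorem morrisDen_succ {K : Type*} [Field K] {r : ℕ} (k₁ k₂ k₃ : ℕ) (z0 : K) (z : Fin r → K) :
    morrisDen (k₁ + 1) k₂ k₃ z0 z = (∏ j, z j) * morrisDen k₁ k₂ k₃ z0 z := by
  simp only [morrisDen, pow_succ]
  ring

/-- Each monomial of the numerator cancels every pole z_j but one; reordering the rest of the
denominator by w costs the sign to the power k₃. -/
theorem morrisFun_last_eq (n k₂ k₃ : ℕ) : morrisFun (n + 1) n 1 k₂ k₃ =
    ∑ w : Equiv.Perm (Fin (n + 1)), realSign w ^ k₃ •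
      (coord (n + 1) 0 ^ (degD (n + 1) n 1 k₂ k₃ - (((n + 1 : ℕ) : ℤ) + 1)) *
        ((midCoord (n + 1) (w (Fin.last n)))⁻¹ * (restDen w k₂ k₃)⁻¹)) := by
  rw [morrisFun_eq, symMonomial, Finset.sum_mul, Finset.mul_sum]
  refine Finset.sum_congr rfl fun w _ => ?_
  have h1 : ∏ j ∈ Finset.univ.filter (fun j : Fin (n + 1) => (j : ℕ) < n), midCoord (n + 1) (w j) =
      ∏ i : Fin n, midCoord (n + 1) (w i.castSucc) := by
    rw [Finset.prod_filter, Fin.prod_univ_castSucc]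
    simp
  have h2 : ∏ i : Fin n, midCoord (n + 1) (w i.castSucc) ≠ 0 :=
    Finset.prod_ne_zero_iff.2 fun i _ => midCoord_ne_zero _
  rw [h1, morrisDen_succ, ← Equiv.prod_comp w (midCoord (n + 1)), Fin.prod_univ_castSucc,
    restDen_inv, mul_smul_comm, mul_smul_comm, smul_smul, ← mul_pow, realSign_mul_self, one_pow,
    one_smul, mul_inv, mul_inv]
  congr 1
  rw [← mul_assoc, ← mul_assoc, mul_inv_cancel₀ h2, one_mul]

/-- The difference of the m-th powers of e^0 and e^0 − z is divisible by z, which cancels the only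
pole e^j − e^{r+1}; what remains is a polynomial times a translation invariant function. -/
theorem restDen_factor_sub_mem {n : ℕ} (w : Equiv.Perm (Fin (n + 1))) (k₂ k₃ m : ℕ) :
    coord (n + 1) 0 ^ m * ((midCoord (n + 1) (w (Fin.last n)))⁻¹ * (restDen w k₂ k₃)⁻¹) -
      (midCoord (n + 1) (w (Fin.last n)))⁻¹ *
        ((coord (n + 1) 0 - midCoord (n + 1) (w (Fin.last n))) ^ m * (restDen w k₂ k₃)⁻¹) ∈
      derivR (rootsA (n + 1)) := by
  obtain ⟨q, hq⟩ := sub_dvd_pow_sub_pow (polyCoord (n + 1) 0)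
    (polyCoord (n + 1) 0 - polyCoord (n + 1) (mid (w (Fin.last n)))) m
  have h1 := congrArg (algebraMap _ (RatFun (Fin (n + 2)))) hq
  rw [sub_sub_cancel, map_sub, map_pow, map_pow, map_mul, map_sub, algebraMap_polyCoord,
    algebraMap_polyCoord] at h1
  have h2 := polynomial_mul_mem_derivR q (restDen_inv_mem w k₂ k₃)
    (ratDeriv_one_morrisDen_inv (n + 1) k₂ k₃ (midCoord (n + 1) ∘ w)
      fun i => ratDeriv_one_midCoord (w i)) 0
  rw [pow_zero, one_mul] at h2
  convert h2 using 1
  have hz : coord (n + 1) (mid (w (Fin.last n))) ≠ 0 := midCoord_ne_zero (w (Fin.last n))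
  rw [midCoord]
  calc _ = (coord (n + 1) (mid (w (Fin.last n))))⁻¹ * (coord (n + 1) 0 ^ m -
        (coord (n + 1) 0 - coord (n + 1) (mid (w (Fin.last n)))) ^ m) *
          (restDen w k₂ k₃)⁻¹ := by ring
    _ = _ := by rw [h1, ← mul_assoc, inv_mul_cancel₀ hz, one_mul]

/-- The reduction from `A_{n+2}` to `A_{n+1}`. -/
theorem morrisFun_last_sub_mem {n k₂ k₃ : ℕ} {c : ℝ}
    (h : morrisFun n 0 k₃ k₂ k₃ - c • symSum n k₃ ∈ derivR (rootsA n))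
    (hD : ((n + 1 : ℕ) : ℤ) + 1 ≤ degD (n + 1) n 1 k₂ k₃) :
    morrisFun (n + 1) n 1 k₂ k₃ - c • symSum (n + 1) k₃ ∈ derivR (rootsA (n + 1)) := by
  obtain ⟨m, hm⟩ := Int.eq_ofNat_of_zero_le (sub_nonneg.2 hD)
  have hfac : (Nat.factorial n : ℝ) ≠ 0 := by exact_mod_cast Nat.factorial_ne_zero n
  -- For each w, first replace e^0 in the power, then substitute in the lower-rank congruence; the
  -- factor 1/n! offsets P_0 = n!.
  have key : ∀ w : Equiv.Perm (Fin (n + 1)),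
      (coord (n + 1) 0 ^ (degD (n + 1) n 1 k₂ k₃ - (((n + 1 : ℕ) : ℤ) + 1)) *
        ((midCoord (n + 1) (w (Fin.last n)))⁻¹ * (restDen w k₂ k₃)⁻¹)) -
      ((Nat.factorial n : ℝ)⁻¹ * c) • ((midCoord (n + 1) (w (Fin.last n)))⁻¹ *
        subst (extPerm_last w) (symSum n k₃)) ∈ derivR (rootsA (n + 1)) := by
    intro w
    have h1 := restDen_factor_sub_mem w k₂ k₃ m
    have h2 := inv_mul_subst_mem_derivR (extPerm_last w) h
    rw [extPerm_last_castSucc, map_sub, subst_smul] at h2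
    have h3 := Submodule.smul_mem _ (Nat.factorial n : ℝ)⁻¹ h2
    have h4 := subst_morrisFun w k₂ k₃
    rw [hm, zpow_natCast] at h4 ⊢
    rw [← h4] at h1
    convert add_mem h1 h3 using 1
    rw [mul_sub, smul_sub, mul_smul_comm, mul_smul_comm, smul_smul]
    simp only [midCoord]
    abel
  have hsum := sum_realSign_smul_inv_mul_subst_symSum n k₃
  have h5 : c • symSum (n + 1) k₃ = ((Nat.factorial n : ℝ)⁻¹ * c) •
      ((Nat.factorial n : ℝ) • symSum (n + 1) k₃) := by
    rw [smul_smul]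
    congr 1
    field_simp
  rw [h5, ← hsum, morrisFun_last_eq, Finset.smul_sum, ← Finset.sum_sub_distrib]
  refine sum_mem fun w _ => ?_
  rw [smul_comm _ (realSign w ^ k₃), ← smul_sub]
  exact Submodule.smul_mem _ _ (key w)

/-- Here P_r is r! times the product of all e^j − e^{r+1}, while P_0 = r!. -/
theorem morrisFun_top (r k₁ k₂ k₃ : ℕ) :
    morrisFun r r (k₁ + 1) k₂ k₃ = morrisFun r 0 k₁ k₂ k₃ := by
  have h1 : symMonomial (midCoord r) (Finset.univ.filter fun j : Fin r => (j : ℕ) < r) =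
      (Nat.factorial r : RatFun (Fin (r + 1))) * ∏ j, midCoord r j := by
    rw [Finset.filter_true_of_mem fun j _ => j.2, symMonomial]
    simp only [Equiv.prod_comp _ (midCoord r), Finset.sum_const, Finset.card_univ,
      Fintype.card_perm, Fintype.card_fin, nsmul_eq_mul]
  have h2 : degD r r (k₁ + 1) k₂ k₃ = degD r 0 k₁ k₂ k₃ := by
    simp only [degD]; push_cast; ring
  have h3 : ∏ j, midCoord r j ≠ 0 := Finset.prod_ne_zero_iff.2 fun i _ => midCoord_ne_zero _
  rw [morrisFun_eq, morrisFun_eq, h1, h2, symMonomial_filter_zero, morrisDen_succ, mul_inv]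
  congr 1
  rw [mul_assoc, ← mul_assoc (∏ j, midCoord r j), mul_inv_cancel₀ h3, one_mul]

end LastStep

/-! ### The residue formula by induction -/

section Main

/-- The difference between the function and the value claimed for its total residue. -/
def defect (r l k₁ k₂ k₃ : ℕ) : RatFun (Fin (r + 1)) :=
  morrisFun r l k₁ k₂ k₃ - morrisConst r l k₁ k₂ k₃ • symSum r k₃

/-- Function and constant satisfy the same recurrence in ℓ, so membership of the defect in ∂(V)R can
be carried up and down in ℓ. -/
theorem defect_recurrence {r l : ℕ} (k₁ k₂ k₃ : ℕ) (hl : 1 ≤ l) (hlr : l ≤ r) :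
    ((k₁ : ℝ) + k₂ - 2 + (k₃ : ℝ) / 2 * (2 * r - l - 1)) • defect r l k₁ k₂ k₃ -
      ((k₁ : ℝ) - 1 + (k₃ : ℝ) / 2 * (r - l)) • defect r (l - 1) k₁ k₂ k₃ ∈
      derivR (rootsA r) := by
  have h1 := morrisFun_recurrence k₁ k₂ k₃ hl hlr
  have h2 := morrisRelations_morrisConst.recL r l k₁ k₂ k₃ hl hlr
  convert h1 using 1
  rw [defect, defect, smul_sub, smul_sub, smul_smul, smul_smul, h2]
  abel

theorem mem_of_smul_mem_derivR {r : ℕ} {a : ℝ} (ha : a ≠ 0) {f : RatFun (Fin (r + 1))}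
    (h : a • f ∈ derivR (rootsA r)) : f ∈ derivR (rootsA r) :=
  (Submodule.smul_mem_iff _ ha).1 h

theorem defect_zero_of_defect {r k₁ k₂ k₃ : ℕ} (L : ℕ) (hL : L ≤ r)
    (hnum : 2 ≤ k₁ ∨ (k₁ = 1 ∧ 0 < k₃ ∧ L < r)) (h : defect r L k₁ k₂ k₃ ∈ derivR (rootsA r)) :
    defect r 0 k₁ k₂ k₃ ∈ derivR (rootsA r) := by
  induction L with
  | zero => exact h
  | succ L ih =>
    refine ih (by omega) (by omega) ?_
    have h1 := defect_recurrence (r := r) (l := L + 1) k₁ k₂ k₃ (by omega) hL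
    have h2 := sub_mem (Submodule.smul_mem _
      ((k₁ : ℝ) + k₂ - 2 + (k₃ : ℝ) / 2 * (2 * r - (L + 1 : ℕ) - 1)) h) h1
    rw [sub_sub_cancel] at h2
    exact mem_of_smul_mem_derivR (recurrence_numer_ne_zero hL hnum) h2

theorem defect_of_defect_zero {r k₁ k₂ k₃ : ℕ} (h₁ : 1 ≤ k₁) (h₂ : 1 ≤ k₂)
    (hd : 2 < k₁ + k₂ ∨ (0 < k₃ ∧ 2 ≤ r)) (h : defect r 0 k₁ k₂ k₃ ∈ derivR (rootsA r))
    (l : ℕ) (hl : l ≤ r) : defect r l k₁ k₂ k₃ ∈ derivR (rootsA r) := by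
  induction l with
  | zero => exact h
  | succ l ih =>
    have h1 := defect_recurrence (r := r) (l := l + 1) k₁ k₂ k₃ (by omega) hl
    have h2 := add_mem h1 (Submodule.smul_mem _
      ((k₁ : ℝ) - 1 + (k₃ : ℝ) / 2 * (r - (l + 1 : ℕ))) (ih (by omega)))
    rw [Nat.add_sub_cancel, sub_add_cancel] at h2
    exact mem_of_smul_mem_derivR (recurrence_denom_ne_zero (by omega) hl h₁ h₂ hd) h2

theorem morrisConst_one_of_trivial_sign {r k₂ k₃ : ℕ} (hr : 1 ≤ r) (hk₂ : 1 ≤ k₂)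
    (h : k₃ = 0 ∨ r ≤ 1) : morrisConst r 0 1 k₂ k₃ = (Nat.factorial r : ℝ) := by
  rw [morrisConst_zero_index hr, Nat.cast_one]
  have h1 : morrisBase r 1 k₂ 0 = (Nat.factorial r : ℝ) := by
    have hk : (0 : ℝ) < k₂ := by exact_mod_cast hk₂
    have := (Real.Gamma_pos_of_pos hk).ne'
    simp [morrisBase, this]
  rcases h with rfl | h
  · simpa using h1
  · obtain rfl : r = 1 := by omega
    rw [morrisBase_one _ _ _ (by positivity), h1]

/-- Induction on r and k₁ as for the constants. The symmetry in k₁ and k₂ is not needed for the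
functions: the starting case k₁ = 1 is computed directly for every k₂ ≥ 1. -/
theorem defect_zero_mem (r : ℕ) (hr : 1 ≤ r) (k₁ k₂ k₃ : ℕ) (h₁ : 1 ≤ k₁) (h₂ : 1 ≤ k₂) :
    defect r 0 k₁ k₂ k₃ ∈ derivR (rootsA r) := by
  induction r, hr using Nat.le_induction generalizing k₁ k₂ k₃ with
  | base =>
    induction k₁, h₁ using Nat.le_induction with
    | base =>
      rw [defect, morrisConst_one_of_trivial_sign le_rfl h₂ (Or.inr le_rfl)]
      exact morrisFun_one_sub_mem h₂ (Or.inr le_rfl)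
    | succ k hk ih =>
      refine defect_zero_of_defect 1 le_rfl (by omega) ?_
      rw [defect, morrisFun_top,
        morrisRelations_morrisConst.recK 1 (k + 1) k₂ k₃ le_rfl (by omega), Nat.add_sub_cancel]
      exact ih
  | succ r hr ihr =>
    induction k₁, h₁ using Nat.le_induction with
    | base =>
      rcases Nat.eq_zero_or_pos k₃ with h3 | h3
      · rw [defect, morrisConst_one_of_trivial_sign (by omega) h₂ (Or.inl h3)]
        exact morrisFun_one_sub_mem h₂ (Or.inl h3)
      · refine defect_zero_of_defect r (by omega) (by omega) ?_
        have h4 := morrisRelations_morrisConst.recR (r + 1) k₂ k₃ (by omega)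
        rw [Nat.add_sub_cancel] at h4
        rw [defect, h4]
        refine morrisFun_last_sub_mem (ihr k₃ k₂ k₃ h3 h₂) ?_
        -- As 1 + k₂ ≥ 2, D is at least 2(r + 1) − r = r + 2, as the reduction in rank r + 1
        -- requires.
        have h5 : (r + 1) * 2 ≤ (1 + k₂) * (r + 1) := by
          rw [mul_comm]; exact Nat.mul_le_mul_right _ (by omega)
        simp only [degD]
        have h6 : (((r + 1) * 2 : ℕ) : ℤ) ≤
            (((1 + k₂) * (r + 1) + k₃ * ((r + 1) * (r + 1 - 1) / 2) : ℕ) : ℤ) := by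
          exact_mod_cast h5.trans (Nat.le_add_right _ _)
        refine le_trans ?_ (sub_le_sub_right h6 _)
        push_cast
        linarith
    | succ k hk ih =>
      refine defect_zero_of_defect (r + 1) le_rfl (by omega) ?_
      rw [defect, morrisFun_top,
        morrisRelations_morrisConst.recK (r + 1) (k + 1) k₂ k₃ (by omega) (by omega),
        Nat.add_sub_cancel]
      exact ih

theorem defect_mem {r l k₁ k₂ k₃ : ℕ} (hr : 1 ≤ r) (hl : l ≤ r)
    (hD : (r : ℤ) + 1 ≤ degD r l k₁ k₂ k₃) (h : ¬ (k₁ = 1 ∧ k₂ = 1 ∧ k₃ = 0 ∧ 1 ≤ l)) :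
    defect r l k₁ k₂ k₃ ∈ derivR (rootsA r) := by
  by_cases hk : k₁ = 0 ∨ k₂ = 0
  · rw [defect, morrisRelations_morrisConst.vanish r l k₁ k₂ k₃ hr hl hk, zero_smul, sub_zero]
    rcases hk with rfl | rfl
    · exact morrisFun_mem_derivR_of_left hD
    · exact morrisFun_mem_derivR_of_right hD
  have h0 := defect_zero_mem r hr k₁ k₂ k₃ (by omega) (by omega)
  by_cases hd : 2 < k₁ + k₂ ∨ (0 < k₃ ∧ 2 ≤ r)
  · exact defect_of_defect_zero (by omega) (by omega) hd h0 l hl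
  rcases Nat.eq_zero_or_pos l with rfl | hl0
  · exact h0
  -- What is left is r = ℓ = 1 with k₁ = k₂ = 1, where D = 1 < r + 1.
  · exfalso
    obtain ⟨rfl, rfl⟩ : k₁ = 1 ∧ k₂ = 1 := by omega
    obtain rfl : r = 1 := by omega
    simp [degD] at hD
    omega

end Main

/-! ### Homogeneity -/

section Homogeneity

variable {ι : Type}

theorem IsHomogeneousOfDegree.mul {f g : RatFun ι} {d e : ℤ} (hf : IsHomogeneousOfDegree f d)
    (hg : IsHomogeneousOfDegree g e) : IsHomogeneousOfDegree (f * g) (d + e) := by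
  obtain ⟨p, q, m, n, hp, hq, hq0, rfl, rfl⟩ := hf
  obtain ⟨p', q', m', n', hp', hq', hq0', rfl, rfl⟩ := hg
  refine ⟨p * p', q * q', m + m', n + n', hp.mul hp', hq.mul hq', mul_ne_zero hq0 hq0', ?_, ?_⟩
  · push_cast; ring
  · rw [map_mul, map_mul, div_mul_div_comm]

theorem IsHomogeneousOfDegree.inv {f : RatFun ι} {d : ℤ} (hf : IsHomogeneousOfDegree f d)
    (h0 : f ≠ 0) : IsHomogeneousOfDegree f⁻¹ (-d) := by
  obtain ⟨p, q, m, n, hp, hq, hq0, rfl, rfl⟩ := hf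
  refine ⟨q, p, n, m, hq, hp, ?_, by ring, by rw [inv_div]⟩
  rintro rfl
  simp at h0

theorem isHomogeneousOfDegree_algebraMap {p : MvPolynomial ι ℝ} {m : ℕ} (hp : p.IsHomogeneous m) :
    IsHomogeneousOfDegree (algebraMap _ (RatFun ι) p) m :=
  ⟨p, 1, m, 0, hp, MvPolynomial.isHomogeneous_one _ _, one_ne_zero, by simp, by simp⟩

theorem isHomogeneousOfDegree_one : IsHomogeneousOfDegree (1 : RatFun ι) 0 := by
  have := isHomogeneousOfDegree_algebraMap (MvPolynomial.isHomogeneous_one ι ℝ)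
  simpa using this

theorem IsHomogeneousOfDegree.pow {f : RatFun ι} {d : ℤ} (hf : IsHomogeneousOfDegree f d) (k : ℕ) :
    IsHomogeneousOfDegree (f ^ k) (k * d) := by
  induction k with
  | zero => simpa using isHomogeneousOfDegree_one
  | succ k ih =>
    rw [pow_succ]
    have := ih.mul hf
    convert this using 1
    push_cast
    ring

theorem IsHomogeneousOfDegree.zpow {f : RatFun ι} {d : ℤ} (hf : IsHomogeneousOfDegree f d)
    (h0 : f ≠ 0) (k : ℤ) : IsHomogeneousOfDegree (f ^ k) (k * d) := by
  cases k with
  | ofNat k => rw [Int.ofNat_eq_natCast, zpow_natCast]; exact hf.pow k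
  | negSucc k =>
    rw [zpow_negSucc]
    have := (hf.pow (k + 1)).inv (pow_ne_zero _ h0)
    convert this using 1
    rw [Int.negSucc_eq]
    push_cast
    ring

theorem isHomogeneousOfDegree_prod {κ : Type*} (s : Finset κ) (f : κ → RatFun ι) (d : κ → ℤ)
    (h : ∀ i ∈ s, IsHomogeneousOfDegree (f i) (d i)) :
    IsHomogeneousOfDegree (∏ i ∈ s, f i) (∑ i ∈ s, d i) := by
  classical
  induction s using Finset.induction_on with
  | empty => simpa using isHomogeneousOfDegree_one
  | insert a s ha ih =>
    rw [Finset.prod_insert ha, Finset.sum_insert ha]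
    exact (h a (Finset.mem_insert_self a s)).mul
      (ih fun i hi => h i (Finset.mem_insert_of_mem hi))

theorem isHomogeneous_polyCoord (r : ℕ) (i : Fin (r + 2)) : (polyCoord r i).IsHomogeneous 1 := by
  induction i using Fin.lastCases with
  | last => rw [polyCoord_last]; exact MvPolynomial.isHomogeneous_zero _ _ _
  | cast i => rw [polyCoord_castSucc]; exact MvPolynomial.isHomogeneous_X _ _

theorem isHomogeneousOfDegree_coord (r : ℕ) (i : Fin (r + 2)) :
    IsHomogeneousOfDegree (coord r i) 1 := by
  rw [← algebraMap_polyCoord]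
  exact isHomogeneousOfDegree_algebraMap (isHomogeneous_polyCoord r i)

theorem isHomogeneousOfDegree_coord_sub (r : ℕ) (i j : Fin (r + 2)) :
    IsHomogeneousOfDegree (coord r i - coord r j) 1 := by
  rw [← algebraMap_polyCoord, ← algebraMap_polyCoord, ← map_sub]
  exact isHomogeneousOfDegree_algebraMap
    ((isHomogeneous_polyCoord r i).sub (isHomogeneous_polyCoord r j))

theorem isHomogeneousOfDegree_diffProd (r : ℕ) :
    IsHomogeneousOfDegree (diffProd (midCoord r)) ((r * (r - 1) / 2 : ℕ) : ℤ) := by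
  have h1 := isHomogeneousOfDegree_prod Finset.univ
    (fun i => ∏ j ∈ Finset.univ.filter (fun j : Fin r => i < j), (midCoord r i - midCoord r j)) _
    fun i _ => isHomogeneousOfDegree_prod (Finset.univ.filter (fun j : Fin r => i < j))
      (fun j => midCoord r i - midCoord r j) (fun _ => 1)
      fun j _ => isHomogeneousOfDegree_coord_sub r (mid i) (mid j)
  have h2 : ∑ i : Fin r, ∑ _j ∈ Finset.univ.filter (fun j : Fin r => i < j), (1 : ℤ) =
      ((r * (r - 1) / 2 : ℕ) : ℤ) := by
    have h3 : ∀ i : Fin r, (Finset.univ.filter (fun j : Fin r => i < j)).card = r - 1 - i := by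
      intro i
      rw [← Fin.card_Ioi]
      congr 1
      ext j
      simp
    simp only [Finset.sum_const, h3, nsmul_eq_mul, mul_one]
    rw [← Finset.sum_range_id, ← Finset.sum_range_reflect, Nat.cast_sum,
      ← Fin.sum_univ_eq_sum_range (fun i => ((r - 1 - i : ℕ) : ℤ))]
  rw [h2] at h1
  exact h1

/-- The degree of `phi` is ℓ − (D + ℓ) = −D, which the power of e^0 corrects to −(r + 1), whatever
the sign of its exponent. -/
theorem isHomogeneousOfDegree_morrisFun {r l : ℕ} (k₁ k₂ k₃ : ℕ) (hl : l ≤ r) :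
    IsHomogeneousOfDegree (morrisFun r l k₁ k₂ k₃) (-((r : ℤ) + 1)) := by
  obtain ⟨p, hp, hpe⟩ := exists_symMonomial_eq r
    (Finset.univ.filter fun j : Fin r => (j : ℕ) < l)
  rw [card_filter_val_lt hl] at hp
  have h1 := isHomogeneousOfDegree_prod Finset.univ (midCoord r) (fun _ => 1)
    fun j _ => isHomogeneousOfDegree_coord r (mid j)
  have h2 := isHomogeneousOfDegree_prod Finset.univ (fun j => coord r 0 - midCoord r j)
    (fun _ => 1) fun j _ => isHomogeneousOfDegree_coord_sub r 0 (mid j)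
  have h3 := ((h1.pow k₁).mul (h2.pow k₂)).mul ((isHomogeneousOfDegree_diffProd r).pow k₃)
  have h4 := ((isHomogeneousOfDegree_coord r 0).zpow (coord_zero_ne_zero r)
    (degD r l k₁ k₂ k₃ - (r + 1))).mul
      ((isHomogeneousOfDegree_algebraMap hp).mul (h3.inv (morrisDen_ne_zero r k₁ k₂ k₃)))
  rw [morrisFun_eq, hpe]
  convert h4 using 1
  · rfl
  · simp only [degD, Finset.sum_const, Finset.card_univ, Fintype.card_fin, nsmul_eq_mul,
      Nat.cast_add, Nat.cast_mul]
    ring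

end Homogeneity

end TotalResidue

end

/-! ### Assembly of the theorem -/

theorem mainTheorem4 :
    -- homogeneity
    (∀ r l k₁ k₂ k₃ : ℕ, 1 ≤ r → l ≤ r →
      TotalResidue.IsHomogeneousOfDegree (TotalResidue.morrisFun r l k₁ k₂ k₃) (-((r : ℤ) + 1))) ∧
    ∃ C : ℕ → ℕ → ℕ → ℕ → ℕ → ℝ,
      -- the total residue
      (∀ r l k₁ k₂ k₃ : ℕ, 1 ≤ r → l ≤ r →
        (r : ℤ) + 1 ≤ TotalResidue.degD r l k₁ k₂ k₃ →
        ¬ (k₁ = 1 ∧ k₂ = 1 ∧ k₃ = 0 ∧ 1 ≤ l) →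
        TotalResidue.IsTotalResidue (TotalResidue.rootsA r)
          (TotalResidue.morrisFun r l k₁ k₂ k₃)
          (C r l k₁ k₂ k₃ • TotalResidue.symSum r k₃)) ∧
      -- the relations
      TotalResidue.MorrisRelations C ∧
      -- the relations determine the constants
      (∀ C' : ℕ → ℕ → ℕ → ℕ → ℕ → ℝ, TotalResidue.MorrisRelations C' →
        ∀ r l k₁ k₂ k₃ : ℕ, 1 ≤ r → l ≤ r →
          ¬ (k₁ = 1 ∧ k₂ = 1 ∧ k₃ = 0 ∧ 1 ≤ l ∧ l + 2 ≤ r) →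
          C' r l k₁ k₂ k₃ = C r l k₁ k₂ k₃) ∧
      -- closed form
      (∀ r l k₁ k₂ k₃ : ℕ, 2 ≤ r → 1 ≤ l → l ≤ r → (0 < k₃ ∨ 2 < k₁ + k₂) →
        C r l k₁ k₂ k₃ =
          (∏ j ∈ Finset.Icc 1 l,
            ((k₁ : ℝ) - 1 + ((r : ℝ) - j) * ((k₃ : ℝ) / 2)) /
              ((k₁ : ℝ) + k₂ - 2 + (2 * (r : ℝ) - j - 1) * ((k₃ : ℝ) / 2))) *
            C r 0 k₁ k₂ k₃) ∧
      (∀ r k₁ k₂ k₃ : ℕ, 2 ≤ r → 2 ≤ k₁ + k₂ →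
        C r 0 k₁ k₂ k₃ =
          (Nat.factorial r : ℝ) * ∏ j ∈ Finset.range r,
            (Real.Gamma (1 + (k₃ : ℝ) / 2) *
                Real.Gamma ((k₁ : ℝ) + k₂ - 1 + ((r : ℝ) + j - 1) * ((k₃ : ℝ) / 2))) /
              (Real.Gamma (1 + ((j : ℝ) + 1) * ((k₃ : ℝ) / 2)) *
                Real.Gamma ((k₁ : ℝ) + j * ((k₃ : ℝ) / 2)) *
                Real.Gamma ((k₂ : ℝ) + j * ((k₃ : ℝ) / 2)))) := by
  refine ⟨fun r l k₁ k₂ k₃ _ hl => TotalResidue.isHomogeneousOfDegree_morrisFun k₁ k₂ k₃ hl,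
    TotalResidue.morrisConst, fun r l k₁ k₂ k₃ hr hl hD h => ?_,
    TotalResidue.morrisRelations_morrisConst,
    fun C' hC' r l k₁ k₂ k₃ hr hl h =>
      hC'.unique TotalResidue.morrisRelations_morrisConst r l k₁ k₂ k₃ hr hl h,
    fun r l k₁ k₂ k₃ hr hl hlr hk => ?_,
    fun r k₁ k₂ k₃ hr _ => TotalResidue.morrisConst_zero_index (by omega) k₁ k₂ k₃⟩
  · exact TotalResidue.isTotalResidue_of_sub_mem (TotalResidue.morrisFun_mem r l k₁ k₂ k₃)
      (Submodule.smul_mem _ _ (TotalResidue.symSum_mem_simpleS r k₃))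
      (TotalResidue.defect_mem hr hl hD h)
  · exact TotalResidue.morrisConst_eq_ratio_mul r l k₁ k₂ k₃
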